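/- Work in the applied $\pi$-calculus over an arbitrary first-order signature and an arbitrary equational theory $=_E$ (the congruence on messages generated by the substitution instances of a set of equations). **Syntax.** Messages $M,N,K$ are terms over variables; names are variables bound by $\nu$. Processes, up to $\alpha$-conversion, are $$P,Q ::= 0 \mid \overline{M}\langle N\rangle.P \mid M(x).P \mid [M=N]P \mid [M\neq N]P \mid \nu x.P \mid P\,|\,Q \mid P+Q \mid {!P}.$$ Extended processes are $A,B::=\sigma\,|\,P \mid \nu x.A$, with $\sigma$ a (finite) active substitution; $\nu\vec x.(\sigma\,|\,P)$ is in normal form when the variables of $\mathrm{dom}(\sigma)$ are distinct from $\vec x$ and occur neither free in $P$ nor in $y\sigma$ for any variable $y$. A process $P$ is identified with $\mathrm{id}\,|\,P$, and $\nu\vec z.(\mathrm{id}\,|\,P)$ with $\nu\vec z.P$. In $A\,|\,Q$, $Q\,|\,A$, $\sigma\,|\,A$ the binders of $A$ are moved outwards, and $\sigma\,|\,(\theta\,|\,P)=\sigma\cdot\theta\,|\,P$. A substitution $\sigma$ is fresh for a set $\mathcal E$ of variables if $\mathrm{dom}(\sigma)\cap\mathcal E=\emptyset$ and $\mathrm{fv}(y\sigma)\cap\mathcal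 E=\emptyset$ for all $y\notin\mathcal E$; $\mathcal E\vDash M\neq N$ means that no $\sigma$ fresh for $\mathcal E$ has $M\sigma=_E N\sigma$. **Early transitions** $\mathcal E: P\xrightarrow{\pi}A$ have labels $\tau$, $\overline M(x)$ (with $\mathrm{bn}=\{x\}$), $M\,N$. They are given by the following rules and the symmetric rules for $|$ and $+$, where occurrences of the channel $M$ in one rule may be replaced by $=_E$-equal messages: - $\mathcal E: M(x).P\xrightarrow{M\,N}P\{N/x\}$; - $\mathcal E:\overline M\langle N\rangle.P\xrightarrow{\overline M(x)}\{N/x\}\,|\,P$ if $x\notin\mathrm{fv}(M,N,P)\cup\mathcal E$; - if $\mathcal E:P\xrightarrow{\pi}A$, then $\mathcal E: P+Q\xrightarrow{\pi}A$; $\mathcal E:[M=N]P\xrightarrow{\pi}A$ if $M=_EN$; $\mathcal E:[M\neq N]P\xrightarrow{\pi}A$ if $\mathcal E\vDash M\neq N$; $\mathcal E:P\,|\,Q\xrightarrow{\pi}A\,|\,Q$ if $\mathrm{bn}(\pi)\cap\mathrm{fv}(Q)=\emptyset$; $\mathcal E:{!P}\xrightarrow{\pi}A\,|\,{!P}$ if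 $\mathrm{bn}(\pi)\cap\mathrm{fv}(P)=\emptyset$; - if $\mathcal E\cup\{x\}:P\xrightarrow{\pi}A$ and $x$ is not in $\pi$ or $\mathcal E$, then $\mathcal E:\nu x.P\xrightarrow{\pi}\nu x.A$; - if $\mathcal E:P\xrightarrow{\overline M(x)}\nu\vec z.(\{N/x\}\,|\,P')$, $\mathcal E:Q\xrightarrow{M\,N}Q'$ and $(\{x\}\cup\vec z)\cap\mathrm{fv}(Q)=\emptyset$, then $\mathcal E:P\,|\,Q\xrightarrow{\tau}\nu\vec z.(P'\,|\,Q')$; - if $\mathcal E:P\xrightarrow{\overline M(x)}\nu\vec z.(\{N/x\}\,|\,Q)$, $\mathcal E:P\xrightarrow{M\,N}R$ and $\vec z\cap\mathrm{fv}(P)=\emptyset$, then $\mathcal E:{!P}\xrightarrow{\tau}\nu\vec z.(Q\,|\,R\,|\,{!P})$. Write $P\xrightarrow{\pi}A$ for $\emptyset:P\xrightarrow{\pi}A$. **Open barbed bisimilarity.** $P$ has barb $M$ if $P\xrightarrow{\overline M(z)}A$ for some $z,A$ or $P\xrightarrow{M\,N}A$ for some $N,A$. An open barbed bisimulation is a symmetric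 relation $\mathcal R$ on processes such that $P\mathrel{\mathcal R}Q$ implies: $\mathcal C\{P\}\mathrel{\mathcal R}\mathcal C\{Q\}$ for all contexts $\mathcal C$ (processes with one hole, possibly with mismatch, whose binders may capture variables); every barb of $P$ is a barb of $Q$; and if $P\xrightarrow{\tau}P'$ then $Q\xrightarrow{\tau}Q'$ and $P'\mathrel{\mathcal R}Q'$ for some $Q'$. Open barbed bisimilarity $\simeq$ is the greatest one. **Late transitions** are defined on the fragment without mismatch and carry no environment $\mathcal E$. Their labels are $\tau$, $\overline M(x)$, $M(x)$, the latter two with bound name $x$. The rules are the early ones (without the mismatch rule), except that input is $M(x).P\xrightarrow{M(x)}P$ (with $x$ chosen fresh by $\alpha$-conversion); that, if $P\xrightarrow{\overline M(x)}\nu\vec z.(\{N/x\}\,|\,P')$, $Q\xrightarrow{M(x)}Q'$ and $\vec z\cap\mathrm{fv}(Q)=\emptyset$, then $P\,|\,Q\xrightarrow{\tau}\nu\vec z.(P'\,|\,Q'\{N/x\})$; and that, if $P\xrightarrow{\overline M(x)}\nu\vec z.(\{N/x\}\,|\,Q)$, $P\xrightarrow{M(x)}R$ and $\vec z\cap\mathrm{fv}(P)=\emptyset$,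 then ${!P}\xrightarrow{\tau}\nu\vec z.(Q\,|\,R\{N/x\}\,|\,{!P})$. On extended processes: if $P\xrightarrow{\pi\sigma}A$ and $\sigma$ is fresh for $\mathrm{bn}(\pi)$, then $\sigma\,|\,P\xrightarrow{\pi}\sigma\,|\,A$; and if $A\xrightarrow{\pi}B$ and $x$ is not in $\pi$, then $\nu x.A\xrightarrow{\pi}\nu x.B$. **Open bisimilarity.** Histories are $h::=\epsilon\mid h\cdot x^o\mid h\cdot M^i$. A substitution $\sigma$ respects $h$ if, whenever $h=h'\cdot x^o\cdot h''$, we have $x\sigma=x$ and $x\notin\mathrm{fv}(y\sigma)$ for all $y\in\mathrm{fv}(h')$. For $A=\nu\vec x.(\theta\,|\,P)$, $A\sigma$ denotes the normal form of the capture-avoiding application: $\nu\vec x.(\theta'\,|\,(P\sigma)\theta')$, where $\theta'$ is the idempotent substitution with domain $\mathrm{dom}(\theta)$ such that $u\theta'=(u\theta\sigma)\theta'$ for $u\in\mathrm{dom}(\theta)$. Two extended processes $\nu\vec x.(\sigma\,|\,P)$ and $\nu\vec y.(\theta\,|\,Q)$ are statically equivalent if, for all messages $M,N$ in which no variable of $\vec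 x,\vec y$ occurs, $M\sigma=_EN\sigma$ iff $M\theta=_EN\theta$. An open bisimulation is a history-indexed family $\mathcal R^h$ of symmetric relations on normal-form extended processes such that, whenever $A\mathrel{\mathcal R}^hB$ and $x$ is fresh for $A,B,h$: - $A$ and $B$ are statically equivalent; - if $\sigma$ respects $h$, then $A\sigma\mathrel{\mathcal R}^{h\sigma}B\sigma$; - if $A\xrightarrow{\tau}A'$, then for some $B'$, $B\xrightarrow{\tau}B'$ and $A'\mathrel{\mathcal R}^hB'$; - if $A\xrightarrow{\overline M(x)}A'$, then for some $B'$, $B\xrightarrow{\overline M(x)}B'$ and $A'\mathrel{\mathcal R}^{h\cdot x^o}B'$; - if $A\xrightarrow{M(x)}A'$, then for some $B'$, $B\xrightarrow{M(x)}B'$ and $A'\mathrel{\mathcal R}^{h\cdot x^i}B'$. Here all transitions are late. $P\sim_oQ$ means that $P\mathrel{\mathcal R}^{x_1^i\cdots x_n^i}Q$ for some open bisimulation $\mathcal R$ and some $x_1,\dots,x_n$ with $\mathrm{fv}(P)\cup\mathrm{fv}(Q)\subseteq\{x_1,\dots,x_n\}$. **Theorem (soundness of open bisimilarity).** Let $P$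 and $Q$ be processes without mismatch. If $P\sim_oQ$, then $P\simeq Q$. -/

import Mathlib

/-!
Applied pi-calculus over an arbitrary message signature and equational theory.

Variables are natural numbers. Processes are taken up to alpha-conversion by using de Bruijn
indices for bound variables: under a binder, index `0` is the bound variable and index `n + 1` is
the variable `n` of the surrounding scope. There is no separate class of names: a name is a
variable bound by `nu`.
-/

universe u w

namespace AppliedPi

/-! ### Messages and equational theories -/

/-- Messages: first-order terms over the function symbols of `L`, with variables in `ℕ`
(relation symbols of `L` play no role). -/
abbrev Msg (L : FirstOrder.Language.{u, w}) := L.Term ℕ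

/-- Substitutions, as total maps; a variable outside of the domain is mapped to itself. -/
abbrev Subst (L : FirstOrder.Language.{u, w}) := ℕ → Msg L

section Messages

variable {L : FirstOrder.Language.{u, w}}

/-- The variable `n` as a message. -/
def v (n : ℕ) : Msg L := FirstOrder.Language.Term.var n

/-- The free variables of a message. -/
def Msg.fv (M : Msg L) : Set ℕ := {n | n ∈ M.varFinset}

/-- The identity substitution. -/
def Subst.id : Subst L := fun n => v n

/-- The substitution that maps `x` to `N` and every other variable to itself. -/
def Subst.single (x : ℕ) (N : Msg L) : Subst L := fun n => if n = x then N else v n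

/-- Composition: first `σ`, then `θ`. For active substitutions with disjoint domains and such that
no variable in the domain of `θ` occurs in the range of `σ`, this is their union. -/
def Subst.comp (σ θ : Subst L) : Subst L := fun n => (σ n).subst θ

/-- The domain of a substitution. -/
def Subst.dom (σ : Subst L) : Set ℕ := {x | σ x ≠ v x}

/-- Renaming of the variables of a message into the scope below `k` further binders. -/
def Msg.shift (k : ℕ) (M : Msg L) : Msg L := M.subst (fun n => v (n + k))

/-- The substitution `σ`, transported below one binder. -/
def Subst.up (σ : Subst L) : Subst L
  | 0 => v 0
  | n + 1 => Msg.shift 1 (σ n)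

/-- The equational theory generated by a set `Ax` of equations: the least congruence which contains
all substitution instances of `Ax`. -/
inductive EqE (Ax : Msg L → Msg L → Prop) : Msg L → Msg L → Prop
  | ax {M N : Msg L} (h : Ax M N) (σ : Subst L) : EqE Ax (M.subst σ) (N.subst σ)
  | refl (M : Msg L) : EqE Ax M M
  | symm {M N : Msg L} : EqE Ax M N → EqE Ax N M
  | trans {M N K : Msg L} : EqE Ax M N → EqE Ax N K → EqE Ax M K
  | congr {n : ℕ} (f : L.Functions n) (a b : Fin n → Msg L) :
      (∀ i, EqE Ax (a i) (b i)) →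
      EqE Ax (FirstOrder.Language.Term.func f a) (FirstOrder.Language.Term.func f b)

/-- The substitution `σ` is fresh for the set of variables `E`. -/
def Subst.FreshFor (σ : Subst L) (E : Set ℕ) : Prop :=
  Disjoint σ.dom E ∧ ∀ y, y ∉ E → Disjoint (Msg.fv (σ y)) E

/-- The (intuitionistic) entailment `E ⊨ M ≠ N`. -/
def EntailsNe (Ax : Msg L → Msg L → Prop) (E : Set ℕ) (M N : Msg L) : Prop :=
  ¬ ∃ σ : Subst L, σ.FreshFor E ∧ EqE Ax (M.subst σ) (N.subst σ)

end Messages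

/-! ### Processes and extended processes -/

/-- Processes. `inp M P` binds index `0` in `P` (not in `M`); `nu P` binds index `0` in `P`. -/
inductive Proc (L : FirstOrder.Language.{u, w}) : Type u
  | zero : Proc L
  | out (M N : Msg L) (P : Proc L) : Proc L
  | inp (M : Msg L) (P : Proc L) : Proc L
  | mat (M N : Msg L) (P : Proc L) : Proc L
  | mismat (M N : Msg L) (P : Proc L) : Proc L
  | nu (P : Proc L) : Proc L
  | par (P Q : Proc L) : Proc L
  | sum (P Q : Proc L) : Proc L
  | rep (P : Proc L) : Proc L

/-- Extended processes: an active substitution alongside a process, below some `ν`-binders. The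
conditions of normal forms are in `EProc.Normal`. -/
inductive EProc (L : FirstOrder.Language.{u, w}) : Type u
  | base (σ : Subst L) (P : Proc L) : EProc L
  | nu (A : EProc L) : EProc L

section Processes

variable {L : FirstOrder.Language.{u, w}}

/-- Capture-avoiding substitution. -/
def Proc.subst : Proc L → Subst L → Proc L
  | .zero, _ => .zero
  | .out M N P, σ => .out (M.subst σ) (N.subst σ) (P.subst σ)
  | .inp M P, σ => .inp (M.subst σ) (P.subst σ.up)
  | .mat M N P, σ => .mat (M.subst σ) (N.subst σ) (P.subst σ)
  | .mismat M N P, σ => .mismat (M.subst σ) (N.subst σ) (P.subst σ)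
  | .nu P, σ => .nu (P.subst σ.up)
  | .par P Q, σ => .par (P.subst σ) (Q.subst σ)
  | .sum P Q, σ => .sum (P.subst σ) (Q.subst σ)
  | .rep P, σ => .rep (P.subst σ)

/-- Renaming of the free variables of a process into the scope below `k` further binders. -/
def Proc.shift (k : ℕ) (P : Proc L) : Proc L := P.subst (fun n => v (n + k))

/-- The instance `P{N/0}` of the body `P` of a binder. -/
def Proc.inst (P : Proc L) (N : Msg L) : Proc L :=
  P.subst (fun n => Nat.casesOn n N (fun m => v m))

/-- The free variables of a process. -/
def Proc.fv : Proc L → Set ℕ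
  | .zero => ∅
  | .out M N P => Msg.fv M ∪ Msg.fv N ∪ P.fv
  | .inp M P => Msg.fv M ∪ {n | n + 1 ∈ P.fv}
  | .mat M N P => Msg.fv M ∪ Msg.fv N ∪ P.fv
  | .mismat M N P => Msg.fv M ∪ Msg.fv N ∪ P.fv
  | .nu P => {n | n + 1 ∈ P.fv}
  | .par P Q => P.fv ∪ Q.fv
  | .sum P Q => P.fv ∪ Q.fv
  | .rep P => P.fv

/-- The fragment without mismatch. -/
def Proc.MismatchFree : Proc L → Prop
  | .zero => True
  | .out _ _ P => P.MismatchFree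
  | .inp _ P => P.MismatchFree
  | .mat _ _ P => P.MismatchFree
  | .mismat _ _ _ => False
  | .nu P => P.MismatchFree
  | .par P Q => P.MismatchFree ∧ Q.MismatchFree
  | .sum P Q => P.MismatchFree ∧ Q.MismatchFree
  | .rep P => P.MismatchFree

/-- The renaming that turns the variable `x` into the index bound by a new binder. -/
def bindVar (x : ℕ) : Subst L := fun n => if n = x then v 0 else v (n + 1)

/-- `νx.P`, where `x` is a free variable of the scope. -/
def Proc.nuVar (x : ℕ) (P : Proc L) : Proc L := .nu (P.subst (bindVar x))

/-- `M(x).P`, where `x` is a free variable of the scope. -/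
def Proc.inpVar (M : Msg L) (x : ℕ) (P : Proc L) : Proc L := .inp M (P.subst (bindVar x))

/-- `ν z₁ … z_k. A`. -/
def EProc.nus : ℕ → EProc L → EProc L
  | 0, A => A
  | k + 1, A => .nu (EProc.nus k A)

/-- `A | Q`, with the binders of `A` moved outwards. -/
def EProc.parR : EProc L → Proc L → EProc L
  | .base σ P, Q => .base σ (.par P Q)
  | .nu A, Q => .nu (A.parR (Q.shift 1))

/-- `P | A`, with the binders of `A` moved outwards. -/
def EProc.parL : Proc L → EProc L → EProc L
  | P, .base σ Q => .base σ (.par P Q)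
  | P, .nu A => .nu (EProc.parL (P.shift 1) A)

/-- `σ | A`, with the binders of `A` moved outwards. -/
def EProc.addSubst : Subst L → EProc L → EProc L
  | σ, .base θ P => .base (σ.comp θ) P
  | σ, .nu A => .nu (EProc.addSubst σ.up A)

/-- Capture-avoiding substitution in the process part of an extended process; used only for
extended processes whose active substitution is the identity. -/
def EProc.substProc : EProc L → Subst L → EProc L
  | .base θ P, σ => .base θ (P.subst σ)
  | .nu A, σ => .nu (A.substProc σ.up)

/-- A process as an extended process, with the identity as its active substitution. -/
def Proc.toEProc (P : Proc L) : EProc L := .base Subst.id P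

/-- The process part `ν z.P` of an extended process `ν z.(σ | P)`. -/
def EProc.toProc : EProc L → Proc L
  | .base _ P => P
  | .nu A => .nu A.toProc

/-- The free variables of an extended process. -/
def EProc.fv : EProc L → Set ℕ
  | .base σ P => σ.dom ∪ {n | ∃ y ∈ σ.dom, n ∈ Msg.fv (σ y)} ∪ P.fv
  | .nu A => {n | n + 1 ∈ A.fv}

/-- Normal form below `k` binders: the domain of the active substitution is finite and its
variables are fresh for the binders, for the process and for the range of the substitution. -/
def EProc.NormalAt : ℕ → EProc L → Prop
  | k, .base σ P => σ.dom.Finite ∧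
      ∀ x ∈ σ.dom, k ≤ x ∧ x ∉ P.fv ∧ ∀ y, x ∉ Msg.fv (σ y)
  | k, .nu A => EProc.NormalAt (k + 1) A

/-- Extended processes in normal form. -/
def EProc.Normal (A : EProc L) : Prop := EProc.NormalAt 0 A

end Processes

/-! ### The open early labelled transition system -/

/-- Early actions: progress, bound output `M̄(x)` and free input `M N`. -/
inductive Act (L : FirstOrder.Language.{u, w}) : Type u
  | tau : Act L
  | out (M : Msg L) (x : ℕ) : Act L
  | inp (M N : Msg L) : Act L

section Early

variable {L : FirstOrder.Language.{u, w}}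

/-- The bound names of an action. -/
def Act.bn : Act L → Set ℕ
  | .tau => ∅
  | .out _ x => {x}
  | .inp _ _ => ∅

/-- An action, seen in the scope below one further binder. The shifted actions are exactly the
actions in whose names the new bound variable does not occur. -/
def Act.shift : Act L → Act L
  | .tau => .tau
  | .out M x => .out (Msg.shift 1 M) (x + 1)
  | .inp M N => .inp (Msg.shift 1 M) (Msg.shift 1 N)

/-- Substitution in an action; the bound name is left unchanged. -/
def Act.subst : Act L → Subst L → Act L
  | .tau, _ => .tau
  | .out M x, σ => .out (M.subst σ) x
  | .inp M N, σ => .inp (M.subst σ) (N.subst σ)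

/-- The environment `E, x` in the scope of a binder for `x`. -/
def extendEnv (E : Set ℕ) : Set ℕ := insert 0 (Nat.succ '' E)

/-- Early transitions `E : P ⟶ A` with label `π` of processes. -/
inductive Step (Ax : Msg L → Msg L → Prop) : Set ℕ → Proc L → Act L → EProc L → Prop
  | inp {E : Set ℕ} {M M' : Msg L} (N : Msg L) {P : Proc L} :
      EqE Ax M M' →
      Step Ax E (.inp M P) (.inp M' N) (P.inst N).toEProc
  | out {E : Set ℕ} {M M' N : Msg L} {P : Proc L} {x : ℕ} :
      EqE Ax M M' →
      x ∉ Msg.fv M ∪ Msg.fv M' ∪ Msg.fv N ∪ P.fv ∪ E →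
      Step Ax E (.out M N P) (.out M' x) (.base (Subst.single x N) P)
  | sumL {E : Set ℕ} {P Q : Proc L} {π : Act L} {A : EProc L} :
      Step Ax E P π A → Step Ax E (.sum P Q) π A
  | sumR {E : Set ℕ} {P Q : Proc L} {π : Act L} {A : EProc L} :
      Step Ax E Q π A → Step Ax E (.sum P Q) π A
  | mat {E : Set ℕ} {M N : Msg L} {P : Proc L} {π : Act L} {A : EProc L} :
      Step Ax E P π A → EqE Ax M N → Step Ax E (.mat M N P) π A
  | mismat {E : Set ℕ} {M N : Msg L} {P : Proc L} {π : Act L} {A : EProc L} :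
      Step Ax E P π A → EntailsNe Ax E M N → Step Ax E (.mismat M N P) π A
  | res {E : Set ℕ} {P : Proc L} {π : Act L} {A : EProc L} :
      Step Ax (extendEnv E) P π.shift A → Step Ax E (.nu P) π (.nu A)
  | parL {E : Set ℕ} {P Q : Proc L} {π : Act L} {A : EProc L} :
      Step Ax E P π A → Disjoint π.bn Q.fv → Step Ax E (.par P Q) π (A.parR Q)
  | parR {E : Set ℕ} {P Q : Proc L} {π : Act L} {A : EProc L} :
      Step Ax E Q π A → Disjoint π.bn P.fv → Step Ax E (.par P Q) π (EProc.parL P A)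
  | repAct {E : Set ℕ} {P : Proc L} {π : Act L} {A : EProc L} :
      Step Ax E P π A → Disjoint π.bn P.fv → Step Ax E (.rep P) π (A.parR (.rep P))
  | closeL {E : Set ℕ} {P Q P' : Proc L} {A : EProc L} {M M' N : Msg L} {x k : ℕ} :
      Step Ax E P (.out M x) (EProc.nus k (.base (Subst.single (x + k) N) P')) →
      Step Ax ((· + k) '' E) (Q.shift k) (.inp (Msg.shift k M') N) A →
      EqE Ax M M' → x ∉ Q.fv →
      Step Ax E (.par P Q) .tau (EProc.nus k (EProc.parL P' A))
  | closeR {E : Set ℕ} {P Q Q' : Proc L} {A : EProc L} {M M' N : Msg L} {x k : ℕ} :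
      Step Ax E Q (.out M x) (EProc.nus k (.base (Subst.single (x + k) N) Q')) →
      Step Ax ((· + k) '' E) (P.shift k) (.inp (Msg.shift k M') N) A →
      EqE Ax M M' → x ∉ P.fv →
      Step Ax E (.par P Q) .tau (EProc.nus k (A.parR Q'))
  | repClose {E : Set ℕ} {P Q : Proc L} {A : EProc L} {M M' N : Msg L} {x k : ℕ} :
      Step Ax E P (.out M x) (EProc.nus k (.base (Subst.single (x + k) N) Q)) →
      Step Ax ((· + k) '' E) (P.shift k) (.inp (Msg.shift k M') N) A →
      EqE Ax M M' →
      Step Ax E (.rep P) .tau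
        (EProc.nus k ((EProc.parL Q A).parR ((Proc.rep P).shift k)))

/-! ### Open barbed bisimilarity -/

/-- The barb `P ↓ M`. -/
def HasBarb (Ax : Msg L → Msg L → Prop) (P : Proc L) (M : Msg L) : Prop :=
  (∃ (z : ℕ) (A : EProc L), Step Ax ∅ P (.out M z) A) ∨
  (∃ (N : Msg L) (A : EProc L), Step Ax ∅ P (.inp M N) A)

/-- `τ`-transitions between processes. A `τ`-transition leads to an extended process `ν z.(id | Q)`, which
is identified with the process `ν z.Q`. -/
def TauStep (Ax : Msg L → Msg L → Prop) (P P' : Proc L) : Prop :=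
  ∃ A : EProc L, Step Ax ∅ P .tau A ∧ P' = A.toProc

end Early

/-- Process contexts: processes with one hole. The binders of a context may capture any free
variable of the process in the hole. -/
inductive Ctx (L : FirstOrder.Language.{u, w}) : Type u
  | hole : Ctx L
  | out (M N : Msg L) (C : Ctx L) : Ctx L
  | inp (M : Msg L) (x : ℕ) (C : Ctx L) : Ctx L
  | mat (M N : Msg L) (C : Ctx L) : Ctx L
  | mismat (M N : Msg L) (C : Ctx L) : Ctx L
  | nu (x : ℕ) (C : Ctx L) : Ctx L
  | parL (C : Ctx L) (Q : Proc L) : Ctx L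
  | parR (P : Proc L) (C : Ctx L) : Ctx L
  | sumL (C : Ctx L) (Q : Proc L) : Ctx L
  | sumR (P : Proc L) (C : Ctx L) : Ctx L
  | rep (C : Ctx L) : Ctx L

section Barbed

variable {L : FirstOrder.Language.{u, w}}

/-- The process obtained by placing `P` into the hole of a context. -/
def Ctx.fill : Ctx L → Proc L → Proc L
  | .hole, P => P
  | .out M N C, P => .out M N (C.fill P)
  | .inp M x C, P => Proc.inpVar M x (C.fill P)
  | .mat M N C, P => .mat M N (C.fill P)
  | .mismat M N C, P => .mismat M N (C.fill P)
  | .nu x C, P => Proc.nuVar x (C.fill P)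
  | .parL C Q, P => .par (C.fill P) Q
  | .parR R C, P => .par R (C.fill P)
  | .sumL C Q, P => .sum (C.fill P) Q
  | .sumR R C, P => .sum R (C.fill P)
  | .rep C, P => .rep (C.fill P)

/-- Open barbed bisimulations. -/
structure IsOpenBarbedBisimulation (Ax : Msg L → Msg L → Prop)
    (R : Proc L → Proc L → Prop) : Prop where
  symm : ∀ {P Q : Proc L}, R P Q → R Q P
  context : ∀ {P Q : Proc L}, R P Q → ∀ C : Ctx L, R (C.fill P) (C.fill Q)
  barb : ∀ {P Q : Proc L}, R P Q → ∀ M : Msg L, HasBarb Ax P M → HasBarb Ax Q M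
  tau : ∀ {P Q : Proc L}, R P Q → ∀ P' : Proc L, TauStep Ax P P' →
    ∃ Q' : Proc L, TauStep Ax Q Q' ∧ R P' Q'

/-- Open barbed bisimilarity: the greatest open barbed bisimulation. -/
def OpenBarbedBisimilar (Ax : Msg L → Msg L → Prop) (P Q : Proc L) : Prop :=
  ∃ R : Proc L → Proc L → Prop, IsOpenBarbedBisimulation Ax R ∧ R P Q

end Barbed

/-! ### The open late labelled transition system of the fragment without mismatch -/

/-- Late actions: progress, bound output `M̄(x)` and bound input `M(x)`. -/
inductive LAct (L : FirstOrder.Language.{u, w}) : Type u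
  | tau : LAct L
  | out (M : Msg L) (x : ℕ) : LAct L
  | inp (M : Msg L) (x : ℕ) : LAct L

section Late

variable {L : FirstOrder.Language.{u, w}}

/-- The bound names of a late action. -/
def LAct.bn : LAct L → Set ℕ
  | .tau => ∅
  | .out _ x => {x}
  | .inp _ x => {x}

/-- A late action, seen in the scope below one further binder. -/
def LAct.shift : LAct L → LAct L
  | .tau => .tau
  | .out M x => .out (Msg.shift 1 M) (x + 1)
  | .inp M x => .inp (Msg.shift 1 M) (x + 1)

/-- Substitution in a late action; the bound name is left unchanged. -/
def LAct.subst : LAct L → Subst L → LAct L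
  | .tau, _ => .tau
  | .out M x, σ => .out (M.subst σ) x
  | .inp M x, σ => .inp (M.subst σ) x

/-- Late transitions `P ⟶ A` with label `π` of processes. There is no rule for mismatch and no environment. -/
inductive LStep (Ax : Msg L → Msg L → Prop) : Proc L → LAct L → EProc L → Prop
  | inp {M M' : Msg L} {P : Proc L} {x : ℕ} :
      EqE Ax M M' →
      x ∉ Msg.fv M' ∪ (Proc.inp M P).fv →
      LStep Ax (.inp M P) (.inp M' x) (P.inst (v x)).toEProc
  | out {M M' N : Msg L} {P : Proc L} {x : ℕ} :
      EqE Ax M M' →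
      x ∉ Msg.fv M ∪ Msg.fv M' ∪ Msg.fv N ∪ P.fv →
      LStep Ax (.out M N P) (.out M' x) (.base (Subst.single x N) P)
  | sumL {P Q : Proc L} {π : LAct L} {A : EProc L} :
      LStep Ax P π A → LStep Ax (.sum P Q) π A
  | sumR {P Q : Proc L} {π : LAct L} {A : EProc L} :
      LStep Ax Q π A → LStep Ax (.sum P Q) π A
  | mat {M N : Msg L} {P : Proc L} {π : LAct L} {A : EProc L} :
      LStep Ax P π A → EqE Ax M N → LStep Ax (.mat M N P) π A
  | res {P : Proc L} {π : LAct L} {A : EProc L} :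
      LStep Ax P π.shift A → LStep Ax (.nu P) π (.nu A)
  | parL {P Q : Proc L} {π : LAct L} {A : EProc L} :
      LStep Ax P π A → Disjoint π.bn Q.fv → LStep Ax (.par P Q) π (A.parR Q)
  | parR {P Q : Proc L} {π : LAct L} {A : EProc L} :
      LStep Ax Q π A → Disjoint π.bn P.fv → LStep Ax (.par P Q) π (EProc.parL P A)
  | repAct {P : Proc L} {π : LAct L} {A : EProc L} :
      LStep Ax P π A → Disjoint π.bn P.fv → LStep Ax (.rep P) π (A.parR (.rep P))
  | closeL {P Q P' : Proc L} {A : EProc L} {M M' N : Msg L} {x k : ℕ} :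
      LStep Ax P (.out M x) (EProc.nus k (.base (Subst.single (x + k) N) P')) →
      LStep Ax (Q.shift k) (.inp (Msg.shift k M') (x + k)) A →
      EqE Ax M M' →
      LStep Ax (.par P Q) .tau
        (EProc.nus k (EProc.parL P' (A.substProc (Subst.single (x + k) N))))
  | closeR {P Q Q' : Proc L} {A : EProc L} {M M' N : Msg L} {x k : ℕ} :
      LStep Ax Q (.out M x) (EProc.nus k (.base (Subst.single (x + k) N) Q')) →
      LStep Ax (P.shift k) (.inp (Msg.shift k M') (x + k)) A →
      EqE Ax M M' →
      LStep Ax (.par P Q) .tau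
        (EProc.nus k ((A.substProc (Subst.single (x + k) N)).parR Q'))
  | repClose {P Q : Proc L} {A : EProc L} {M M' N : Msg L} {x k : ℕ} :
      LStep Ax P (.out M x) (EProc.nus k (.base (Subst.single (x + k) N) Q)) →
      LStep Ax (P.shift k) (.inp (Msg.shift k M') (x + k)) A →
      EqE Ax M M' →
      LStep Ax (.rep P) .tau
        (EProc.nus k ((EProc.parL Q (A.substProc (Subst.single (x + k) N))).parR
          ((Proc.rep P).shift k)))

/-- Late transitions of extended processes: the rules for restriction and for active
substitutions. -/
inductive ELStep (Ax : Msg L → Msg L → Prop) : EProc L → LAct L → EProc L → Prop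
  | res {A B : EProc L} {π : LAct L} :
      ELStep Ax A π.shift B → ELStep Ax (.nu A) π (.nu B)
  | frame {σ : Subst L} {P : Proc L} {π : LAct L} {A : EProc L} :
      LStep Ax P (π.subst σ) A → σ.FreshFor π.bn →
      ELStep Ax (.base σ P) π (EProc.addSubst σ A)

/-! ### Static equivalence, histories and open bisimilarity -/

/-- The recipes `M` and `N`, in which the bound names of the extended process do not occur, yield
equal messages under its active substitution. -/
def EProc.Equates (Ax : Msg L → Msg L → Prop) : EProc L → Msg L → Msg L → Prop
  | .base σ _, M, N => EqE Ax (M.subst σ) (N.subst σ)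
  | .nu A, M, N => EProc.Equates Ax A (Msg.shift 1 M) (Msg.shift 1 N)

/-- Static equivalence. -/
def StaticEquiv (Ax : Msg L → Msg L → Prop) (A B : EProc L) : Prop :=
  ∀ M N : Msg L, A.Equates Ax M N ↔ B.Equates Ax M N

/-- `NormSubst A σ A'`: the normal form of `Aσ` is `A'`. As `σ` may introduce variables from the
domain of the active substitution `θ` of `A`, the active substitution has to be applied again after
`σ`: the new active substitution `θ'` is the idempotent substitution on the domain of `θ` which
solves `θ'(x) = (θ(x)σ)θ'`, and the new process is `(Pσ)θ'`. -/
inductive NormSubst : EProc L → Subst L → EProc L → Prop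
  | base {θ θ' σ : Subst L} {P : Proc L} :
      θ'.dom = θ.dom →
      (∀ y, Disjoint (Msg.fv (θ' y)) θ.dom) →
      (∀ x ∈ θ.dom, θ' x = ((θ x).subst σ).subst θ') →
      NormSubst (.base θ P) σ (.base θ' ((P.subst σ).subst θ'))
  | nu {A A' : EProc L} {σ : Subst L} :
      NormSubst A σ.up A' → NormSubst (.nu A) σ (.nu A')

end Late

/-- Histories `h ::= ε | h · xᵒ | h · Mⁱ`. -/
inductive History (L : FirstOrder.Language.{u, w}) : Type u
  | nil : History L
  | out (h : History L) (x : ℕ) : History L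
  | inp (h : History L) (M : Msg L) : History L

section Open

variable {L : FirstOrder.Language.{u, w}}

/-- The free variables of a history. -/
def History.fv : History L → Set ℕ
  | .nil => ∅
  | .out h x => h.fv ∪ {x}
  | .inp h M => h.fv ∪ Msg.fv M

/-- Application of a substitution to a history; it is only applied to respectful substitutions,
which fix the output variables. -/
def History.subst : History L → Subst L → History L
  | .nil, _ => .nil
  | .out h x, σ => .out (h.subst σ) x
  | .inp h M, σ => .inp (h.subst σ) (M.subst σ)

/-- The substitution `σ` respects a history: whenever the history is `h' · xᵒ · h''`, then
`xσ = x`, and `x` does not occur in `yσ` for the variables `y` of `h'`. -/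
def Respects (σ : Subst L) : History L → Prop
  | .nil => True
  | .out h x => Respects σ h ∧ σ x = v x ∧ ∀ y ∈ h.fv, x ∉ Msg.fv (σ y)
  | .inp h _ => Respects σ h

/-- The history `h · x₁ⁱ · … · xₙⁱ`. -/
def History.inps (h : History L) : List ℕ → History L
  | [] => h
  | x :: xs => (h.inp (v x)).inps xs

/-- Open bisimulations: relations, indexed by histories, between extended processes in normal
form. -/
structure IsOpenBisimulation (Ax : Msg L → Msg L → Prop)
    (R : History L → EProc L → EProc L → Prop) : Prop where
  normal : ∀ {h : History L} {A B : EProc L}, R h A B → A.Normal ∧ B.Normal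
  symm : ∀ {h : History L} {A B : EProc L}, R h A B → R h B A
  static : ∀ {h : History L} {A B : EProc L}, R h A B → StaticEquiv Ax A B
  subst : ∀ {h : History L} {A B : EProc L}, R h A B → ∀ σ : Subst L, Respects σ h →
    ∀ A' B' : EProc L, NormSubst A σ A' → NormSubst B σ B' → R (h.subst σ) A' B'
  tau : ∀ {h : History L} {A B : EProc L}, R h A B → ∀ A' : EProc L, ELStep Ax A .tau A' →
    ∃ B' : EProc L, ELStep Ax B .tau B' ∧ R h A' B'
  out : ∀ {h : History L} {A B : EProc L}, R h A B → ∀ (M : Msg L) (x : ℕ) (A' : EProc L),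
    x ∉ A.fv ∪ B.fv ∪ h.fv → ELStep Ax A (.out M x) A' →
    ∃ B' : EProc L, ELStep Ax B (.out M x) B' ∧ R (h.out x) A' B'
  inp : ∀ {h : History L} {A B : EProc L}, R h A B → ∀ (M : Msg L) (x : ℕ) (A' : EProc L),
    x ∉ A.fv ∪ B.fv ∪ h.fv → ELStep Ax A (.inp M x) A' →
    ∃ B' : EProc L, ELStep Ax B (.inp M x) B' ∧ R (h.inp (v x)) A' B'

/-- Open bisimilarity of processes: they are related by an open bisimulation at a history
`x₁ⁱ · … · xₙⁱ` that contains all their free variables. -/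
def OpenBisimilar (Ax : Msg L → Msg L → Prop) (P Q : Proc L) : Prop :=
  ∃ R : History L → EProc L → EProc L → Prop, IsOpenBisimulation Ax R ∧
    ∃ xs : List ℕ, (∀ x ∈ P.fv ∪ Q.fv, x ∈ xs) ∧
      R (History.nil.inps xs) P.toEProc Q.toEProc

end Open

end AppliedPi

namespace AppliedPi

/-! ### Substitution calculus -/

section Substitution

variable {L : FirstOrder.Language.{u, w}}

/-! Open bisimilarity is embedded into a relation `FrameRel` that already contains every parallel
environment, and the closure of that relation under the remaining contexts is shown to be an open
barbed bisimulation.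

Both transition systems are first replaced by commitments (`CStep`): an input keeps its body as an
abstraction, an output keeps its payload, and no fresh name is ever chosen. Early steps, which
define barbs and the τ-game, and late steps, which define open bisimilarity, both amount to
commitments (`Step.toCStep`, `CStep.toStep`, `LStep.toCStep`, `CStep.toLStep`).

Two processes are in `FrameRel` if, up to a renaming of their free variables, they are `ν z.(P | Ts
θ)` and `ν w.(Q | Ts ρ)`, where `ν z.(θ | P)` and `ν w.(ρ | Q)` are open bisimilar and the
components `Ts` are the same on both sides, their messages being recipes over the frames. Parity
does the bookkeeping: the even variables are the names of outputs, hence the domains of the frames,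
and the free variables of the processes are sent to odd ones. A substitution that is fresh for the
even variables respects the history, so `FrameRel` is closed under substitution.

The components `Ts` may contain mismatch. An equality between recipes passes from `θ` to `ρ` by
static equivalence. An entailed inequality passes because a substitution refuting it under `ρ` is
respectful: the instances of the pair are again bisimilar, and their static equivalence refutes it
under `θ` as well (`FramedPair.transfer`). Hence a component behaves alike over both frames
(`CStep.transfer`), while the moves of `P` are matched by those of `Q` through the open
bisimulation; communications combine the two (`FramedPair.exists_wrap`). This gives `FrameRel.sim`.

The other contexts are handled once and for all: if a symmetric relation closed under substitution
has all its commitments matched up to its contextual closure, then so has the closure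
(`Cong.sim_subst`), and its reflexive transitive closure is an open barbed bisimulation
(`isOpenBarbedBisimulation_congStar`). -/

@[simp] theorem v_subst (n : ℕ) (σ : Subst L) : (v n : Msg L).subst σ = σ n := rfl

theorem Msg.subst_subst (M : Msg L) (σ τ : Subst L) :
    (M.subst σ).subst τ = M.subst (fun n => (σ n).subst τ) := by
  induction M with
  | var n => rfl
  | func f ts ih => simp only [FirstOrder.Language.Term.subst]; congr 1; funext i; exact ih i

theorem Msg.subst_v (M : Msg L) : M.subst (fun n => v n) = M := by
  induction M with
  | var n => rfl
  | func f ts ih => simp only [FirstOrder.Language.Term.subst]; congr 1; funext i; exact ih i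

theorem Msg.fv_var (n : ℕ) : Msg.fv (v n : Msg L) = {n} := by
  ext m; simp [Msg.fv, v, FirstOrder.Language.Term.varFinset]

theorem Msg.mem_fv_func {n : ℕ} (f : L.Functions n) (ts : Fin n → Msg L) (x : ℕ) :
    x ∈ Msg.fv (FirstOrder.Language.Term.func f ts : Msg L) ↔ ∃ i, x ∈ Msg.fv (ts i) := by
  simp [Msg.fv, FirstOrder.Language.Term.varFinset]

theorem Msg.subst_congr {M : Msg L} {σ τ : Subst L} (h : ∀ n ∈ Msg.fv M, σ n = τ n) :
    M.subst σ = M.subst τ := by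
  induction M with
  | var n => exact h n (by rw [show FirstOrder.Language.Term.var n = (v n : Msg L) from rfl, Msg.fv_var]; rfl)
  | func f ts ih =>
    simp only [FirstOrder.Language.Term.subst]; congr 1; funext i
    exact ih i fun n hn => h n ((Msg.mem_fv_func f ts n).2 ⟨i, hn⟩)

theorem Msg.mem_fv_subst {M : Msg L} {σ : Subst L} {x : ℕ} :
    x ∈ Msg.fv (M.subst σ) ↔ ∃ n ∈ Msg.fv M, x ∈ Msg.fv (σ n) := by
  induction M with
  | var n =>
    rw [show FirstOrder.Language.Term.var n = (v n : Msg L) from rfl, Msg.fv_var]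
    simp
  | func f ts ih =>
    simp only [FirstOrder.Language.Term.subst, Msg.mem_fv_func, ih]
    constructor
    · rintro ⟨i, n, hn, hx⟩; exact ⟨n, ⟨i, hn⟩, hx⟩
    · rintro ⟨n, ⟨i, hn⟩, hx⟩; exact ⟨i, n, hn, hx⟩

theorem Msg.fv_finite (M : Msg L) : (Msg.fv M).Finite := M.varFinset.finite_toSet

theorem Msg.shift_shift (M : Msg L) (j k : ℕ) : Msg.shift j (Msg.shift k M) = Msg.shift (k + j) M := by
  simp only [Msg.shift, Msg.subst_subst, v_subst, Nat.add_assoc]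

theorem Msg.shift_zero (M : Msg L) : Msg.shift 0 M = M := Msg.subst_v M

theorem Msg.shift_subst (M : Msg L) (k : ℕ) (σ : Subst L) :
    (Msg.shift k M).subst σ = M.subst (fun n => σ (n + k)) := by
  simp only [Msg.shift, Msg.subst_subst, v_subst]

@[simp] theorem shift_v (k n : ℕ) : Msg.shift k (v n : Msg L) = v (n + k) := rfl

theorem Msg.mem_fv_shift {M : Msg L} {k x : ℕ} : x ∈ Msg.fv (Msg.shift k M) ↔ ∃ n ∈ Msg.fv M, x = n + k := by
  simp only [Msg.shift, Msg.mem_fv_subst, Msg.fv_var, Set.mem_singleton_iff]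

theorem Msg.add_mem_fv_shift {M : Msg L} {k x : ℕ} : x + k ∈ Msg.fv (Msg.shift k M) ↔ x ∈ Msg.fv M := by
  simp [Msg.mem_fv_shift]

/-! ### Lifting of substitutions below blocks of binders. -/

/-- The substitution `σ`, transported below `k` binders. -/
def upN (k : ℕ) (σ : Subst L) : Subst L := fun n => if n < k then v n else Msg.shift k (σ (n - k))

theorem upN_lt {k n : ℕ} (σ : Subst L) (h : n < k) : upN k σ n = v n := if_pos h

theorem upN_ge {k n : ℕ} (σ : Subst L) (h : k ≤ n) : upN k σ n = Msg.shift k (σ (n - k)) :=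
  if_neg (by omega)

@[simp] theorem upN_add (k n : ℕ) (σ : Subst L) : upN k σ (n + k) = Msg.shift k (σ n) := by
  rw [upN_ge _ (by omega), Nat.add_sub_cancel]

theorem upN_zero (σ : Subst L) : upN 0 σ = σ := by
  funext n; simp [upN, Msg.shift_zero]

theorem up_eq_upN (σ : Subst L) : σ.up = upN 1 σ := by
  funext n
  cases n with
  | zero => rfl
  | succ n => rw [upN_add]; rfl

theorem upN_upN (j k : ℕ) (σ : Subst L) : upN j (upN k σ) = upN (j + k) σ := by
  funext n
  rcases lt_or_ge n j with h | h
  · rw [upN_lt _ h, upN_lt _ (by omega)]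
  · rw [upN_ge _ h]
    rcases lt_or_ge (n - j) k with h' | h'
    · rw [upN_lt _ h', upN_lt _ (by omega), shift_v]; congr 1; omega
    · rw [upN_ge _ h', upN_ge _ (by omega), Msg.shift_shift, Nat.add_comm k j, Nat.sub_sub]

theorem up_upN (k : ℕ) (σ : Subst L) : (upN k σ).up = upN (k + 1) σ := by
  rw [up_eq_upN, upN_upN, Nat.add_comm]

theorem upN_up (k : ℕ) (σ : Subst L) : upN k σ.up = upN (k + 1) σ := by
  rw [up_eq_upN, upN_upN]

theorem upN_subst (k : ℕ) (σ τ : Subst L) (n : ℕ) :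
    (upN k σ n).subst (upN k τ) = upN k (fun m => (σ m).subst τ) n := by
  rcases lt_or_ge n k with h | h
  · simp only [upN_lt _ h, v_subst]
  · simp only [upN_ge _ h, Msg.shift_subst, upN_add]
    simp only [Msg.shift, Msg.subst_subst]

theorem up_subst (σ τ : Subst L) (n : ℕ) :
    (σ.up n).subst τ.up = Subst.up (fun m => (σ m).subst τ) n := by
  simp only [up_eq_upN, upN_subst]

theorem Msg.shift_upN (M : Msg L) (k : ℕ) (σ : Subst L) :
    (Msg.shift k M).subst (upN k σ) = Msg.shift k (M.subst σ) := by
  rw [Msg.shift_subst]; simp only [upN_add]; simp only [Msg.shift, Msg.subst_subst]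

theorem upN_v (k : ℕ) : upN k (fun n => (v n : Msg L)) = fun n => v n := by
  funext n
  rcases lt_or_ge n k with h | h
  · rw [upN_lt _ h]
  · rw [upN_ge _ h, shift_v]; congr 1; omega

theorem up_v : Subst.up (fun n => (v n : Msg L)) = fun n => v n := by rw [up_eq_upN, upN_v]

theorem Proc.subst_subst (P : Proc L) (σ τ : Subst L) :
    (P.subst σ).subst τ = P.subst (fun n => (σ n).subst τ) := by
  induction P generalizing σ τ with
  | zero => rfl
  | out M N P ih | mat M N P ih | mismat M N P ih => simp only [Proc.subst, Msg.subst_subst, ih]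
  | inp M P ih => simp only [Proc.subst, Msg.subst_subst, ih, up_subst]
  | nu P ih => simp only [Proc.subst, ih, up_subst]
  | par P Q ih1 ih2 | sum P Q ih1 ih2 => simp only [Proc.subst, ih1, ih2]
  | rep P ih => simp only [Proc.subst, ih]

theorem Proc.subst_v (P : Proc L) : P.subst (fun n => v n) = P := by
  induction P with
  | zero => rfl
  | out M N P ih | mat M N P ih | mismat M N P ih => simp only [Proc.subst, Msg.subst_v, ih]
  | inp M P ih => simp only [Proc.subst, Msg.subst_v, up_v, ih]
  | nu P ih => simp only [Proc.subst, up_v, ih]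
  | par P Q ih1 ih2 | sum P Q ih1 ih2 => simp only [Proc.subst, ih1, ih2]
  | rep P ih => simp only [Proc.subst, ih]

theorem Proc.subst_congr {P : Proc L} {σ τ : Subst L} (h : ∀ n ∈ P.fv, σ n = τ n) :
    P.subst σ = P.subst τ := by
  have hup : ∀ {P : Proc L} {σ τ : Subst L}, (∀ n, n + 1 ∈ P.fv → σ n = τ n) →
      ∀ n ∈ P.fv, σ.up n = τ.up n := by
    intro P σ τ h n hn
    cases n with
    | zero => rfl
    | succ n => simp only [Subst.up, h n hn]
  induction P generalizing σ τ with
  | zero => rfl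
  | out M N P ih | mat M N P ih | mismat M N P ih =>
    simp only [Proc.subst]
    rw [Msg.subst_congr (M := M) fun n hn => h n (Or.inl (Or.inl hn)),
      Msg.subst_congr (M := N) fun n hn => h n (Or.inl (Or.inr hn)), ih fun n hn => h n (Or.inr hn)]
  | inp M P ih =>
    simp only [Proc.subst]
    rw [Msg.subst_congr (M := M) fun n hn => h n (Or.inl hn), ih (hup fun n hn => h n (Or.inr hn))]
  | nu P ih => simp only [Proc.subst]; rw [ih (hup fun n hn => h n hn)]
  | par P Q ih1 ih2 | sum P Q ih1 ih2 =>
    simp only [Proc.subst]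
    rw [ih1 fun n hn => h n (Or.inl hn), ih2 fun n hn => h n (Or.inr hn)]
  | rep P ih => simp only [Proc.subst]; rw [ih fun n hn => h n hn]

theorem Proc.mem_fv_subst {P : Proc L} {σ : Subst L} {x : ℕ} :
    x ∈ (P.subst σ).fv ↔ ∃ n ∈ P.fv, x ∈ Msg.fv (σ n) := by
  have hup : ∀ {P : Proc L} {σ : Subst L} {x : ℕ}, (∃ n ∈ P.fv, x + 1 ∈ Msg.fv (σ.up n)) ↔
      ∃ n, n + 1 ∈ P.fv ∧ x ∈ Msg.fv (σ n) := by
    intro P σ x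
    constructor
    · rintro ⟨n, hn, hx⟩
      cases n with
      | zero => simp [Subst.up, Msg.fv_var] at hx
      | succ n => exact ⟨n, hn, Msg.add_mem_fv_shift.1 hx⟩
    · rintro ⟨n, hn, hx⟩; exact ⟨n + 1, hn, Msg.add_mem_fv_shift.2 hx⟩
  induction P generalizing σ x with
  | zero => simp [Proc.subst, Proc.fv]
  | out M N P ih | mat M N P ih | mismat M N P ih =>
    simp only [Proc.subst, Proc.fv, Set.mem_union, Msg.mem_fv_subst, ih, or_and_right, exists_or]
  | inp M P ih =>
    simp only [Proc.subst, Proc.fv, Set.mem_union, Msg.mem_fv_subst, ih, or_and_right, exists_or,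
      Set.mem_ofPred_eq, hup]
  | nu P ih => simp only [Proc.subst, Proc.fv, Set.mem_ofPred_eq, ih, hup]
  | par P Q ih1 ih2 | sum P Q ih1 ih2 =>
    simp only [Proc.subst, Proc.fv, Set.mem_union, ih1, ih2, or_and_right, exists_or]
  | rep P ih => simp only [Proc.subst, Proc.fv, ih]

theorem Proc.fv_finite (P : Proc L) : P.fv.Finite := by
  have hs : ∀ s : Set ℕ, s.Finite → {n | n + 1 ∈ s}.Finite := fun s h =>
    h.preimage (f := (· + 1)) (add_left_injective 1).injOn
  induction P with
  | zero => exact Set.finite_empty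
  | out M N P ih | mat M N P ih | mismat M N P ih =>
    exact ((Msg.fv_finite M).union (Msg.fv_finite N)).union ih
  | inp M P ih => exact (Msg.fv_finite M).union (hs _ ih)
  | nu P ih => exact hs _ ih
  | par P Q ih1 ih2 | sum P Q ih1 ih2 => exact ih1.union ih2
  | rep P ih => exact ih

theorem Proc.shift_subst (P : Proc L) (k : ℕ) (σ : Subst L) :
    (P.shift k).subst σ = P.subst (fun n => σ (n + k)) := by
  simp only [Proc.shift, Proc.subst_subst, v_subst]

theorem Proc.shift_upN (P : Proc L) (k : ℕ) (σ : Subst L) :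
    (P.shift k).subst (upN k σ) = (P.subst σ).shift k := by
  rw [Proc.shift_subst]; simp only [upN_add, Proc.shift, Proc.subst_subst]; rfl

theorem Proc.shift_shift (P : Proc L) (j k : ℕ) : (P.shift k).shift j = P.shift (k + j) := by
  simp only [Proc.shift, Proc.subst_subst, v_subst, Nat.add_assoc]

theorem Proc.shift_zero (P : Proc L) : P.shift 0 = P := Proc.subst_v P

theorem Proc.mem_fv_shift {P : Proc L} {k x : ℕ} : x ∈ (P.shift k).fv ↔ ∃ n ∈ P.fv, x = n + k := by
  simp only [Proc.shift, Proc.mem_fv_subst, Msg.fv_var, Set.mem_singleton_iff]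

theorem Proc.add_mem_fv_shift {P : Proc L} {k x : ℕ} : x + k ∈ (P.shift k).fv ↔ x ∈ P.fv := by
  simp [Proc.mem_fv_shift]

/-- `M` for the variable `0`, and `σ` for the other variables, which are counted from `1`. -/
def scons (M : Msg L) (σ : Subst L) : Subst L
  | 0 => M
  | n + 1 => σ n

@[simp] theorem scons_zero (M : Msg L) (σ : Subst L) : scons M σ 0 = M := rfl
@[simp] theorem scons_succ (M : Msg L) (σ : Subst L) (n : ℕ) : scons M σ (n + 1) = σ n := rfl

theorem Proc.inst_eq (P : Proc L) (N : Msg L) : P.inst N = P.subst (scons N fun n => v n) := by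
  unfold Proc.inst
  congr 1
  funext n
  cases n <;> rfl

/-- The renaming `n ↦ n + k`, as a substitution. -/
def sh (k : ℕ) : Subst L := fun n => v (n + k)

@[simp] theorem sh_apply (k n : ℕ) : (sh k n : Msg L) = v (n + k) := rfl

theorem upN_ren (k : ℕ) (g : ℕ → ℕ) :
    upN k (fun n => (v (g n) : Msg L)) = fun n => v (if n < k then n else g (n - k) + k) := by
  funext n
  unfold upN
  split_ifs <;> rfl

end Substitution

/-! ### Equational theory and mismatch -/

section Equations

variable {L : FirstOrder.Language.{u, w}} {Ax : Msg L → Msg L → Prop}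

theorem EqE.subst {M N : Msg L} (h : EqE Ax M N) (σ : Subst L) :
    EqE Ax (M.subst σ) (N.subst σ) := by
  induction h with
  | ax h τ => rw [Msg.subst_subst, Msg.subst_subst]; exact .ax h _
  | refl => exact .refl _
  | symm _ ih => exact ih.symm
  | trans _ _ ih1 ih2 => exact ih1.trans ih2
  | congr f a b _ ih => exact .congr f _ _ ih

/-- The environment `E` in the scope of `k` binders. -/
def extendEnvN (k : ℕ) (E : Set ℕ) : Set ℕ := {n | n < k ∨ ∃ m ∈ E, n = m + k}

theorem extendEnvN_zero (E : Set ℕ) : extendEnvN 0 E = E := by ext n; simp [extendEnvN]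

theorem extendEnv_eq (E : Set ℕ) : extendEnv E = extendEnvN 1 E := by
  ext n; simp [extendEnv, extendEnvN, eq_comm]

theorem extendEnvN_extendEnvN (j k : ℕ) (E : Set ℕ) :
    extendEnvN j (extendEnvN k E) = extendEnvN (j + k) E := by
  ext n
  simp only [extendEnvN, Set.mem_ofPred_eq]
  constructor
  · rintro (h | ⟨m, h | ⟨l, hl, rfl⟩, rfl⟩)
    · left; omega
    · left; omega
    · right; exact ⟨l, hl, by omega⟩
  · rintro (h | ⟨m, hm, rfl⟩)
    · rcases lt_or_ge n j with h' | h'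
      · exact Or.inl h'
      · exact Or.inr ⟨n - j, Or.inl (by omega), by omega⟩
    · exact Or.inr ⟨m + k, Or.inr ⟨m, hm, rfl⟩, by omega⟩

theorem extendEnvN_extendEnv (k : ℕ) (E : Set ℕ) : extendEnvN k (extendEnv E) = extendEnvN (k + 1) E := by
  rw [extendEnv_eq, extendEnvN_extendEnvN]

theorem extendEnvN_finite {E : Set ℕ} (h : E.Finite) (k : ℕ) : (extendEnvN k E).Finite := by
  have : extendEnvN k E ⊆ Set.Iio k ∪ (· + k) '' E := by
    rintro n (h | ⟨m, hm, rfl⟩)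
    · exact Or.inl h
    · exact Or.inr ⟨m, hm, rfl⟩
  exact ((Set.finite_Iio k).union (h.image _)).subset this

theorem extendEnv_finite {E : Set ℕ} (h : E.Finite) : (extendEnv E).Finite := by
  rw [extendEnv_eq]; exact extendEnvN_finite h 1

theorem freshFor_iff {σ : Subst L} {E : Set ℕ} :
    σ.FreshFor E ↔ (∀ x ∈ E, σ x = v x) ∧ ∀ y ∉ E, ∀ x ∈ E, x ∉ Msg.fv (σ y) := by
  unfold Subst.FreshFor Subst.dom
  rw [Set.disjoint_right]
  simp only [Set.mem_ofPred_eq, not_not, Set.disjoint_right]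

theorem freshFor_upN {σ : Subst L} {E : Set ℕ} (h : σ.FreshFor E) (k : ℕ) :
    (upN k σ).FreshFor (extendEnvN k E) := by
  rw [freshFor_iff] at h ⊢
  constructor
  · rintro x (hx | ⟨m, hm, rfl⟩)
    · exact upN_lt _ hx
    · rw [upN_add, h.1 m hm, shift_v]
  · intro y hy x hx hxy
    have hyk : k ≤ y := by
      by_contra hlt
      exact hy (Or.inl (by omega))
    obtain ⟨y, rfl⟩ := Nat.exists_eq_add_of_le' hyk
    rw [upN_add, Msg.mem_fv_shift] at hxy
    obtain ⟨n, hn, rfl⟩ := hxy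
    rcases hx with hx | ⟨m, hm, hx⟩
    · omega
    · have : n = m := by omega
      subst this
      exact h.2 y (fun hyE => hy (Or.inr ⟨y, hyE, rfl⟩)) n hm hn

/-- Substitutions that are fresh for the names of `k` binders come from the surrounding scope. -/
theorem exists_upN_of_freshFor {σ : Subst L} {E : Set ℕ} {k : ℕ}
    (h : σ.FreshFor (extendEnvN k E)) : ∃ τ : Subst L, τ.FreshFor E ∧ σ = upN k τ := by
  have h' := h
  rw [freshFor_iff] at h
  -- Freshness keeps the indices below `k` out of these images, so the truncated subtraction loses
  -- nothing.
  have key : ∀ n, Msg.shift k ((σ (n + k)).subst fun m => v (m - k)) = σ (n + k) := by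
    intro n
    rw [Msg.shift, Msg.subst_subst]
    conv_rhs => rw [← Msg.subst_v (σ (n + k))]
    refine Msg.subst_congr fun m hm => ?_
    have : k ≤ m := by
      by_contra hlt
      by_cases hn : n ∈ E
      · rw [h.1 _ (Or.inr ⟨n, hn, rfl⟩), Msg.fv_var] at hm
        have : m = n + k := hm
        omega
      · refine h.2 (n + k) ?_ m (Or.inl (by omega)) hm
        rintro (hk | ⟨m, hm, he⟩)
        · omega
        · have : n = m := by omega
          exact hn (this ▸ hm)
    simp only [v_subst]; congr 1; omega
  refine ⟨fun n => (σ (n + k)).subst fun m => v (m - k), ?_, ?_⟩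
  · rw [freshFor_iff]
    constructor
    · intro x hx
      simp only [h.1 _ (Or.inr ⟨x, hx, rfl⟩), v_subst, Nat.add_sub_cancel]
    · intro y hy x hx hxy
      have hxy' := Msg.add_mem_fv_shift (k := k).2 hxy
      rw [key] at hxy'
      refine h.2 (y + k) ?_ (x + k) (Or.inr ⟨x, hx, rfl⟩) hxy'
      rintro (hk | ⟨m, hm, he⟩)
      · omega
      · have : y = m := by omega
        exact hy (this ▸ hm)
  · funext n
    rcases lt_or_ge n k with hn | hn
    · rw [upN_lt _ hn, h.1 n (Or.inl hn)]
    · obtain ⟨n, rfl⟩ := Nat.exists_eq_add_of_le' hn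
      rw [upN_add, key]

end Equations

/-! ### Commitments -/

/-- Labels of commitments. -/
inductive CLab (L : FirstOrder.Language.{u, w}) : Type u
  | tau : CLab L
  | out (M : Msg L) : CLab L
  | inp (M : Msg L) : CLab L

section Commitments

variable {L : FirstOrder.Language.{u, w}}

/-- The number of parameters that the body of a commitment abstracts. -/
def CLab.ar : CLab L → ℕ
  | .tau => 0
  | .out _ => 0
  | .inp _ => 1

/-- Substitution in a label. -/
def CLab.subst : CLab L → Subst L → CLab L
  | .tau, _ => .tau
  | .out M, σ => .out (M.subst σ)
  | .inp M, σ => .inp (M.subst σ)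

/-- The free variables of a label. -/
def CLab.fv : CLab L → Set ℕ
  | .tau => ∅
  | .out M => Msg.fv M
  | .inp M => Msg.fv M

/-- Equality of labels up to the equational theory. -/
inductive CLab.Equiv (Ax : Msg L → Msg L → Prop) : CLab L → CLab L → Prop
  | tau : CLab.Equiv Ax .tau .tau
  | out {M N : Msg L} : EqE Ax M N → CLab.Equiv Ax (.out M) (.out N)
  | inp {M N : Msg L} : EqE Ax M N → CLab.Equiv Ax (.inp M) (.inp N)

@[simp] theorem CLab.ar_subst (l : CLab L) (σ : Subst L) : (l.subst σ).ar = l.ar := by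
  cases l <;> rfl

theorem CLab.subst_subst (l : CLab L) (σ τ : Subst L) :
    (l.subst σ).subst τ = l.subst (fun n => (σ n).subst τ) := by
  cases l <;> simp only [CLab.subst, Msg.subst_subst]

theorem CLab.subst_v (l : CLab L) : l.subst (fun n => v n) = l := by
  cases l <;> simp only [CLab.subst, Msg.subst_v]

theorem CLab.fv_finite (l : CLab L) : l.fv.Finite := by
  cases l
  · exact Set.finite_empty
  all_goals exact Msg.fv_finite _

theorem CLab.Equiv.ar_eq {Ax : Msg L → Msg L → Prop} {l l' : CLab L} (h : CLab.Equiv Ax l l') :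
    l.ar = l'.ar := by cases h <;> rfl

theorem CLab.Equiv.symm {Ax : Msg L → Msg L → Prop} {l l' : CLab L} (h : CLab.Equiv Ax l l') :
    CLab.Equiv Ax l' l := by
  cases h with
  | tau => exact .tau
  | out h => exact .out h.symm
  | inp h => exact .inp h.symm

theorem CLab.Equiv.trans {Ax : Msg L → Msg L → Prop} {l l' l'' : CLab L} (h : CLab.Equiv Ax l l')
    (h' : CLab.Equiv Ax l' l'') : CLab.Equiv Ax l l'' := by
  cases h with
  | tau => exact h'
  | out h => cases h' with | out h' => exact .out (h.trans h')
  | inp h => cases h' with | inp h' => exact .inp (h.trans h')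

theorem CLab.Equiv.subst {Ax : Msg L → Msg L → Prop} {l l' : CLab L} (h : CLab.Equiv Ax l l')
    (σ : Subst L) : CLab.Equiv Ax (l.subst σ) (l'.subst σ) := by
  cases h with
  | tau => exact .tau
  | out h => exact .out (h.subst σ)
  | inp h => exact .inp (h.subst σ)

theorem CLab.Equiv.of_subst_inj {Ax : Msg L → Msg L → Prop} {l l' : CLab L} {σ τ : Subst L}
    (hστ : ∀ n, (σ n).subst τ = v n) (h : CLab.Equiv Ax (l.subst σ) (l'.subst σ)) :
    CLab.Equiv Ax l l' := by
  have := h.subst τ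
  simpa only [CLab.subst_subst, hστ, CLab.subst_v] using this

/-- The substitution that a receiver with `i` binders performs when it obtains `N` from a sender
with `j` binders. -/
def recv (j i : ℕ) (N : Msg L) : Subst L := scons (Msg.shift i N) (upN i (sh j))

/-- Commitments `E : P ⟶ (ν z₁ … z_j) (N, P')`. The payload `N` is present for outputs. In the
scope of the body of an input, index `0` is the received message and the binders come next. -/
inductive CStep (Ax : Msg L → Msg L → Prop) :
    Set ℕ → Proc L → CLab L → ℕ → Option (Msg L) → Proc L → Prop
  | inp {E : Set ℕ} {M M' : Msg L} {P : Proc L} :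
      EqE Ax M M' → CStep Ax E (.inp M P) (.inp M') 0 none P
  | out {E : Set ℕ} {M M' N : Msg L} {P : Proc L} :
      EqE Ax M M' → CStep Ax E (.out M N P) (.out M') 0 (some N) P
  | sumL {E : Set ℕ} {P Q P' : Proc L} {l : CLab L} {j : ℕ} {N : Option (Msg L)} :
      CStep Ax E P l j N P' → CStep Ax E (.sum P Q) l j N P'
  | sumR {E : Set ℕ} {P Q Q' : Proc L} {l : CLab L} {j : ℕ} {N : Option (Msg L)} :
      CStep Ax E Q l j N Q' → CStep Ax E (.sum P Q) l j N Q'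
  | mat {E : Set ℕ} {M M' : Msg L} {P P' : Proc L} {l : CLab L} {j : ℕ} {N : Option (Msg L)} :
      CStep Ax E P l j N P' → EqE Ax M M' → CStep Ax E (.mat M M' P) l j N P'
  | mismat {E : Set ℕ} {M M' : Msg L} {P P' : Proc L} {l : CLab L} {j : ℕ} {N : Option (Msg L)} :
      CStep Ax E P l j N P' → EntailsNe Ax E M M' → CStep Ax E (.mismat M M' P) l j N P'
  | res {E : Set ℕ} {P P' : Proc L} {l : CLab L} {j : ℕ} {N : Option (Msg L)} :
      CStep Ax (extendEnv E) P (l.subst (sh 1)) j N P' → CStep Ax E (.nu P) l (j + 1) N P'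
  | parL {E : Set ℕ} {P Q P' : Proc L} {l : CLab L} {j : ℕ} {N : Option (Msg L)} :
      CStep Ax E P l j N P' → CStep Ax E (.par P Q) l j N (.par P' (Q.shift (j + l.ar)))
  | parR {E : Set ℕ} {P Q Q' : Proc L} {l : CLab L} {j : ℕ} {N : Option (Msg L)} :
      CStep Ax E Q l j N Q' → CStep Ax E (.par P Q) l j N (.par (P.shift (j + l.ar)) Q')
  | repAct {E : Set ℕ} {P P' : Proc L} {l : CLab L} {j : ℕ} {N : Option (Msg L)} :
      CStep Ax E P l j N P' →
      CStep Ax E (.rep P) l j N (.par P' ((Proc.rep P).shift (j + l.ar)))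
  | closeL {E : Set ℕ} {P Q P' Q' : Proc L} {M N : Msg L} {j i : ℕ} {N' : Option (Msg L)} :
      CStep Ax E P (.out M) j (some N) P' → CStep Ax E Q (.inp M) i N' Q' →
      CStep Ax E (.par P Q) .tau (j + i) none (.par (P'.shift i) (Q'.subst (recv j i N)))
  | closeR {E : Set ℕ} {P Q P' Q' : Proc L} {M N : Msg L} {j i : ℕ} {N' : Option (Msg L)} :
      CStep Ax E Q (.out M) j (some N) Q' → CStep Ax E P (.inp M) i N' P' →
      CStep Ax E (.par P Q) .tau (j + i) none (.par (P'.subst (recv j i N)) (Q'.shift i))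
  | repClose {E : Set ℕ} {P Q R : Proc L} {M N : Msg L} {j i : ℕ} {N' : Option (Msg L)} :
      CStep Ax E P (.out M) j (some N) Q → CStep Ax E P (.inp M) i N' R →
      CStep Ax E (.rep P) .tau (j + i) none
        (.par (.par (Q.shift i) (R.subst (recv j i N))) ((Proc.rep P).shift (j + i)))

/-! ### Structural properties of commitments. -/

variable {Ax : Msg L → Msg L → Prop}

theorem CStep.exists_payload {E : Set ℕ} {P P' : Proc L} {l : CLab L} {j : ℕ} {N : Option (Msg L)}
    (h : CStep Ax E P l j N P') {M : Msg L} (hl : l = .out M) : ∃ N', N = some N' := by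
  induction h generalizing M with
  | inp => cases hl
  | out => exact ⟨_, rfl⟩
  | res _ ih => subst hl; exact ih rfl
  | sumL _ ih | sumR _ ih | mat _ _ ih | mismat _ _ ih | parL _ ih | parR _ ih | repAct _ ih => exact ih hl
  | closeL | closeR | repClose => cases hl

theorem CStep.relabel {E : Set ℕ} {P P' : Proc L} {l l' : CLab L} {j : ℕ} {N : Option (Msg L)}
    (h : CStep Ax E P l j N P') (hl : CLab.Equiv Ax l l') : CStep Ax E P l' j N P' := by
  induction h generalizing l' with
  | inp h => cases hl with | inp h' => exact .inp (h.trans h')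
  | out h => cases hl with | out h' => exact .out (h.trans h')
  | sumL _ ih => exact .sumL (ih hl)
  | sumR _ ih => exact .sumR (ih hl)
  | mat _ h ih => exact .mat (ih hl) h
  | mismat _ h ih => exact .mismat (ih hl) h
  | res _ ih => exact .res (ih (hl.subst _))
  | parL _ ih => rw [hl.ar_eq]; exact .parL (ih hl)
  | parR _ ih => rw [hl.ar_eq]; exact .parR (ih hl)
  | repAct _ ih => rw [hl.ar_eq]; exact .repAct (ih hl)
  | closeL h1 h2 => cases hl; exact .closeL h1 h2
  | closeR h1 h2 => cases hl; exact .closeR h1 h2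
  | repClose h1 h2 => cases hl; exact .repClose h1 h2

theorem mem_fv_recv {j i x n : ℕ} {N : Msg L} (h : x + (j + i) ∈ Msg.fv (recv j i N n)) :
    x + j ∈ Msg.fv N ∨ n = x + (i + 1) := by
  cases n with
  | zero =>
    left
    rwa [recv, scons_zero, ← Nat.add_assoc, Msg.add_mem_fv_shift] at h
  | succ n =>
    right
    rw [recv, scons_succ] at h
    rcases lt_or_ge n i with hn | hn
    · rw [upN_lt _ hn, Msg.fv_var, Set.mem_singleton_iff] at h; omega
    · rw [upN_ge _ hn, sh_apply, shift_v, Msg.fv_var, Set.mem_singleton_iff] at h; omega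

theorem CStep.mem_fv {E : Set ℕ} {P P' : Proc L} {l : CLab L} {j : ℕ} {N : Option (Msg L)}
    (h : CStep Ax E P l j N P') (x : ℕ) :
    (x + (j + l.ar) ∈ P'.fv → x ∈ P.fv) ∧ ∀ N' ∈ N, x + j ∈ Msg.fv N' → x ∈ P.fv := by
  induction h generalizing x with
  | inp => exact ⟨fun h => Or.inr h, by simp⟩
  | out => exact ⟨fun h => Or.inr h, by rintro _ ⟨⟩ h; exact Or.inl (Or.inr h)⟩
  | sumL _ ih => exact ⟨fun h => Or.inl ((ih x).1 h), fun _ hN h => Or.inl ((ih x).2 _ hN h)⟩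
  | sumR _ ih => exact ⟨fun h => Or.inr ((ih x).1 h), fun _ hN h => Or.inr ((ih x).2 _ hN h)⟩
  | mat _ _ ih | mismat _ _ ih =>
    exact ⟨fun h => Or.inr ((ih x).1 h), fun _ hN h => Or.inr ((ih x).2 _ hN h)⟩
  | @res _ _ _ l j _ _ ih =>
    constructor
    · intro h
      refine (ih (x + 1)).1 ?_
      rw [CLab.ar_subst]
      rwa [show x + (j + 1 + l.ar) = x + 1 + (j + l.ar) by omega] at h
    · intro N' hN h
      refine (ih (x + 1)).2 N' hN ?_
      rwa [show x + (j + 1) = x + 1 + j by omega] at h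
  | parL _ ih =>
    refine ⟨?_, fun _ hN h => Or.inl ((ih x).2 _ hN h)⟩
    rintro (h | h)
    · exact Or.inl ((ih x).1 h)
    · exact Or.inr (Proc.add_mem_fv_shift.1 h)
  | parR _ ih =>
    refine ⟨?_, fun _ hN h => Or.inr ((ih x).2 _ hN h)⟩
    rintro (h | h)
    · exact Or.inl (Proc.add_mem_fv_shift.1 h)
    · exact Or.inr ((ih x).1 h)
  | repAct _ ih =>
    refine ⟨?_, fun _ hN h => (ih x).2 _ hN h⟩
    rintro (h | h)
    · exact (ih x).1 h
    · exact Proc.add_mem_fv_shift.1 h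
  | @closeL _ _ _ _ _ _ _ j i _ _ _ ih1 ih2 =>
    refine ⟨?_, by simp⟩
    simp only [CLab.ar, Nat.add_zero] at ih1 ih2 ⊢
    rintro (h | h)
    · rw [← Nat.add_assoc, Proc.add_mem_fv_shift] at h
      exact Or.inl ((ih1 x).1 h)
    · obtain ⟨n, hn, hx⟩ := Proc.mem_fv_subst.1 h
      rcases mem_fv_recv hx with h | rfl
      · exact Or.inl ((ih1 x).2 _ rfl h)
      · exact Or.inr ((ih2 x).1 hn)
  | @closeR _ _ _ _ _ _ _ j i _ _ _ ih1 ih2 =>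
    refine ⟨?_, by simp⟩
    simp only [CLab.ar, Nat.add_zero] at ih1 ih2 ⊢
    rintro (h | h)
    · obtain ⟨n, hn, hx⟩ := Proc.mem_fv_subst.1 h
      rcases mem_fv_recv hx with h | rfl
      · exact Or.inr ((ih1 x).2 _ rfl h)
      · exact Or.inl ((ih2 x).1 hn)
    · rw [← Nat.add_assoc, Proc.add_mem_fv_shift] at h
      exact Or.inr ((ih1 x).1 h)
  | @repClose _ _ _ _ _ _ j i _ _ _ ih1 ih2 =>
    refine ⟨?_, by simp⟩
    simp only [CLab.ar, Nat.add_zero] at ih1 ih2 ⊢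
    rintro ((h | h) | h)
    · rw [← Nat.add_assoc, Proc.add_mem_fv_shift] at h
      exact (ih1 x).1 h
    · obtain ⟨n, hn, hx⟩ := Proc.mem_fv_subst.1 h
      rcases mem_fv_recv hx with h | rfl
      · exact (ih1 x).2 _ rfl h
      · exact (ih2 x).1 hn
    · exact Proc.add_mem_fv_shift.1 h

theorem Proc.mismatchFree_subst {P : Proc L} (σ : Subst L) :
    (P.subst σ).MismatchFree ↔ P.MismatchFree := by
  induction P generalizing σ with
  | zero | mismat => rfl
  | out M N P ih | mat M N P ih | inp M P ih | nu P ih | rep P ih =>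
    simp only [Proc.subst, Proc.MismatchFree, ih]
  | par P Q ih1 ih2 | sum P Q ih1 ih2 => simp only [Proc.subst, Proc.MismatchFree, ih1, ih2]

theorem CStep.mismatchFree {E : Set ℕ} {P P' : Proc L} {l : CLab L} {j : ℕ} {N : Option (Msg L)}
    (h : CStep Ax E P l j N P') (hP : P.MismatchFree) : P'.MismatchFree := by
  induction h with
  | inp | out => exact hP
  | sumL _ ih => exact ih hP.1
  | sumR _ ih => exact ih hP.2
  | mat _ _ ih => exact ih hP
  | mismat => exact hP.elim
  | res _ ih => exact ih hP
  | parL _ ih => exact ⟨ih hP.1, (Proc.mismatchFree_subst _).2 hP.2⟩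
  | parR _ ih => exact ⟨(Proc.mismatchFree_subst _).2 hP.1, ih hP.2⟩
  | repAct _ ih => exact ⟨ih hP, (Proc.mismatchFree_subst _).2 hP⟩
  | closeL _ _ ih1 ih2 =>
    exact ⟨(Proc.mismatchFree_subst _).2 (ih1 hP.1), (Proc.mismatchFree_subst _).2 (ih2 hP.2)⟩
  | closeR _ _ ih1 ih2 =>
    exact ⟨(Proc.mismatchFree_subst _).2 (ih2 hP.1), (Proc.mismatchFree_subst _).2 (ih1 hP.2)⟩
  | repClose _ _ ih1 ih2 =>
    exact ⟨⟨(Proc.mismatchFree_subst _).2 (ih1 hP), (Proc.mismatchFree_subst _).2 (ih2 hP)⟩,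
      (Proc.mismatchFree_subst _).2 hP⟩

/-- Only the mismatch rule consults the environment. This makes late transitions, which carry none,
comparable with commitments in any environment. -/
theorem CStep.change_env {E : Set ℕ} {P P' : Proc L} {l : CLab L} {j : ℕ} {N : Option (Msg L)}
    (h : CStep Ax E P l j N P') (hP : P.MismatchFree) (E' : Set ℕ) : CStep Ax E' P l j N P' := by
  induction h generalizing E' with
  | inp h => exact .inp h
  | out h => exact .out h
  | sumL _ ih => exact .sumL (ih hP.1 _)
  | sumR _ ih => exact .sumR (ih hP.2 _)
  | mat _ h ih => exact .mat (ih hP _) h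
  | mismat => exact hP.elim
  | res _ ih => exact .res (ih hP _)
  | parL _ ih => exact .parL (ih hP.1 _)
  | parR _ ih => exact .parR (ih hP.2 _)
  | repAct _ ih => exact .repAct (ih hP _)
  | closeL _ _ ih1 ih2 => exact .closeL (ih1 hP.1 _) (ih2 hP.2 _)
  | closeR _ _ ih1 ih2 => exact .closeR (ih1 hP.2 _) (ih2 hP.1 _)
  | repClose _ _ ih1 ih2 => exact .repClose (ih1 hP _) (ih2 hP _)

/-! ### Transfer of commitments between substitution instances -/

/-- Below any number of binders, the equalities and the entailed inequalities between instances
under `θ` carry over to the instances under `ρ`. -/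
structure Transfer (Ax : Msg L → Msg L → Prop) (E : Set ℕ) (θ : Subst L) (E' : Set ℕ)
    (ρ : Subst L) : Prop where
  eq : ∀ (m : ℕ) (M N : Msg L), EqE Ax (M.subst (upN m θ)) (N.subst (upN m θ)) →
    EqE Ax (M.subst (upN m ρ)) (N.subst (upN m ρ))
  ne : ∀ (m : ℕ) (M N : Msg L),
    EntailsNe Ax (extendEnvN m E) (M.subst (upN m θ)) (N.subst (upN m θ)) →
    EntailsNe Ax (extendEnvN m E') (M.subst (upN m ρ)) (N.subst (upN m ρ))

theorem Transfer.up {E E' : Set ℕ} {θ ρ : Subst L} (h : Transfer Ax E θ E' ρ) :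
    Transfer Ax (extendEnv E) θ.up (extendEnv E') ρ.up where
  eq m M N := by simpa only [upN_up] using h.eq (m + 1) M N
  ne m M N := by simpa only [upN_up, extendEnvN_extendEnv] using h.ne (m + 1) M N

theorem Transfer.eq_zero {E E' : Set ℕ} {θ ρ : Subst L} (h : Transfer Ax E θ E' ρ) {M N : Msg L}
    (hMN : EqE Ax (M.subst θ) (N.subst θ)) : EqE Ax (M.subst ρ) (N.subst ρ) := by
  simpa only [upN_zero] using h.eq 0 M N (by simpa only [upN_zero] using hMN)

theorem Transfer.ne_zero {E E' : Set ℕ} {θ ρ : Subst L} (h : Transfer Ax E θ E' ρ) {M N : Msg L}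
    (hMN : EntailsNe Ax E (M.subst θ) (N.subst θ)) : EntailsNe Ax E' (M.subst ρ) (N.subst ρ) := by
  simpa only [upN_zero, extendEnvN_zero] using
    h.ne 0 M N (by simpa only [upN_zero, extendEnvN_zero] using hMN)

theorem Transfer.equiv {E E' : Set ℕ} {θ ρ : Subst L} (h : Transfer Ax E θ E' ρ) {l l' : CLab L}
    (hl : CLab.Equiv Ax (l.subst θ) (l'.subst θ)) : CLab.Equiv Ax (l.subst ρ) (l'.subst ρ) := by
  cases l <;> cases l' <;> cases hl
  · exact .tau
  · next hl => exact .out (h.eq_zero hl)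
  · next hl => exact .inp (h.eq_zero hl)

/-- Communication commutes with substitution; needed for the three communication cases of
`CStep.transfer`. -/
theorem recv_upN (j i : ℕ) (N : Msg L) (θ : Subst L) (n : ℕ) :
    (upN (i + 1) θ n).subst (recv j i (N.subst (upN j θ))) =
      (recv j i N n).subst (upN (j + i) θ) := by
  rw [show upN (j + i) θ = upN i (upN j θ) by rw [upN_upN, Nat.add_comm], ← up_upN]
  cases n with
  | zero => simp only [Subst.up, v_subst, recv, scons_zero, Msg.shift_upN]
  | succ n =>
    simp only [Subst.up, recv, Msg.shift_subst, scons_succ, upN_subst]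
    congr 1
    funext m
    simp only [sh_apply, v_subst, upN_add]
    rfl

theorem Proc.subst_recv (P : Proc L) (j i : ℕ) (N : Msg L) (θ : Subst L) :
    (P.subst (upN (i + 1) θ)).subst (recv j i (N.subst (upN j θ))) =
      (P.subst (recv j i N)).subst (upN (j + i) θ) := by
  simp only [Proc.subst_subst, recv_upN]

theorem Proc.shift_subst_upN (P : Proc L) (j i : ℕ) (θ : Subst L) :
    (P.subst (upN j θ)).shift i = (P.shift i).subst (upN (j + i) θ) := by
  rw [Nat.add_comm, ← upN_upN, Proc.shift_upN]

/-- A derivation for `T.subst θ` looks at messages only through tests of equality and inequality,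
all of which survive the passage to `ρ`. So it is the instance of a derivation on the template `T`
and can be replayed under `ρ`. The label is recovered only up to the equational theory, because
channels may be replaced by equal messages. -/
theorem CStep.transfer {E : Set ℕ} {P P' : Proc L} {l : CLab L} {j : ℕ} {N : Option (Msg L)}
    (hs : CStep Ax E P l j N P') {E' : Set ℕ} {θ ρ : Subst L} (h : Transfer Ax E θ E' ρ)
    {T : Proc L} (hT : P = T.subst θ) :
    ∃ (l₀ : CLab L) (N₀ : Option (Msg L)) (T₀ : Proc L), CLab.Equiv Ax (l₀.subst θ) l ∧
      N = N₀.map (fun M => M.subst (upN j θ)) ∧ P' = T₀.subst (upN (j + l.ar) θ) ∧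
      CStep Ax E' (T.subst ρ) (l₀.subst ρ) j (N₀.map fun M => M.subst (upN j ρ))
        (T₀.subst (upN (j + l.ar) ρ)) := by
  induction hs generalizing E' θ ρ T with
  | @inp _ M M' P hM =>
    cases T <;> simp only [Proc.subst, reduceCtorEq] at hT
    next M₀ T =>
    obtain ⟨rfl, rfl⟩ := Proc.inp.inj hT
    refine ⟨.inp M₀, none, T, .inp hM, rfl, ?_, ?_⟩
    · simp only [CLab.ar, up_eq_upN, Nat.zero_add]
    · simp only [CLab.ar, Nat.zero_add, ← up_eq_upN]; exact .inp (.refl _)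
  | @out _ M M' N P hM =>
    cases T <;> simp only [Proc.subst, reduceCtorEq] at hT
    next M₀ N₀ T =>
    obtain ⟨rfl, rfl, rfl⟩ := Proc.out.inj hT
    refine ⟨.out M₀, some N₀, T, .out hM, ?_, ?_, ?_⟩
    · simp only [upN_zero, Option.map_some]
    · simp only [CLab.ar, upN_zero, Nat.zero_add]
    · simp only [CLab.ar, Nat.zero_add, upN_zero]; exact .out (.refl _)
  | sumL _ ih =>
    cases T <;> simp only [Proc.subst, reduceCtorEq] at hT
    next T₁ T₂ =>
    obtain ⟨rfl, rfl⟩ := Proc.sum.inj hT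
    obtain ⟨l₀, N₀, T₀, h1, h2, h3, h4⟩ := ih h rfl
    exact ⟨l₀, N₀, T₀, h1, h2, h3, .sumL h4⟩
  | sumR _ ih =>
    cases T <;> simp only [Proc.subst, reduceCtorEq] at hT
    next T₁ T₂ =>
    obtain ⟨rfl, rfl⟩ := Proc.sum.inj hT
    obtain ⟨l₀, N₀, T₀, h1, h2, h3, h4⟩ := ih h rfl
    exact ⟨l₀, N₀, T₀, h1, h2, h3, .sumR h4⟩
  | mat _ hM ih =>
    cases T <;> simp only [Proc.subst, reduceCtorEq] at hT
    next T =>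
    obtain ⟨rfl, rfl, rfl⟩ := Proc.mat.inj hT
    obtain ⟨l₀, N₀, T₀, h1, h2, h3, h4⟩ := ih h rfl
    exact ⟨l₀, N₀, T₀, h1, h2, h3, .mat h4 (h.eq_zero hM)⟩
  | mismat _ hM ih =>
    cases T <;> simp only [Proc.subst, reduceCtorEq] at hT
    next T =>
    obtain ⟨rfl, rfl, rfl⟩ := Proc.mismat.inj hT
    obtain ⟨l₀, N₀, T₀, h1, h2, h3, h4⟩ := ih h rfl
    exact ⟨l₀, N₀, T₀, h1, h2, h3, .mismat h4 (h.ne_zero hM)⟩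
  | @res _ _ _ l j _ _ ih =>
    cases T <;> simp only [Proc.subst, reduceCtorEq] at hT
    next T =>
    obtain rfl := Proc.nu.inj hT
    obtain ⟨l₀, N₀, T₀, h1, h2, h3, h4⟩ := ih h.up rfl
    simp only [upN_up, CLab.ar_subst] at h2 h3 h4
    rw [show j + l.ar + 1 = j + 1 + l.ar by omega] at h3 h4
    -- The template label found below the binder may mention the bound index `0`, although it equals
    -- a label without it. Any message may therefore be put for that index without leaving the
    -- equivalence class; the variable `0` of the outer scope is used.
    have e1 : ∀ (l₀ : CLab L) (τ : Subst L), ((l₀.subst (scons (v 0) fun n => v n)).subst τ) =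
        (l₀.subst τ.up).subst (scons (τ 0) fun n => v n) := by
      intro l₀ τ
      simp only [CLab.subst_subst]
      congr 1
      funext n
      cases n with
      | zero => rfl
      | succ n => simp only [scons_succ, v_subst, Subst.up, Msg.shift_subst, Msg.subst_v]
    have e2 : CLab.Equiv Ax ((l₀.subst (scons (v 0) fun n => v n)).subst θ) l := by
      rw [e1]
      have := h1.subst (scons (θ 0) fun n => v n)
      simpa only [CLab.subst_subst, sh_apply, v_subst, scons_succ, CLab.subst_v] using this
    refine ⟨l₀.subst (scons (v 0) fun n => v n), N₀, T₀, e2, h2, h3, .res (h4.relabel ?_)⟩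
    have e3 : ∀ τ : Subst L, ((l₀.subst (scons (v 0) fun n => v n)).subst τ).subst (sh 1) =
        ((l₀.subst (scons (v 0) fun n => v n)).subst (sh 1)).subst τ.up := by
      intro τ
      simp only [CLab.subst_subst]
      congr 1
      funext n
      rw [Msg.subst_subst, Msg.subst_subst]
      rfl
    rw [e3]
    refine h.up.equiv (h1.trans ?_)
    rw [← e3]
    exact (e2.subst _).symm
  | @parL _ _ _ _ l j _ _ ih =>
    cases T <;> simp only [Proc.subst, reduceCtorEq] at hT
    next T₁ T₂ =>
    obtain ⟨rfl, rfl⟩ := Proc.par.inj hT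
    obtain ⟨l₀, N₀, T₀, h1, h2, h3, h4⟩ := ih h rfl
    have har : l₀.ar = l.ar := by rw [← h1.ar_eq, CLab.ar_subst]
    refine ⟨l₀, N₀, .par T₀ (T₂.shift (j + l.ar)), h1, h2, ?_, ?_⟩
    · simp only [Proc.subst, Proc.shift_upN, h3]
    · simp only [Proc.subst, Proc.shift_upN]
      simpa only [CLab.ar_subst, har] using CStep.parL (Q := T₂.subst ρ) h4
  | @parR _ _ _ _ l j _ _ ih =>
    cases T <;> simp only [Proc.subst, reduceCtorEq] at hT
    next T₁ T₂ =>
    obtain ⟨rfl, rfl⟩ := Proc.par.inj hT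
    obtain ⟨l₀, N₀, T₀, h1, h2, h3, h4⟩ := ih h rfl
    have har : l₀.ar = l.ar := by rw [← h1.ar_eq, CLab.ar_subst]
    refine ⟨l₀, N₀, .par (T₁.shift (j + l.ar)) T₀, h1, h2, ?_, ?_⟩
    · simp only [Proc.subst, Proc.shift_upN, h3]
    · simp only [Proc.subst, Proc.shift_upN]
      simpa only [CLab.ar_subst, har] using CStep.parR (P := T₁.subst ρ) h4
  | @repAct _ _ _ l j _ _ ih =>
    cases T <;> simp only [Proc.subst, reduceCtorEq] at hT
    next T =>
    obtain rfl := Proc.rep.inj hT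
    obtain ⟨l₀, N₀, T₀, h1, h2, h3, h4⟩ := ih h rfl
    have har : l₀.ar = l.ar := by rw [← h1.ar_eq, CLab.ar_subst]
    refine ⟨l₀, N₀, .par T₀ ((Proc.rep T).shift (j + l.ar)), h1, h2, ?_, ?_⟩
    · simp only [Proc.subst, Proc.shift_upN, h3]
    · have := CStep.repAct h4
      simpa only [CLab.ar_subst, har, Proc.subst, Proc.shift_upN] using this
  | @closeL _ _ _ _ _ _ _ j i _ _ _ ih1 ih2 =>
    cases T <;> simp only [Proc.subst, reduceCtorEq] at hT
    next T₁ T₂ =>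
    obtain ⟨rfl, rfl⟩ := Proc.par.inj hT
    obtain ⟨l₀, N₀, T₀, h1, h2, h3, h4⟩ := ih1 h rfl
    obtain ⟨l₁, N₁, T₁', g1, g2, g3, g4⟩ := ih2 h rfl
    cases l₀ <;> cases h1
    next M₀ h1 =>
    cases l₁ <;> cases g1
    next M₁ g1 =>
    cases N₀ with
    | none => cases h2
    | some N₀ =>
    obtain rfl := Option.some.inj h2
    refine ⟨.tau, none, .par (T₀.shift i) (T₁'.subst (recv j i N₀)), .tau, rfl, ?_, ?_⟩
    · simp only [Proc.subst, h3, g3, CLab.ar, Nat.add_zero, Proc.subst_recv, Proc.shift_subst_upN]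
    -- The two channels agree under `θ` only up to the theory, so their equality also has to be
    -- transferred to `ρ`.
    · have g4' := g4.relabel (.inp (h.eq_zero (g1.trans h1.symm)))
      have := CStep.closeL h4 g4'
      simpa only [Proc.subst, CLab.ar, Nat.add_zero, Proc.subst_recv, Proc.shift_subst_upN,
        Option.map_none, CLab.subst] using this
  | @closeR _ _ _ _ _ _ _ j i _ _ _ ih1 ih2 =>
    cases T <;> simp only [Proc.subst, reduceCtorEq] at hT
    next T₁ T₂ =>
    obtain ⟨rfl, rfl⟩ := Proc.par.inj hT
    obtain ⟨l₀, N₀, T₀, h1, h2, h3, h4⟩ := ih1 h rfl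
    obtain ⟨l₁, N₁, T₁', g1, g2, g3, g4⟩ := ih2 h rfl
    cases l₀ <;> cases h1
    next M₀ h1 =>
    cases l₁ <;> cases g1
    next M₁ g1 =>
    cases N₀ with
    | none => cases h2
    | some N₀ =>
    obtain rfl := Option.some.inj h2
    refine ⟨.tau, none, .par (T₁'.subst (recv j i N₀)) (T₀.shift i), .tau, rfl, ?_, ?_⟩
    · simp only [Proc.subst, h3, g3, CLab.ar, Nat.add_zero, Proc.subst_recv, Proc.shift_subst_upN]
    · have g4' := g4.relabel (.inp (h.eq_zero (g1.trans h1.symm)))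
      have := CStep.closeR h4 g4'
      simpa only [Proc.subst, CLab.ar, Nat.add_zero, Proc.subst_recv, Proc.shift_subst_upN,
        Option.map_none, CLab.subst] using this
  | @repClose _ _ _ _ _ _ j i _ _ _ ih1 ih2 =>
    cases T <;> simp only [Proc.subst, reduceCtorEq] at hT
    next T =>
    obtain rfl := Proc.rep.inj hT
    obtain ⟨l₀, N₀, T₀, h1, h2, h3, h4⟩ := ih1 h rfl
    obtain ⟨l₁, N₁, T₁', g1, g2, g3, g4⟩ := ih2 h rfl
    cases l₀ <;> cases h1
    next M₀ h1 =>
    cases l₁ <;> cases g1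
    next M₁ g1 =>
    cases N₀ with
    | none => cases h2
    | some N₀ =>
    obtain rfl := Option.some.inj h2
    refine ⟨.tau, none, .par (.par (T₀.shift i) (T₁'.subst (recv j i N₀)))
      ((Proc.rep T).shift (j + i)), .tau, rfl, ?_, ?_⟩
    · simp only [h3, g3, CLab.ar, Nat.add_zero, Proc.subst_recv, Proc.shift_subst_upN]
      simp only [Proc.subst, Proc.shift_upN]
    · have g4' := g4.relabel (.inp (h.eq_zero (g1.trans h1.symm)))
      have := CStep.repClose h4 g4'
      simp only [CLab.ar, Nat.add_zero, Proc.subst_recv, Proc.shift_subst_upN] at this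
      simpa only [Proc.subst, CLab.ar, Nat.add_zero, Proc.shift_upN, Option.map_none,
        CLab.subst] using this

/-! ### Invariance of commitments under injective renamings. -/

/-- `g` embeds the scope of the environment `E` into that of `E'`. -/
structure RenEnv (g : ℕ → ℕ) (E E' : Set ℕ) : Prop where
  inj : Function.Injective g
  mem : ∀ n, g n ∈ E' ↔ n ∈ E

theorem RenEnv.up {g : ℕ → ℕ} {E E' : Set ℕ} (h : RenEnv g E E') (m : ℕ) :
    RenEnv (fun n => if n < m then n else g (n - m) + m) (extendEnvN m E) (extendEnvN m E') := by
  constructor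
  · intro a b hab
    simp only at hab
    split_ifs at hab with h1 h2 h2
    · exact hab
    · omega
    · omega
    · have := h.inj (Nat.add_right_cancel hab)
      omega
  · intro n
    split_ifs with h1
    · exact iff_of_true (Or.inl h1) (Or.inl h1)
    · obtain ⟨n, rfl⟩ := Nat.exists_eq_add_of_le' (not_lt.1 h1)
      simp only [Nat.add_sub_cancel]
      have key : ∀ (F : Set ℕ) (a : ℕ), a + m ∈ extendEnvN m F ↔ a ∈ F := by
        intro F a
        constructor
        · rintro (ha | ⟨b, hb, he⟩)
          · omega
          · rwa [Nat.add_right_cancel he]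
        · exact fun ha => Or.inr ⟨a, ha, rfl⟩
      rw [key, key, h.mem]

theorem EqE.of_ren {g : ℕ → ℕ} (hg : Function.Injective g) {M N : Msg L}
    (h : EqE Ax (M.subst fun n => v (g n)) (N.subst fun n => v (g n))) : EqE Ax M N := by
  have := h.subst (fun n => v (Function.invFun g n))
  simpa only [Msg.subst_subst, v_subst, Function.leftInverse_invFun hg _, Msg.subst_v] using this

/-- A unifier before renaming is conjugated by `g` and extended by the identity off the range of
`g`; this gives a unifier after renaming. -/
theorem RenEnv.entailsNe_of_ren {g : ℕ → ℕ} {E E' : Set ℕ} (h : RenEnv g E E') {M N : Msg L}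
    (hMN : EntailsNe Ax E' (M.subst fun n => v (g n)) (N.subst fun n => v (g n))) :
    EntailsNe Ax E M N := by
  classical
  rintro ⟨σ, hσ, he⟩
  rw [freshFor_iff] at hσ
  have hval : ∀ n, (Function.extend g (fun n => (σ n).subst fun n => v (g n)) (fun n => v n) : Subst L)
      (g n) = (σ n).subst fun n => v (g n) := fun n => h.inj.extend_apply _ _ _
  refine hMN ⟨Function.extend g (fun n => (σ n).subst fun n => v (g n)) (fun n => v n), ?_, ?_⟩
  · rw [freshFor_iff]
    constructor
    · intro x hx
      by_cases hr : ∃ n, g n = x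
      · obtain ⟨n, rfl⟩ := hr
        rw [hval, hσ.1 n ((h.mem n).1 hx), v_subst]
      · rw [Function.extend_apply' _ _ _ hr]
    · intro y hy x hx hxy
      by_cases hr : ∃ n, g n = y
      · obtain ⟨n, rfl⟩ := hr
        rw [hval, Msg.mem_fv_subst] at hxy
        obtain ⟨m, hm, hxm⟩ := hxy
        rw [Msg.fv_var, Set.mem_singleton_iff] at hxm
        subst hxm
        exact hσ.2 n (fun hn => hy ((h.mem n).2 hn)) m ((h.mem m).1 hx) hm
      · rw [Function.extend_apply' _ _ _ hr, Msg.fv_var, Set.mem_singleton_iff] at hxy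
        exact hy (hxy ▸ hx)
  · have := he.subst (fun n => v (g n))
    simpa only [Msg.subst_subst, v_subst, hval] using this

/-- A unifier after renaming may produce variables off the range of `g`. They are all sent to one
variable outside `E`, so that the unifier pulled back is still fresh for `E`; finiteness of `E`
provides that variable. -/
theorem RenEnv.entailsNe_ren {g : ℕ → ℕ} {E E' : Set ℕ} (h : RenEnv g E E') (hE : E.Finite)
    {M N : Msg L} (hMN : EntailsNe Ax E M N) :
    EntailsNe Ax E' (M.subst fun n => v (g n)) (N.subst fun n => v (g n)) := by
  classical
  obtain ⟨y, hy⟩ := hE.exists_notMem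
  rintro ⟨σ, hσ, he⟩
  rw [freshFor_iff] at hσ
  have hval : ∀ n, Function.extend g id (fun _ => y) (g n) = n := fun n => h.inj.extend_apply _ _ _
  refine hMN ⟨fun n => (σ (g n)).subst fun n => v (Function.extend g id (fun _ => y) n), ?_, ?_⟩
  · rw [freshFor_iff]
    constructor
    · intro x hx
      simp only [hσ.1 _ ((h.mem x).2 hx), v_subst, hval]
    · intro z hz x hx hxz
      simp only [Msg.mem_fv_subst, Msg.fv_var, Set.mem_singleton_iff] at hxz
      obtain ⟨m, hm, rfl⟩ := hxz
      by_cases hr : ∃ n, g n = m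
      · obtain ⟨n, rfl⟩ := hr
        rw [hval] at hx
        exact hσ.2 (g z) (fun hz' => hz ((h.mem z).1 hz')) (g n) ((h.mem n).2 hx) hm
      · rw [Function.extend_apply' _ _ _ hr] at hx
        exact hy hx
  · have := he.subst (fun n => v (Function.extend g id (fun _ => y) n))
    simpa only [Msg.subst_subst, v_subst] using this

theorem RenEnv.transfer_unren {g : ℕ → ℕ} {E E' : Set ℕ} (h : RenEnv g E E') :
    Transfer Ax E' (fun n => v (g n)) E (fun n => v n) where
  eq m M N := by
    rw [upN_ren, upN_v, Msg.subst_v, Msg.subst_v]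
    exact EqE.of_ren (h.up m).inj
  ne m M N := by
    rw [upN_ren, upN_v, Msg.subst_v, Msg.subst_v]
    exact (h.up m).entailsNe_of_ren

theorem RenEnv.transfer_ren {g : ℕ → ℕ} {E E' : Set ℕ} (h : RenEnv g E E') (hE : E.Finite) :
    Transfer Ax E (fun n => v n) E' (fun n => v (g n)) where
  eq m M N := by
    rw [upN_v, upN_ren, Msg.subst_v, Msg.subst_v]
    exact fun h => h.subst _
  ne m M N := by
    rw [upN_v, upN_ren, Msg.subst_v, Msg.subst_v]
    exact (h.up m).entailsNe_ren (extendEnvN_finite hE m)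

theorem Option.map_subst_v (N : Option (Msg L)) : N.map (fun M => M.subst fun n => v n) = N := by
  cases N <;> simp [Msg.subst_v]

theorem CStep.ren {g : ℕ → ℕ} {E E' : Set ℕ} (h : RenEnv g E E') (hE : E.Finite)
    {P P' : Proc L} {l : CLab L} {j : ℕ} {N : Option (Msg L)} (hs : CStep Ax E P l j N P') :
    CStep Ax E' (P.subst fun n => v (g n)) (l.subst fun n => v (g n)) j
      (N.map fun M => M.subst (upN j fun n => v (g n)))
      (P'.subst (upN (j + l.ar) fun n => v (g n))) := by
  obtain ⟨l₀, N₀, T₀, h1, rfl, rfl, h4⟩ := hs.transfer (h.transfer_ren hE) (Proc.subst_v P).symm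
  rw [CLab.subst_v] at h1
  simp only [upN_v, Proc.subst_v, Option.map_subst_v]
  exact h4.relabel (h1.subst _)

theorem CStep.unren {g : ℕ → ℕ} {E E' : Set ℕ} (h : RenEnv g E E') {P P' : Proc L} {l : CLab L}
    {j : ℕ} {N : Option (Msg L)}
    (hs : CStep Ax E' (P.subst fun n => v (g n)) (l.subst fun n => v (g n)) j N P') :
    ∃ (N₀ : Option (Msg L)) (P₀ : Proc L), CStep Ax E P l j N₀ P₀ ∧
      N = (N₀.map fun M => M.subst (upN j fun n => v (g n))) ∧
      P' = P₀.subst (upN (j + l.ar) fun n => v (g n)) := by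
  obtain ⟨l₀, N₀, T₀, h1, h2, h3, h4⟩ := hs.transfer h.transfer_unren rfl
  simp only [upN_v, Proc.subst_v, Option.map_subst_v, CLab.subst_v] at h4
  rw [CLab.ar_subst] at h3
  refine ⟨N₀, T₀, h4.relabel (h1.of_subst_inj (τ := fun n => v (Function.invFun g n)) ?_), h2, h3⟩
  intro n
  rw [v_subst, Function.leftInverse_invFun h.inj]

theorem renEnv_shift (k : ℕ) (E : Set ℕ) : RenEnv (fun n => n + k) E ((· + k) '' E) where
  inj := add_left_injective k
  mem n := by simp

end Commitments

/-! ### Extended processes below binders -/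

section EProcs

variable {L : FirstOrder.Language.{u, w}}

theorem nus_base_inj {k j : ℕ} {σ θ : Subst L} {P Q : Proc L}
    (h : EProc.nus k (.base σ P) = EProc.nus j (.base θ Q)) : k = j ∧ σ = θ ∧ P = Q := by
  induction k generalizing j with
  | zero =>
    cases j with
    | zero => exact ⟨rfl, EProc.base.inj h⟩
    | succ j => cases h
  | succ k ih =>
    cases j with
    | zero => cases h
    | succ j =>
      obtain ⟨rfl, h'⟩ := ih (EProc.nu.inj h)
      exact ⟨rfl, h'⟩

theorem nus_nus (k j : ℕ) (A : EProc L) : EProc.nus k (EProc.nus j A) = EProc.nus (k + j) A := by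
  induction k with
  | zero => simp [EProc.nus]
  | succ k ih => rw [Nat.succ_add]; simp only [EProc.nus, ih]

theorem parR_nus (k : ℕ) (A : EProc L) (Q : Proc L) :
    (EProc.nus k A).parR Q = EProc.nus k (A.parR (Q.shift k)) := by
  induction k generalizing Q with
  | zero => rw [Proc.shift_zero]; rfl
  | succ k ih => simp only [EProc.nus, EProc.parR, ih, Proc.shift_shift, Nat.add_comm]

theorem parL_nus (k : ℕ) (A : EProc L) (P : Proc L) :
    EProc.parL P (EProc.nus k A) = EProc.nus k (EProc.parL (P.shift k) A) := by
  induction k generalizing P with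
  | zero => rw [Proc.shift_zero]; rfl
  | succ k ih => simp only [EProc.nus, EProc.parL, ih, Proc.shift_shift, Nat.add_comm]

theorem addSubst_nus (k : ℕ) (A : EProc L) (σ : Subst L) :
    EProc.addSubst σ (EProc.nus k A) = EProc.nus k (EProc.addSubst (upN k σ) A) := by
  induction k generalizing σ with
  | zero => rw [upN_zero]; rfl
  | succ k ih => simp only [EProc.nus, EProc.addSubst, ih, upN_up]

theorem substProc_nus (k : ℕ) (A : EProc L) (σ : Subst L) :
    (EProc.nus k A).substProc σ = EProc.nus k (A.substProc (upN k σ)) := by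
  induction k generalizing σ with
  | zero => rw [upN_zero]; rfl
  | succ k ih => simp only [EProc.nus, EProc.substProc, ih, upN_up]

/-- `ν z₁ … z_k. P` for processes. -/
def nusP : ℕ → Proc L → Proc L
  | 0, P => P
  | k + 1, P => .nu (nusP k P)

theorem toProc_nus (k : ℕ) (A : EProc L) : (EProc.nus k A).toProc = nusP k A.toProc := by
  induction k with
  | zero => rfl
  | succ k ih => simp only [EProc.nus, EProc.toProc, nusP, ih]

/-- The active substitution of the result of a commitment. -/
def CLab.frame (l : CLab L) (x j : ℕ) (N : Option (Msg L)) : Subst L :=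
  match l with
  | .tau => Subst.id
  | .out _ => Subst.single (x + j) (N.getD (v 0))
  | .inp _ => Subst.id

/-- The body of a commitment, applied to a received message. -/
def CLab.body (l : CLab L) (P : Proc L) (M : Msg L) : Proc L :=
  match l with
  | .tau => P
  | .out _ => P
  | .inp _ => P.inst M

/-- The extended process that results from a commitment. -/
def CLab.result (l : CLab L) (x : ℕ) (I : Msg L) (j : ℕ) (N : Option (Msg L)) (P : Proc L) : EProc L :=
  EProc.nus j (.base (l.frame x j N) (l.body P (Msg.shift j I)))

theorem shift_succ_inst (P : Proc L) (j : ℕ) (M : Msg L) : (P.shift (j + 1)).inst M = P.shift j := by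
  rw [Proc.inst_eq, Proc.shift_subst]; rfl

theorem CLab.body_shift (l : CLab L) (P : Proc L) (j : ℕ) (M : Msg L) :
    l.body (P.shift (j + l.ar)) M = P.shift j := by
  cases l
  · rfl
  · rfl
  · exact shift_succ_inst P j M

theorem CLab.body_par (l : CLab L) (P Q : Proc L) (M : Msg L) :
    l.body (.par P Q) M = .par (l.body P M) (l.body Q M) := by cases l <;> rfl

theorem CLab.result_parR (l : CLab L) (x : ℕ) (I : Msg L) (j : ℕ) (N : Option (Msg L)) (P Q : Proc L) :
    (l.result x I j N P).parR Q = l.result x I j N (.par P (Q.shift (j + l.ar))) := by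
  simp only [CLab.result, parR_nus, EProc.parR, CLab.body_par, CLab.body_shift]

theorem CLab.result_parL (l : CLab L) (x : ℕ) (I : Msg L) (j : ℕ) (N : Option (Msg L)) (P Q : Proc L) :
    EProc.parL P (l.result x I j N Q) = l.result x I j N (.par (P.shift (j + l.ar)) Q) := by
  simp only [CLab.result, parL_nus, EProc.parL, CLab.body_par, CLab.body_shift]

theorem CLab.result_nu (l : CLab L) (x : ℕ) (I : Msg L) (j : ℕ) (N : Option (Msg L)) (P : Proc L) :
    EProc.nu ((l.subst (sh 1)).result (x + 1) (Msg.shift 1 I) j N P) = l.result x I (j + 1) N P := by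
  cases l with
  | tau => rfl
  | out M =>
    simp only [CLab.result, CLab.subst, CLab.frame, CLab.body, EProc.nus]
    rw [Nat.add_assoc, Nat.add_comm 1 j]
  | inp M =>
    simp only [CLab.result, CLab.subst, CLab.frame, CLab.body, EProc.nus, Msg.shift_shift]
    rw [Nat.add_comm 1 j]

/-- Early actions from labels. -/
def CLab.act (l : CLab L) (x : ℕ) (I : Msg L) : Act L :=
  match l with
  | .tau => .tau
  | .out M => .out M x
  | .inp M => .inp M I

/-- Late actions from labels. -/
def CLab.lact (l : CLab L) (x : ℕ) : LAct L :=
  match l with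
  | .tau => .tau
  | .out M => .out M x
  | .inp M => .inp M x

theorem CLab.act_shift (l : CLab L) (x : ℕ) (I : Msg L) :
    (l.act x I).shift = (l.subst (sh 1)).act (x + 1) (Msg.shift 1 I) := by cases l <;> rfl

theorem CLab.lact_shift (l : CLab L) (x : ℕ) :
    (l.lact x).shift = (l.subst (sh 1)).lact (x + 1) := by cases l <;> rfl

end EProcs

/-! ### Commitments and labelled transitions -/

section Correspondence

variable {L : FirstOrder.Language.{u, w}} {Ax : Msg L → Msg L → Prop}

/-- The communication rules let a shifted receiver input the payload, whereas commitments apply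
`recv` to the unshifted one; the results coincide. -/
theorem inst_upN_sh (Q : Proc L) (k i : ℕ) (N : Msg L) :
    (Q.subst (upN (i + 1) (sh k))).inst (Msg.shift i N) = Q.subst (recv k i N) := by
  rw [Proc.inst_eq, Proc.subst_subst]
  congr 1
  funext n
  rw [← up_upN]
  cases n with
  | zero => rfl
  | succ n => simp only [Subst.up, recv, scons_succ, Msg.shift_subst, Msg.subst_v]

theorem CStep.unshift {E : Set ℕ} {k : ℕ} {P P' : Proc L} {l : CLab L} {j : ℕ} {N : Option (Msg L)}
    (hs : CStep Ax ((· + k) '' E) (P.shift k) (l.subst (sh k)) j N P') :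
    ∃ (N₀ : Option (Msg L)) (P₀ : Proc L), CStep Ax E P l j N₀ P₀ ∧
      P' = P₀.subst (upN (j + l.ar) (sh k)) := by
  obtain ⟨N₀, P₀, h1, -, h3⟩ := CStep.unren (renEnv_shift k E) hs
  exact ⟨N₀, P₀, h1, h3⟩

/-- The bound name `x` and the received message `I` are only parameters of the action: the
commitment lives before they are chosen, and `CLab.result` puts them back. -/
theorem Step.toCStep {E : Set ℕ} {P : Proc L} {π : Act L} {A : EProc L} (h : Step Ax E P π A)
    {l : CLab L} {x : ℕ} {I : Msg L} (hπ : π = l.act x I) :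
    ∃ j N P', CStep Ax E P l j N P' ∧ A = l.result x I j N P' := by
  -- The payload of an output premise is read off the resulting frame at its only domain candidate,
  -- `x + k`.
  have hout : ∀ {E : Set ℕ} {P P' : Proc L} {M N : Msg L} {x k : ℕ}, (∃ j N' P'',
      CStep Ax E P (.out M) j N' P'' ∧ EProc.nus k (.base (Subst.single (x + k) N) P') =
        (CLab.out M).result x (v 0) j N' P'') → CStep Ax E P (.out M) k (some N) P' := by
    rintro E P P' M N x k ⟨j, N', P'', h1, h2⟩
    obtain ⟨rfl, h3, rfl⟩ := nus_base_inj h2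
    obtain ⟨N', rfl⟩ := h1.exists_payload rfl
    have := congrFun h3 (x + k)
    simp only [Subst.single, CLab.frame, if_true, Option.getD_some] at this
    exact this ▸ h1
  induction h generalizing l x I with
  | inp N h =>
    cases l <;> cases hπ
    exact ⟨0, none, _, .inp h, by simp only [CLab.result, CLab.body, Msg.shift_zero]; rfl⟩
  | @out _ _ _ N _ _ h _ =>
    cases l <;> cases hπ
    exact ⟨0, some N, _, .out h, rfl⟩
  | sumL _ ih => obtain ⟨j, N, P', h1, h2⟩ := ih hπ; exact ⟨j, N, P', .sumL h1, h2⟩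
  | sumR _ ih => obtain ⟨j, N, P', h1, h2⟩ := ih hπ; exact ⟨j, N, P', .sumR h1, h2⟩
  | mat _ h ih => obtain ⟨j, N, P', h1, h2⟩ := ih hπ; exact ⟨j, N, P', .mat h1 h, h2⟩
  | mismat _ h ih => obtain ⟨j, N, P', h1, h2⟩ := ih hπ; exact ⟨j, N, P', .mismat h1 h, h2⟩
  | res _ ih =>
    obtain ⟨j, N, P', h1, rfl⟩ := ih (by rw [hπ, CLab.act_shift])
    exact ⟨j + 1, N, P', .res h1, CLab.result_nu _ _ _ _ _ _⟩
  | parL _ _ ih =>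
    obtain ⟨j, N, P', h1, rfl⟩ := ih hπ
    exact ⟨j, N, _, .parL h1, CLab.result_parR _ _ _ _ _ _ _⟩
  | parR _ _ ih =>
    obtain ⟨j, N, P', h1, rfl⟩ := ih hπ
    exact ⟨j, N, _, .parR h1, CLab.result_parL _ _ _ _ _ _ _⟩
  | repAct _ _ ih =>
    obtain ⟨j, N, P', h1, rfl⟩ := ih hπ
    exact ⟨j, N, _, .repAct h1, CLab.result_parR _ _ _ _ _ _ _⟩
  | @closeL _ _ _ _ _ M M' N x k _ _ hM _ ih1 ih2 =>
    cases l <;> cases hπ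
    have h1 := hout (ih1 (l := .out M) (I := v 0) rfl)
    obtain ⟨i, N', Q', h2, rfl⟩ := ih2 (l := (CLab.inp M').subst (sh k)) (x := 0) (I := N) rfl
    obtain ⟨N₀, Q₀, h3, rfl⟩ := h2.unshift
    refine ⟨k + i, none, _, .closeL h1 (h3.relabel (.inp hM.symm)), ?_⟩
    simp only [CLab.result, CLab.subst, CLab.body, CLab.frame, parL_nus, nus_nus, EProc.parL,
      CLab.ar, inst_upN_sh]
  | @closeR _ _ _ _ _ M M' N x k _ _ hM _ ih1 ih2 =>
    cases l <;> cases hπ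
    have h1 := hout (ih1 (l := .out M) (I := v 0) rfl)
    obtain ⟨i, N', Q', h2, rfl⟩ := ih2 (l := (CLab.inp M').subst (sh k)) (x := 0) (I := N) rfl
    obtain ⟨N₀, Q₀, h3, rfl⟩ := h2.unshift
    refine ⟨k + i, none, _, .closeR h1 (h3.relabel (.inp hM.symm)), ?_⟩
    simp only [CLab.result, CLab.subst, CLab.body, CLab.frame, parR_nus, nus_nus, EProc.parR,
      CLab.ar, inst_upN_sh]
  | @repClose _ _ _ _ M M' N x k _ _ hM ih1 ih2 =>
    cases l <;> cases hπ
    have h1 := hout (ih1 (l := .out M) (I := v 0) rfl)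
    obtain ⟨i, N', Q', h2, rfl⟩ := ih2 (l := (CLab.inp M').subst (sh k)) (x := 0) (I := N) rfl
    obtain ⟨N₀, Q₀, h3, rfl⟩ := h2.unshift
    refine ⟨k + i, none, _, .repClose h1 (h3.relabel (.inp hM.symm)), ?_⟩
    simp only [CLab.result, CLab.subst, CLab.body, CLab.frame, parR_nus, parL_nus, nus_nus,
      EProc.parR, EProc.parL, CLab.ar, inst_upN_sh, Proc.shift_shift]

theorem CStep.shift {E : Set ℕ} (hE : E.Finite) (k : ℕ) {P P' : Proc L} {l : CLab L} {j : ℕ}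
    {N : Option (Msg L)} (hs : CStep Ax E P l j N P') :
    CStep Ax ((· + k) '' E) (P.shift k) (l.subst (sh k)) j
      (N.map fun M => M.subst (upN j (sh k))) (P'.subst (upN (j + l.ar) (sh k))) :=
  hs.ren (renEnv_shift k E) hE

theorem CLab.bn_act_subset (l : CLab L) (x : ℕ) (I : Msg L) : (l.act x I).bn ⊆ {x} := by
  cases l <;> simp [CLab.act, Act.bn]

theorem CLab.disjoint_bn_act {l : CLab L} {x : ℕ} {I : Msg L} {s : Set ℕ} (h : x ∉ s) :
    Disjoint (l.act x I).bn s :=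
  (Set.disjoint_singleton_left.2 h).mono_left (l.bn_act_subset x I)

theorem CLab.disjoint_bn_lact {l : CLab L} {x : ℕ} {s : Set ℕ} (h : x ∉ s) :
    Disjoint (l.lact x).bn s := by
  refine (Set.disjoint_singleton_left.2 h).mono_left ?_
  cases l <;> simp [CLab.lact, LAct.bn]

theorem CLab.succ_mem_fv_shift {l : CLab L} {x : ℕ} : x + 1 ∈ (l.subst (sh 1)).fv ↔ x ∈ l.fv := by
  cases l
  · rfl
  all_goals exact Msg.add_mem_fv_shift

theorem succ_mem_extendEnv {E : Set ℕ} {x : ℕ} : x + 1 ∈ extendEnv E ↔ x ∈ E := by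
  simp [extendEnv]

/-- The communication rules speak about a shifted copy of the receiver, which is no subprocess. The
induction is on `P` with `σ` general, so that shifted copies are covered by its hypotheses.
Finiteness of `E` leaves room for the bound names that these rules need. -/
theorem CStep.toStep {P : Proc L} (σ : Subst L) {E : Set ℕ} (hE : E.Finite) {P' : Proc L}
    {l : CLab L} {j : ℕ} {N : Option (Msg L)} (h : CStep Ax E (P.subst σ) l j N P') {x : ℕ}
    (hx : x ∉ (P.subst σ).fv ∪ l.fv ∪ E) (I : Msg L) :
    Step Ax E (P.subst σ) (l.act x I) (l.result x I j N P') := by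
  induction P generalizing σ E P' l j N x I with
  | zero => cases h
  | out M N P ih =>
    cases h with
    | out h =>
      refine Step.out h ?_
      simp only [Proc.subst, Proc.fv, CLab.fv, Set.mem_union] at hx ⊢
      tauto
  | inp M P ih =>
    cases h with
    | inp h =>
      simp only [CLab.result, CLab.body, Msg.shift_zero]
      exact Step.inp I h
  | mat M N P ih =>
    simp only [Proc.subst, Proc.fv, Set.mem_union, not_or] at hx
    cases h with
    | mat h hM => exact .mat (ih σ hE h (by simp only [Set.mem_union]; tauto) I) hM
  | mismat M N P ih =>
    simp only [Proc.subst, Proc.fv, Set.mem_union, not_or] at hx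
    cases h with
    | mismat h hM => exact .mismat (ih σ hE h (by simp only [Set.mem_union]; tauto) I) hM
  | nu P ih =>
    cases h with
    | res h =>
      have := ih σ.up (extendEnv_finite hE) h (x := x + 1) ?_ (Msg.shift 1 I)
      · rw [← CLab.act_shift] at this
        rw [← CLab.result_nu]
        exact .res this
      · simpa only [Proc.subst, Proc.fv, Set.mem_union, Set.mem_ofPred_eq, CLab.succ_mem_fv_shift,
          succ_mem_extendEnv] using hx
  | sum P Q ih1 ih2 =>
    simp only [Proc.subst, Proc.fv, Set.mem_union, not_or] at hx
    cases h with
    | sumL h => exact .sumL (ih1 σ hE h (by simp only [Set.mem_union]; tauto) I)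
    | sumR h => exact .sumR (ih2 σ hE h (by simp only [Set.mem_union]; tauto) I)
  | par P Q ih1 ih2 =>
    simp only [Proc.subst, Proc.fv, Set.mem_union, not_or] at hx
    cases h with
    | parL h =>
      rw [← CLab.result_parR]
      exact .parL (ih1 σ hE h (by simp only [Set.mem_union]; tauto) I)
        (CLab.disjoint_bn_act hx.1.1.2)
    | parR h =>
      rw [← CLab.result_parL]
      exact .parR (ih2 σ hE h (by simp only [Set.mem_union]; tauto) I)
        (CLab.disjoint_bn_act hx.1.1.1)
    | @closeL _ _ _ _ _ M N j i N' h1 h2 =>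
      obtain ⟨y, hy⟩ := (((((P.subst σ).fv_finite).union (Q.subst σ).fv_finite).union
        (Msg.fv_finite M)).union hE).exists_notMem
      simp only [Set.mem_union, not_or] at hy
      have g1 := ih1 σ hE h1 (x := y) (by simp only [Set.mem_union, CLab.fv]; tauto) (v 0)
      have h2' := h2.shift hE j
      simp only [Proc.shift, Proc.subst_subst] at h2'
      obtain ⟨z, hz⟩ := ((((Q.subst fun n => (σ n).subst fun n => v (n + j)).fv_finite).union
        (CLab.fv_finite ((CLab.inp M).subst (sh j)))).union (hE.image (· + j))).exists_notMem
      have g2 := ih2 _ (hE.image _) h2' hz N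
      rw [← Proc.subst_subst] at g2
      have := Step.closeL g1 g2 (.refl M) hy.1.1.2
      simpa only [CLab.result, CLab.subst, CLab.body, CLab.frame, parL_nus, nus_nus, EProc.parL,
        CLab.ar, inst_upN_sh, Proc.subst, CLab.act] using this
    | @closeR _ _ _ _ _ M N j i N' h1 h2 =>
      obtain ⟨y, hy⟩ := (((((P.subst σ).fv_finite).union (Q.subst σ).fv_finite).union
        (Msg.fv_finite M)).union hE).exists_notMem
      simp only [Set.mem_union, not_or] at hy
      have g1 := ih2 σ hE h1 (x := y) (by simp only [Set.mem_union, CLab.fv]; tauto) (v 0)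
      have h2' := h2.shift hE j
      simp only [Proc.shift, Proc.subst_subst] at h2'
      obtain ⟨z, hz⟩ := ((((P.subst fun n => (σ n).subst fun n => v (n + j)).fv_finite).union
        (CLab.fv_finite ((CLab.inp M).subst (sh j)))).union (hE.image (· + j))).exists_notMem
      have g2 := ih1 _ (hE.image _) h2' hz N
      rw [← Proc.subst_subst] at g2
      have := Step.closeR g1 g2 (.refl M) hy.1.1.1
      simpa only [CLab.result, CLab.subst, CLab.body, CLab.frame, parR_nus, nus_nus, EProc.parR,
        CLab.ar, inst_upN_sh, Proc.subst, CLab.act] using this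
  | rep P ih =>
    simp only [Proc.subst, Proc.fv, Set.mem_union, not_or] at hx
    cases h with
    | repAct h =>
      have := Step.repAct (ih σ hE h (by simp only [Set.mem_union]; tauto) I)
        (CLab.disjoint_bn_act hx.1.1)
      rwa [CLab.result_parR] at this
    | @repClose _ _ _ _ M N j i N' h1 h2 =>
      obtain ⟨y, hy⟩ := ((((P.subst σ).fv_finite).union (Msg.fv_finite M)).union hE).exists_notMem
      have g1 := ih σ hE h1 (x := y) (by simpa only [CLab.fv] using hy) (v 0)
      have h2' := h2.shift hE j
      simp only [Proc.shift, Proc.subst_subst] at h2'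
      obtain ⟨z, hz⟩ := ((((P.subst fun n => (σ n).subst fun n => v (n + j)).fv_finite).union
        (CLab.fv_finite ((CLab.inp M).subst (sh j)))).union (hE.image (· + j))).exists_notMem
      have g2 := ih _ (hE.image _) h2' hz N
      rw [← Proc.subst_subst] at g2
      have := Step.repClose g1 g2 (.refl M)
      simpa only [CLab.result, CLab.subst, CLab.body, CLab.frame, parR_nus, parL_nus, nus_nus,
        EProc.parR, EProc.parL, CLab.ar, inst_upN_sh, Proc.shift_shift, Proc.subst,
        CLab.act] using this

theorem hasBarb_iff {P : Proc L} {M : Msg L} : HasBarb Ax P M ↔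
    ∃ j N P', CStep Ax ∅ P (.out M) j N P' ∨ CStep Ax ∅ P (.inp M) j N P' := by
  constructor
  · rintro (⟨z, A, h⟩ | ⟨N, A, h⟩)
    · obtain ⟨j, N, P', h, -⟩ := h.toCStep (l := .out M) (I := v 0) rfl
      exact ⟨j, N, P', Or.inl h⟩
    · obtain ⟨j, N, P', h, -⟩ := h.toCStep (l := .inp M) (x := 0) rfl
      exact ⟨j, N, P', Or.inr h⟩
  · obtain ⟨z, hz⟩ := (P.fv_finite.union (Msg.fv_finite M)).exists_notMem
    have hP := Proc.subst_v P
    rintro ⟨j, N, P', h | h⟩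
    · left
      rw [← hP] at h
      exact ⟨z, _, hP ▸ h.toStep _ Set.finite_empty (x := z) (by rw [hP, Set.union_empty]; exact hz) (v 0)⟩
    · right
      rw [← hP] at h
      exact ⟨v 0, _, hP ▸ h.toStep _ Set.finite_empty (x := z) (by rw [hP, Set.union_empty]; exact hz) (v 0)⟩

theorem tauStep_iff {P P' : Proc L} : TauStep Ax P P' ↔
    ∃ j N P'', CStep Ax ∅ P .tau j N P'' ∧ P' = nusP j P'' := by
  constructor
  · rintro ⟨A, h, rfl⟩
    obtain ⟨j, N, P', h', rfl⟩ := h.toCStep (l := .tau) (I := v 0) (x := 0) rfl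
    exact ⟨j, N, P', h', toProc_nus _ _⟩
  · rintro ⟨j, N, P'', h, rfl⟩
    obtain ⟨z, hz⟩ := P.fv_finite.exists_notMem
    have hP := Proc.subst_v P
    rw [← hP] at h
    have hs := h.toStep _ Set.finite_empty (x := z)
      (by simpa only [CLab.fv, Set.union_empty, hP] using hz) (v 0)
    rw [hP] at hs
    exact ⟨_, hs, by rw [CLab.result, toProc_nus]; rfl⟩

/-- Receiving a fresh variable and then replacing it by the message. -/
theorem substProc_inst_single {Q : Proc L} {x k i : ℕ} {N : Msg L}
    (hx : x + k + (i + 1) ∉ (Q.subst (upN (i + 1) (sh k))).fv) :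
    ((Q.subst (upN (i + 1) (sh k))).inst (v (x + k + i))).subst (upN i (Subst.single (x + k) N)) =
      Q.subst (recv k i N) := by
  rw [Proc.inst_eq, Proc.subst_subst, Proc.subst_subst]
  refine Proc.subst_congr fun n hn => ?_
  rw [← up_upN]
  cases n with
  | zero =>
    simp only [Subst.up, v_subst, scons_zero, upN_add, recv, Subst.single, if_true]
  | succ n =>
    simp only [Subst.up, recv, scons_succ, Msg.shift_subst, v_subst]
    rcases lt_or_ge n i with h | h
    · simp only [upN_lt _ h, v_subst]
    · obtain ⟨n, rfl⟩ := Nat.exists_eq_add_of_le' h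
      simp only [upN_add, sh_apply, shift_v, v_subst, Subst.single]
      rw [if_neg]
      · rfl
      · intro he
        have : n = x := by omega
        subst this
        refine hx (Proc.mem_fv_subst.2 ⟨_, hn, ?_⟩)
        rw [Nat.add_assoc, upN_add, sh_apply, shift_v, Msg.fv_var]
        rfl

/-- The last conjunct records that the bound name was fresh. It is what makes receiving `x` and then
replacing it by the payload the same as receiving the payload (`substProc_inst_single`). -/
theorem LStep.toCStep {P : Proc L} {π : LAct L} {A : EProc L} (h : LStep Ax P π A) (E : Set ℕ)
    {l : CLab L} {x : ℕ} (hπ : π = l.lact x) :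
    ∃ j N P', CStep Ax E P l j N P' ∧ A = l.result x (v x) j N P' ∧
      (x ∈ π.bn → x + (j + l.ar) ∉ P'.fv) := by
  have hout : ∀ {E : Set ℕ} {P P' : Proc L} {M N : Msg L} {x k : ℕ}, (∃ j N' P'',
      CStep Ax E P (.out M) j N' P'' ∧ EProc.nus k (.base (Subst.single (x + k) N) P') =
        (CLab.out M).result x (v x) j N' P'' ∧
        (x ∈ (LAct.out M x).bn → x + (j + (CLab.out M).ar) ∉ P''.fv)) →
      CStep Ax E P (.out M) k (some N) P' := by
    rintro E P P' M N x k ⟨j, N', P'', h1, h2, -⟩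
    obtain ⟨rfl, h3, rfl⟩ := nus_base_inj h2
    obtain ⟨N', rfl⟩ := h1.exists_payload rfl
    have := congrFun h3 (x + k)
    simp only [Subst.single, CLab.frame, if_true, Option.getD_some] at this
    exact this ▸ h1
  have hsh : ∀ {Q : Proc L} {k a x : ℕ} {s : Set ℕ}, Disjoint s Q.fv → x ∈ s →
      x + (k + a) ∉ (Q.shift (k + a)).fv := by
    intro Q k a x s hd hx h
    exact Set.disjoint_left.1 hd hx (Proc.add_mem_fv_shift.1 h)
  induction h generalizing l x E with
  | inp h hx =>
    cases l <;> cases hπ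
    exact ⟨0, none, _, .inp h, by simp only [CLab.result, CLab.body, Msg.shift_zero]; rfl,
      fun _ hx' => hx (Or.inr (Or.inr (by simpa [CLab.ar] using hx')))⟩
  | @out _ _ N _ _ h hx =>
    cases l <;> cases hπ
    exact ⟨0, some N, _, .out h, rfl, fun _ hx' => hx (Or.inr (by simpa [CLab.ar] using hx'))⟩
  | sumL _ ih => obtain ⟨j, N, P', h1, h2⟩ := ih E hπ; exact ⟨j, N, P', .sumL h1, h2⟩
  | sumR _ ih => obtain ⟨j, N, P', h1, h2⟩ := ih E hπ; exact ⟨j, N, P', .sumR h1, h2⟩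
  | mat _ h ih => obtain ⟨j, N, P', h1, h2⟩ := ih E hπ; exact ⟨j, N, P', .mat h1 h, h2⟩
  | res _ ih =>
    obtain ⟨j, N, P', h1, rfl, h3⟩ := ih (extendEnv E) (by rw [hπ, CLab.lact_shift])
    refine ⟨j + 1, N, P', .res h1, ?_, fun hx hx' => h3 ?_ ?_⟩
    · exact CLab.result_nu l x (v x) j N P'
    · subst hπ
      cases l <;> simp [CLab.lact, LAct.bn, LAct.shift] at hx ⊢
    · rw [CLab.ar_subst]
      rwa [show x + 1 + (j + l.ar) = x + (j + 1 + l.ar) by omega]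
  | parL _ hd ih =>
    obtain ⟨j, N, P', h1, rfl, h3⟩ := ih E hπ
    refine ⟨j, N, _, .parL h1, CLab.result_parR _ _ _ _ _ _ _, fun hx => ?_⟩
    rintro (h | h)
    · exact h3 hx h
    · exact hsh hd hx h
  | parR _ hd ih =>
    obtain ⟨j, N, P', h1, rfl, h3⟩ := ih E hπ
    refine ⟨j, N, _, .parR h1, CLab.result_parL _ _ _ _ _ _ _, fun hx => ?_⟩
    rintro (h | h)
    · exact hsh hd hx h
    · exact h3 hx h
  | repAct _ hd ih =>
    obtain ⟨j, N, P', h1, rfl, h3⟩ := ih E hπ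
    refine ⟨j, N, _, .repAct h1, CLab.result_parR _ _ _ _ _ _ _, fun hx => ?_⟩
    rintro (h | h)
    · exact h3 hx h
    · exact hsh (Q := .rep _) hd hx h
  | @closeL _ _ _ _ M M' N y k _ _ hM ih1 ih2 =>
    cases l <;> cases hπ
    have h1 := hout (ih1 E (l := .out M) rfl)
    obtain ⟨i, N', Q', h2, rfl, hx⟩ :=
      ih2 ((· + k) '' E) (l := (CLab.inp M').subst (sh k)) (x := y + k) rfl
    obtain ⟨N₀, Q₀, h3, rfl⟩ := h2.unshift
    have hx' := substProc_inst_single (N := N) (hx rfl)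
    refine ⟨k + i, none, _, .closeL h1 (h3.relabel (.inp hM.symm)), ?_, by simp [LAct.bn]⟩
    simp only [CLab.result, CLab.subst, CLab.body, CLab.frame, parL_nus, nus_nus, EProc.parL,
      substProc_nus, EProc.substProc, CLab.ar, shift_v, hx']
  | @closeR _ _ _ _ M M' N y k _ _ hM ih1 ih2 =>
    cases l <;> cases hπ
    have h1 := hout (ih1 E (l := .out M) rfl)
    obtain ⟨i, N', Q', h2, rfl, hx⟩ :=
      ih2 ((· + k) '' E) (l := (CLab.inp M').subst (sh k)) (x := y + k) rfl
    obtain ⟨N₀, Q₀, h3, rfl⟩ := h2.unshift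
    have hx' := substProc_inst_single (N := N) (hx rfl)
    refine ⟨k + i, none, _, .closeR h1 (h3.relabel (.inp hM.symm)), ?_, by simp [LAct.bn]⟩
    simp only [CLab.result, CLab.subst, CLab.body, CLab.frame, parR_nus, nus_nus, EProc.parR,
      substProc_nus, EProc.substProc, CLab.ar, shift_v, hx']
  | @repClose _ _ _ M M' N y k _ _ hM ih1 ih2 =>
    cases l <;> cases hπ
    have h1 := hout (ih1 E (l := .out M) rfl)
    obtain ⟨i, N', Q', h2, rfl, hx⟩ :=
      ih2 ((· + k) '' E) (l := (CLab.inp M').subst (sh k)) (x := y + k) rfl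
    obtain ⟨N₀, Q₀, h3, rfl⟩ := h2.unshift
    have hx' := substProc_inst_single (N := N) (hx rfl)
    refine ⟨k + i, none, _, .repClose h1 (h3.relabel (.inp hM.symm)), ?_, by simp [LAct.bn]⟩
    simp only [CLab.result, CLab.subst, CLab.body, CLab.frame, parR_nus, parL_nus, nus_nus,
      EProc.parR, EProc.parL, substProc_nus, EProc.substProc, CLab.ar, shift_v, hx', Proc.shift_shift]

/-- As in `CStep.toStep`, generality in `σ` covers the shifted receiver. The environment can stay
empty, even below restrictions, because `P` has no mismatch. -/
theorem CStep.toLStep {P : Proc L} (hP : P.MismatchFree) (σ : Subst L) {P' : Proc L}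
    {l : CLab L} {j : ℕ} {N : Option (Msg L)} (h : CStep Ax ∅ (P.subst σ) l j N P') {x : ℕ}
    (hx : x ∉ (P.subst σ).fv ∪ l.fv) :
    LStep Ax (P.subst σ) (l.lact x) (l.result x (v x) j N P') := by
  have hinp : ∀ {Q Q' : Proc L} {k i y : ℕ} {M N : Msg L} {N' : Option (Msg L)} {σ : Subst L},
      y ∉ (Q.subst σ).fv → y ∉ Msg.fv M → CStep Ax ∅ (Q.subst σ) (.inp M) i N' Q' →
      (∀ (σ : Subst L) {P' : Proc L} {l : CLab L} {j : ℕ} {N : Option (Msg L)},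
        CStep Ax ∅ (Q.subst σ) l j N P' → ∀ {x : ℕ}, x ∉ (Q.subst σ).fv ∪ l.fv →
        LStep Ax (Q.subst σ) (l.lact x) (l.result x (v x) j N P')) →
      ∃ A, LStep Ax ((Q.subst σ).shift k) (.inp (Msg.shift k M) (y + k)) A ∧
        A.substProc (Subst.single (y + k) N) =
          EProc.nus i (.base Subst.id (Q'.subst (recv k i N))) := by
    intro Q Q' k i y M N N' σ hy hM h ih
    have h2 := h.shift Set.finite_empty k
    have hy' : y + k ∉ ((Q.subst σ).shift k).fv := fun h => hy (Proc.add_mem_fv_shift.1 h)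
    have hM' : y + k ∉ Msg.fv (Msg.shift k M) := fun h => hM (Msg.add_mem_fv_shift.1 h)
    have hx : y + k + (i + 1) ∉ (Q'.subst (upN (i + 1) (sh k))).fv :=
      fun h => hy' ((h2.mem_fv (y + k)).1 h)
    rw [Set.image_empty] at h2
    simp only [Proc.shift, Proc.subst_subst] at h2 hy'
    have := ih _ h2 (x := y + k) (by rintro (h | h); exacts [hy' h, hM' h])
    rw [← Proc.subst_subst] at this
    refine ⟨_, this, ?_⟩
    have hx' := substProc_inst_single (N := N) hx
    simp only [CLab.result, CLab.subst, CLab.body, CLab.frame, substProc_nus, EProc.substProc,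
      CLab.ar, shift_v, hx']
  induction P generalizing σ P' l j N x with
  | zero => cases h
  | out M N P ih =>
    cases h with
    | out h =>
      refine LStep.out h ?_
      simp only [Proc.subst, Proc.fv, CLab.fv, Set.mem_union] at hx ⊢
      tauto
  | inp M P ih =>
    cases h with
    | inp h =>
      simp only [CLab.result, CLab.body, Msg.shift_zero]
      refine LStep.inp h ?_
      simp only [Proc.subst, CLab.fv, Set.mem_union] at hx ⊢
      tauto
  | mat M N P ih =>
    simp only [Proc.subst, Proc.fv, Set.mem_union, not_or] at hx
    cases h with
    | mat h hM => exact .mat (ih hP σ h (by simp only [Set.mem_union]; tauto)) hM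
  | mismat M N P ih => exact hP.elim
  | nu P ih =>
    cases h with
    | res h =>
      rw [extendEnv_eq, show extendEnvN 1 ∅ = ({0} : Set ℕ) by ext n; simp [extendEnvN]] at h
      have h := h.change_env ((Proc.mismatchFree_subst _).2 hP) ∅
      have := ih hP σ.up h (x := x + 1) ?_
      · rw [← CLab.lact_shift] at this
        rw [← CLab.result_nu]
        exact .res this
      · simpa only [Proc.subst, Proc.fv, Set.mem_union, Set.mem_ofPred_eq,
          CLab.succ_mem_fv_shift] using hx
  | sum P Q ih1 ih2 =>
    simp only [Proc.subst, Proc.fv, Set.mem_union, not_or] at hx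
    cases h with
    | sumL h => exact .sumL (ih1 hP.1 σ h (by simp only [Set.mem_union]; tauto))
    | sumR h => exact .sumR (ih2 hP.2 σ h (by simp only [Set.mem_union]; tauto))
  | par P Q ih1 ih2 =>
    simp only [Proc.subst, Proc.fv, Set.mem_union, not_or] at hx
    cases h with
    | parL h =>
      rw [← CLab.result_parR]
      exact .parL (ih1 hP.1 σ h (by simp only [Set.mem_union]; tauto))
        (CLab.disjoint_bn_lact hx.1.2)
    | parR h =>
      rw [← CLab.result_parL]
      exact .parR (ih2 hP.2 σ h (by simp only [Set.mem_union]; tauto))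
        (CLab.disjoint_bn_lact hx.1.1)
    | @closeL _ _ _ _ _ M N j i N' h1 h2 =>
      obtain ⟨y, hy⟩ := ((((P.subst σ).fv_finite).union (Q.subst σ).fv_finite).union
        (Msg.fv_finite M)).exists_notMem
      simp only [Set.mem_union, not_or] at hy
      have g1 := ih1 hP.1 σ h1 (x := y) (by simp only [Set.mem_union, CLab.fv]; tauto)
      obtain ⟨A, g2, hA⟩ := hinp (k := j) (N := N) hy.1.2 hy.2 h2 (ih2 hP.2)
      have := LStep.closeL g1 g2 (.refl M)
      simpa only [hA, Option.getD_some, CLab.result, CLab.body, CLab.frame, parL_nus, nus_nus, EProc.parL,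
        Proc.subst, CLab.lact] using this
    | @closeR _ _ _ _ _ M N j i N' h1 h2 =>
      obtain ⟨y, hy⟩ := ((((P.subst σ).fv_finite).union (Q.subst σ).fv_finite).union
        (Msg.fv_finite M)).exists_notMem
      simp only [Set.mem_union, not_or] at hy
      have g1 := ih2 hP.2 σ h1 (x := y) (by simp only [Set.mem_union, CLab.fv]; tauto)
      obtain ⟨A, g2, hA⟩ := hinp (k := j) (N := N) hy.1.1 hy.2 h2 (ih1 hP.1)
      have := LStep.closeR g1 g2 (.refl M)
      simpa only [hA, Option.getD_some, CLab.result, CLab.body, CLab.frame, parR_nus, nus_nus, EProc.parR,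
        Proc.subst, CLab.lact] using this
  | rep P ih =>
    simp only [Proc.subst, Proc.fv, Set.mem_union, not_or] at hx
    cases h with
    | repAct h =>
      have := LStep.repAct (ih hP σ h (by simp only [Set.mem_union]; tauto))
        (CLab.disjoint_bn_lact hx.1)
      rwa [CLab.result_parR] at this
    | @repClose _ _ _ _ M N j i N' h1 h2 =>
      obtain ⟨y, hy⟩ := (((P.subst σ).fv_finite).union (Msg.fv_finite M)).exists_notMem
      have hy' := hy
      simp only [Set.mem_union, not_or] at hy
      have g1 := ih hP σ h1 (x := y) (by simpa only [CLab.fv] using hy')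
      obtain ⟨A, g2, hA⟩ := hinp (k := j) (N := N) hy.1 hy.2 h2 (ih hP)
      have := LStep.repClose g1 g2 (.refl M)
      simpa only [hA, Option.getD_some, CLab.result, CLab.body, CLab.frame, parR_nus, parL_nus, nus_nus,
        EProc.parR, EProc.parL, Proc.subst, CLab.lact, Proc.shift_shift] using this

end Correspondence

/-! ### Parallel components and the contextual closure of a relation -/

section Closure

variable {L : FirstOrder.Language.{u, w}}

/-- `P | T` or `T | P`. -/
def pair (b : Bool) (P T : Proc L) : Proc L := if b then .par P T else .par T P

/-- The parallel components `Ts`, instantiated by `s`, around `P`. -/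
def wrap (s : Subst L) : List (Bool × Proc L) → Proc L → Proc L
  | [], P => P
  | (b, T) :: Ts, P => pair b (wrap s Ts P) (T.subst s)

/-- Substitution in parallel components. -/
def substAll (Ts : List (Bool × Proc L)) (s : Subst L) : List (Bool × Proc L) :=
  Ts.map fun p => (p.1, p.2.subst s)

theorem pair_subst (b : Bool) (P T : Proc L) (s : Subst L) :
    (pair b P T).subst s = pair b (P.subst s) (T.subst s) := by cases b <;> rfl

theorem CLab.body_pair (l : CLab L) (b : Bool) (P Q : Proc L) (M : Msg L) :
    l.body (pair b P Q) M = pair b (l.body P M) (l.body Q M) := by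
  cases b <;> exact CLab.body_par _ _ _ _

theorem wrap_append (s : Subst L) (Us Ts : List (Bool × Proc L)) (P : Proc L) :
    wrap s (Us ++ Ts) P = wrap s Us (wrap s Ts P) := by
  induction Us with
  | nil => rfl
  | cons U Us ih => simp only [List.cons_append, wrap, ih]

theorem wrap_subst (s τ : Subst L) (Us : List (Bool × Proc L)) (P : Proc L) :
    (wrap s Us P).subst τ = wrap (fun n => (s n).subst τ) Us (P.subst τ) := by
  induction Us with
  | nil => rfl
  | cons U Us ih => simp only [wrap, pair_subst, ih, Proc.subst_subst]

theorem wrap_substAll (s τ : Subst L) (Us : List (Bool × Proc L)) (P : Proc L) :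
    wrap τ (substAll Us s) P = wrap (fun n => (s n).subst τ) Us P := by
  induction Us with
  | nil => rfl
  | cons U Us ih =>
    simp only [substAll, List.map_cons, wrap, Proc.subst_subst] at ih ⊢
    rw [ih]

theorem nusP_subst (k : ℕ) (P : Proc L) (σ : Subst L) :
    (nusP k P).subst σ = nusP k (P.subst (upN k σ)) := by
  induction k generalizing σ with
  | zero => rw [upN_zero]; rfl
  | succ k ih => simp only [nusP, Proc.subst, ih, upN_up]

theorem nusP_nusP (k j : ℕ) (P : Proc L) : nusP k (nusP j P) = nusP (k + j) P := by
  induction k with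
  | zero => simp [nusP]
  | succ k ih => rw [Nat.succ_add]; simp only [nusP, ih]

theorem inst_subst (P : Proc L) (M : Msg L) (σ : Subst L) :
    (P.inst M).subst σ = (P.subst σ.up).inst (M.subst σ) := by
  simp only [Proc.inst_eq, Proc.subst_subst]
  congr 1
  funext n
  cases n with
  | zero => rfl
  | succ n => simp only [scons_succ, v_subst, Subst.up, Msg.shift_subst, Msg.subst_v]

theorem CLab.body_subst (l : CLab L) (P : Proc L) (M : Msg L) (σ : Subst L) :
    (l.body P M).subst σ = l.body (P.subst (upN l.ar σ)) (M.subst σ) := by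
  cases l with
  | tau => simp only [CLab.body, CLab.ar, upN_zero]
  | out => simp only [CLab.body, CLab.ar, upN_zero]
  | inp => simp only [CLab.body, CLab.ar, inst_subst, up_eq_upN]

theorem CLab.body_subst_label (l : CLab L) (σ : Subst L) (P : Proc L) (M : Msg L) :
    (l.subst σ).body P M = l.body P M := by cases l <;> rfl

/-- The process obtained from a commitment by applying it to `M` and placing it next to `Us`. In
`Us`, index `0` stands for the payload of an output, and for `M` otherwise. -/
def plug (l : CLab L) (M : Msg L) (j : ℕ) (N : Option (Msg L)) (P : Proc L)
    (Us : List (Bool × Proc L)) : Proc L :=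
  nusP j (wrap (scons (N.getD (Msg.shift j M)) (sh j)) Us (l.body P (Msg.shift j M)))

/-- An idle neighbour of the acting process may be counted among the surrounding components. It is
shifted by one since index `0` is reserved there. -/
theorem plug_pair (l : CLab L) (M : Msg L) (j : ℕ) (N : Option (Msg L)) (P T : Proc L) (b : Bool)
    (Us : List (Bool × Proc L)) :
    plug l M j N (pair b P (T.shift (j + l.ar))) Us =
      plug l M j N P (Us ++ [(b, T.shift 1)]) := by
  simp only [plug, wrap_append, CLab.body_pair, CLab.body_shift, wrap, Proc.shift_subst,
    scons_succ]
  rfl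

theorem plug_nu (l : CLab L) (M : Msg L) (j : ℕ) (N : Option (Msg L)) (P : Proc L)
    (Us : List (Bool × Proc L)) :
    plug l M (j + 1) N P Us =
      .nu (plug (l.subst (sh 1)) (Msg.shift 1 M) j N P (substAll Us (Subst.up (sh 1)))) := by
  simp only [plug, nusP, wrap_substAll, CLab.body_subst_label, Msg.shift_shift, Nat.add_comm 1 j]
  congr 3
  funext n
  cases n with
  | zero => rfl
  | succ n =>
    simp only [scons_succ, Subst.up, sh_apply, shift_v, v_subst]
    congr 1
    omega

/-- Single-hole contextual closure of a relation, with permutations of `ν`-binders. -/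
inductive Cong (D : Proc L → Proc L → Prop) : Proc L → Proc L → Prop
  | base {P Q : Proc L} : D P Q → Cong D P Q
  | perm {k : ℕ} {P : Proc L} (r r' : ℕ → ℕ) : (∀ n, r' (r n) = n) → (∀ n, r (r' n) = n) →
      (∀ n, k ≤ n → r n = n) → Cong D (nusP k P) (nusP k (P.subst fun n => v (r n)))
  | out {M N : Msg L} {P Q : Proc L} : Cong D P Q → Cong D (.out M N P) (.out M N Q)
  | inp {M : Msg L} {P Q : Proc L} : Cong D P Q → Cong D (.inp M P) (.inp M Q)
  | mat {M N : Msg L} {P Q : Proc L} : Cong D P Q → Cong D (.mat M N P) (.mat M N Q)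
  | mismat {M N : Msg L} {P Q : Proc L} : Cong D P Q → Cong D (.mismat M N P) (.mismat M N Q)
  | nu {P Q : Proc L} : Cong D P Q → Cong D (.nu P) (.nu Q)
  | pair {P Q T : Proc L} (b : Bool) : Cong D P Q → Cong D (pair b P T) (pair b Q T)
  | sumL {P Q T : Proc L} : Cong D P Q → Cong D (.sum P T) (.sum Q T)
  | sumR {P Q T : Proc L} : Cong D P Q → Cong D (.sum T P) (.sum T Q)
  | rep {P Q : Proc L} : Cong D P Q → Cong D (.rep P) (.rep Q)

/-- Reflexive and transitive closure of the contextual closure. -/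
abbrev CongStar (D : Proc L → Proc L → Prop) : Proc L → Proc L → Prop :=
  Relation.ReflTransGen (Cong D)

variable {D : Proc L → Proc L → Prop}

theorem CongStar.nu {P Q : Proc L} (h : CongStar D P Q) : CongStar D (.nu P) (.nu Q) :=
  Relation.ReflTransGen.lift Proc.nu (fun _ _ h => Cong.nu h) _ _ h

theorem CongStar.nusP {P Q : Proc L} (h : CongStar D P Q) (k : ℕ) :
    CongStar D (nusP k P) (nusP k Q) := by
  induction k with
  | zero => exact h
  | succ k ih => exact ih.nu

theorem CongStar.pair {P Q : Proc L} (h : CongStar D P Q) (b : Bool) (T : Proc L) :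
    CongStar D (pair b P T) (pair b Q T) :=
  Relation.ReflTransGen.lift (fun P => AppliedPi.pair b P T) (fun _ _ h => Cong.pair b h) _ _ h

theorem CongStar.wrap {P Q : Proc L} (h : CongStar D P Q) (s : Subst L)
    (Us : List (Bool × Proc L)) : CongStar D (wrap s Us P) (wrap s Us Q) := by
  induction Us with
  | nil => exact h
  | cons U Us ih => exact ih.pair _ _

theorem Cong.symm (hD : ∀ {P Q : Proc L}, D P Q → D Q P) {P Q : Proc L} (h : Cong D P Q) :
    Cong D Q P := by
  induction h with
  | base h => exact .base (hD h)
  | @perm k P r r' h1 h2 h3 =>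
    have := Cong.perm (D := D) (k := k) (P := P.subst fun n => v (r n)) r' r h2 h1
      (fun n hn => by conv_lhs => rw [← h3 n hn, h1])
    simpa only [Proc.subst_subst, v_subst, h1, Proc.subst_v] using this
  | out _ ih => exact .out ih
  | inp _ ih => exact .inp ih
  | mat _ ih => exact .mat ih
  | mismat _ ih => exact .mismat ih
  | nu _ ih => exact .nu ih
  | pair b _ ih => exact .pair b ih
  | sumL _ ih => exact .sumL ih
  | sumR _ ih => exact .sumR ih
  | rep _ ih => exact .rep ih

/-- A permutation of `k` binders and a substitution for the outer variables act on disjoint sets of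
variables. -/
theorem ren_upN_comm {k : ℕ} {r : ℕ → ℕ} (hr : ∀ n, n < k → r n < k) (h : ∀ n, k ≤ n → r n = n)
    (s : Subst L) (n : ℕ) :
    upN k s (r n) = (upN k s n).subst (fun n => v (r n)) := by
  rcases lt_or_ge n k with hn | hn
  · rw [upN_lt _ hn, upN_lt _ (hr n hn), v_subst]
  · rw [h n hn, upN_ge _ hn, Msg.shift_subst]
    refine Msg.subst_congr fun m _ => ?_
    rw [h _ (by omega)]

theorem perm_lt {k : ℕ} {r r' : ℕ → ℕ} (h1 : ∀ n, r' (r n) = n) (h3 : ∀ n, k ≤ n → r n = n)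
    (n : ℕ) (hn : n < k) : r n < k := by
  by_contra hlt
  have h4 := h3 (r n) (by omega)
  have h5 := congrArg r' h4
  rw [h1, h1] at h5
  omega

theorem Cong.subst (hD : ∀ {P Q : Proc L}, D P Q → ∀ s, D (P.subst s) (Q.subst s))
    {P Q : Proc L} (h : Cong D P Q) (s : Subst L) : Cong D (P.subst s) (Q.subst s) := by
  induction h generalizing s with
  | base h => exact .base (hD h s)
  | @perm k P r r' h1 h2 h3 =>
    have := Cong.perm (D := D) (k := k) (P := P.subst (upN k s)) r r' h1 h2 h3
    simp only [nusP_subst, Proc.subst_subst, v_subst, ren_upN_comm (perm_lt h1 h3) h3] at this ⊢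
    exact this
  | out _ ih => exact .out (ih s)
  | inp _ ih => exact .inp (ih s.up)
  | mat _ ih => exact .mat (ih s)
  | mismat _ ih => exact .mismat (ih s)
  | nu _ ih => exact .nu (ih s.up)
  | pair b _ ih => rw [pair_subst, pair_subst]; exact .pair b (ih s)
  | sumL _ ih => exact .sumL (ih s)
  | sumR _ ih => exact .sumR (ih s)
  | rep _ ih => exact .rep (ih s)

/-- The renaming that exchanges a block of `i` binders and a surrounding block of `j` binders. -/
def swp (i j n : ℕ) : ℕ := if n < i then n + j else if n < i + j then n - i else n

theorem swp_swp (i j n : ℕ) : swp j i (swp i j n) = n := by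
  unfold swp; split_ifs <;> omega

theorem Cong.swap (i j : ℕ) (P : Proc L) :
    Cong D (nusP (j + i) P) (nusP (i + j) (P.subst fun n => v (swp i j n))) := by
  rw [Nat.add_comm i j]
  refine Cong.perm (swp i j) (swp j i) (swp_swp i j) (swp_swp j i) fun n hn => ?_
  unfold swp; split_ifs <;> omega

/-! ### Matching of commitments up to the contextual closure. -/

/-- Two commitments are related if they are related in all static contexts. -/
def Matches (D : Proc L → Proc L → Prop) (l : CLab L) (j : ℕ) (N : Option (Msg L)) (P : Proc L)
    (i : ℕ) (N' : Option (Msg L)) (Q : Proc L) : Prop :=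
  ∀ (M : Msg L) (Us : List (Bool × Proc L)), CongStar D (plug l M j N P Us) (plug l M i N' Q Us)

/-- Every commitment of `P` is matched by one of `Q`. -/
def Sim (Ax : Msg L → Msg L → Prop) (D : Proc L → Proc L → Prop) (P Q : Proc L) : Prop :=
  ∀ (E : Set ℕ), E.Finite → ∀ (l : CLab L) (j : ℕ) (N : Option (Msg L)) (P' : Proc L),
    CStep Ax E P l j N P' → ∃ i N' Q', CStep Ax E Q l i N' Q' ∧ Matches D l j N P' i N' Q'

theorem Matches.refl (l : CLab L) (j : ℕ) (N : Option (Msg L)) (P : Proc L) :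
    Matches D l j N P j N P := fun _ _ => .refl

theorem Matches.of_body {l : CLab L} {j : ℕ} {N : Option (Msg L)} {P Q : Proc L}
    (h : ∀ M, CongStar D (l.body P M) (l.body Q M)) : Matches D l j N P j N Q :=
  fun _ _ => ((h _).wrap _ _).nusP _

/-- Because matching quantifies over all surrounding components, a new one is simply absorbed. -/
theorem Matches.pair {l : CLab L} {j i : ℕ} {N N' : Option (Msg L)} {P Q : Proc L}
    (h : Matches D l j N P i N' Q) (b : Bool) (T : Proc L) :
    Matches D l j N (AppliedPi.pair b P (T.shift (j + l.ar)))
      i N' (AppliedPi.pair b Q (T.shift (i + l.ar))) := by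
  intro M Us
  simp only [plug_pair]
  exact h M _

theorem Matches.nu {l : CLab L} {j i : ℕ} {N N' : Option (Msg L)} {P Q : Proc L}
    (h : Matches D (l.subst (sh 1)) j N P i N' Q) : Matches D l (j + 1) N P (i + 1) N' Q := by
  intro M Us
  simp only [plug_nu]
  exact (h _ _).nu

theorem plug_tau (M : Msg L) (j : ℕ) (P : Proc L) (Us : List (Bool × Proc L)) :
    plug .tau M j none P Us = nusP j (wrap (sh j) (substAll Us (scons M fun n => v n)) P) := by
  simp only [plug, wrap_substAll, CLab.body, Option.getD_none]
  congr 2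
  funext n
  cases n <;> rfl

theorem Matches.tau {j i : ℕ} {P Q : Proc L}
    (h : ∀ Us, CongStar D (nusP j (wrap (sh j) Us P)) (nusP i (wrap (sh i) Us Q))) :
    Matches D .tau j none P i none Q := by
  intro M Us
  simp only [plug_tau]
  exact h _

/-! ### Commitments of restrictions, pairs and contexts. -/

variable {Ax : Msg L → Msg L → Prop}

theorem CStep.nusP_inv {E : Set ℕ} {k : ℕ} {P P' : Proc L} {l : CLab L} {j : ℕ}
    {N : Option (Msg L)} (h : CStep Ax E (nusP k P) l j N P') :
    ∃ j', j = j' + k ∧ CStep Ax (extendEnvN k E) P (l.subst (sh k)) j' N P' := by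
  induction k generalizing E l j with
  | zero =>
    refine ⟨j, rfl, ?_⟩
    rw [extendEnvN_zero]
    exact (CLab.subst_v l).symm ▸ h
  | succ k ih =>
    cases h with
    | res h =>
      obtain ⟨j', rfl, h'⟩ := ih h
      refine ⟨j', rfl, ?_⟩
      rw [extendEnvN_extendEnv, CLab.subst_subst] at h'
      simp only [sh_apply, v_subst, Nat.add_assoc, Nat.add_comm 1 k] at h'
      exact h'

theorem CStep.nusP {E : Set ℕ} {k : ℕ} {P P' : Proc L} {l : CLab L} {j : ℕ}
    {N : Option (Msg L)} (h : CStep Ax (extendEnvN k E) P (l.subst (sh k)) j N P') :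
    CStep Ax E (nusP k P) l (j + k) N P' := by
  induction k generalizing E l with
  | zero =>
    rw [extendEnvN_zero] at h
    exact (CLab.subst_v l) ▸ h
  | succ k ih =>
    refine CStep.res (ih ?_)
    rw [extendEnvN_extendEnv, CLab.subst_subst]
    simp only [sh_apply, v_subst, Nat.add_assoc, Nat.add_comm 1 k]
    exact h

theorem CStep.pair_cases {E : Set ℕ} {b : Bool} {P T R : Proc L} {l : CLab L} {j : ℕ}
    {N : Option (Msg L)} (h : CStep Ax E (pair b P T) l j N R) :
    (∃ P', R = pair b P' (T.shift (j + l.ar)) ∧ CStep Ax E P l j N P') ∨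
    (∃ T', R = pair b (P.shift (j + l.ar)) T' ∧ CStep Ax E T l j N T') ∨
    (∃ j' i c N₁ N₂ P' T', l = .tau ∧ N = none ∧ j = j' + i ∧
      R = pair b (P'.shift i) (T'.subst (recv j' i N₁)) ∧
      CStep Ax E P (.out c) j' (some N₁) P' ∧ CStep Ax E T (.inp c) i N₂ T') ∨
    (∃ j' i c N₁ N₂ P' T', l = .tau ∧ N = none ∧ j = j' + i ∧
      R = pair b (P'.subst (recv j' i N₁)) (T'.shift i) ∧
      CStep Ax E T (.out c) j' (some N₁) T' ∧ CStep Ax E P (.inp c) i N₂ P') := by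
  cases b
  · cases h with
    | parL h => exact Or.inr (Or.inl ⟨_, rfl, h⟩)
    | parR h => exact Or.inl ⟨_, rfl, h⟩
    | closeL h1 h2 => exact Or.inr (Or.inr (Or.inr ⟨_, _, _, _, _, _, _, rfl, rfl, rfl, rfl, h1, h2⟩))
    | closeR h1 h2 => exact Or.inr (Or.inr (Or.inl ⟨_, _, _, _, _, _, _, rfl, rfl, rfl, rfl, h1, h2⟩))
  · cases h with
    | parL h => exact Or.inl ⟨_, rfl, h⟩
    | parR h => exact Or.inr (Or.inl ⟨_, rfl, h⟩)
    | closeL h1 h2 => exact Or.inr (Or.inr (Or.inl ⟨_, _, _, _, _, _, _, rfl, rfl, rfl, rfl, h1, h2⟩))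
    | closeR h1 h2 => exact Or.inr (Or.inr (Or.inr ⟨_, _, _, _, _, _, _, rfl, rfl, rfl, rfl, h1, h2⟩))

theorem CStep.pair_left {E : Set ℕ} (b : Bool) {P P' : Proc L} (T : Proc L) {l : CLab L} {j : ℕ}
    {N : Option (Msg L)} (h : CStep Ax E P l j N P') :
    CStep Ax E (pair b P T) l j N (pair b P' (T.shift (j + l.ar))) := by
  cases b
  · exact .parR h
  · exact .parL h

theorem CStep.pair_right {E : Set ℕ} (b : Bool) (P : Proc L) {T T' : Proc L} {l : CLab L} {j : ℕ}
    {N : Option (Msg L)} (h : CStep Ax E T l j N T') :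
    CStep Ax E (pair b P T) l j N (pair b (P.shift (j + l.ar)) T') := by
  cases b
  · exact .parL h
  · exact .parR h

theorem CStep.pair_out_inp {E : Set ℕ} (b : Bool) {P P' T T' : Proc L} {c N : Msg L} {j i : ℕ}
    {N' : Option (Msg L)} (h1 : CStep Ax E P (.out c) j (some N) P')
    (h2 : CStep Ax E T (.inp c) i N' T') :
    CStep Ax E (pair b P T) .tau (j + i) none (pair b (P'.shift i) (T'.subst (recv j i N))) := by
  cases b
  · exact .closeR h1 h2
  · exact .closeL h1 h2

theorem CStep.pair_inp_out {E : Set ℕ} (b : Bool) {P P' T T' : Proc L} {c N : Msg L} {j i : ℕ}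
    {N' : Option (Msg L)} (h1 : CStep Ax E T (.out c) j (some N) T')
    (h2 : CStep Ax E P (.inp c) i N' P') :
    CStep Ax E (pair b P T) .tau (j + i) none (pair b (P'.subst (recv j i N)) (T'.shift i)) := by
  cases b
  · exact .closeL h1 h2
  · exact .closeR h1 h2

theorem CStep.exists_some {E : Set ℕ} {P P' : Proc L} {c : Msg L} {j : ℕ} {N : Option (Msg L)}
    (h : CStep Ax E P (.out c) j N P') : ∃ N', N = some N' := h.exists_payload rfl

theorem CStep.eq_none {E : Set ℕ} {P P' : Proc L} {j : ℕ} {N : Option (Msg L)} {l : CLab L}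
    (h : CStep Ax E P l j N P') (hl : ∀ M, l ≠ .out M) : N = none := by
  induction h with
  | inp | closeL | closeR | repClose => rfl
  | out => exact (hl _ rfl).elim
  | @res _ _ _ l _ _ _ ih =>
    refine ih fun M hM => ?_
    cases l <;> cases hM
    exact hl _ rfl
  | sumL _ ih | sumR _ ih | mat _ _ ih | mismat _ _ ih | parL _ ih | parR _ ih | repAct _ ih => exact ih hl

/-- After a communication the binders of the receiver lie inside those of the sender. To regard the
receiver's residual `T` as a component next to an output of the hole, its `i` binders have to come
out; this is why the contextual closure includes permutations of binders. -/
theorem nusP_swap_out (D : Proc L → Proc L → Prop) (c M₀ : Msg L) (j i : ℕ) (N : Msg L)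
    (P T : Proc L) (b : Bool) (Us : List (Bool × Proc L)) :
    Cong D (nusP (j + i) (wrap (sh (j + i)) Us (pair b (P.shift i) (T.subst (recv j i N)))))
      (nusP i (plug (.out c) M₀ j (some (N.subst (upN j (sh i)))) (P.subst (upN j (sh i)))
        (substAll Us (sh (i + 1)) ++ [(b, T)]))) := by
  have h1 : ∀ n, swp i j (n + (j + i)) = n + i + j := by intro n; unfold swp; split_ifs <;> omega
  have h2 : ∀ n, (v (swp i j (n + i)) : Msg L) = upN j (sh i) n := by
    intro n
    unfold swp upN
    rcases lt_or_ge n j with h | h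
    · rw [if_neg (by omega), if_pos (by omega), if_pos h, Nat.add_sub_cancel]
    · rw [if_neg (by omega), if_neg (by omega), if_neg (by omega), sh_apply, shift_v]
      congr 1; omega
  have h3 : ∀ n, (recv j i N n).subst (fun n => v (swp i j n)) =
      scons (N.subst (upN j (sh i))) (sh j) n := by
    intro n
    cases n with
    | zero =>
      simp only [recv, scons_zero, Msg.shift_subst, h2]
    | succ n =>
      simp only [recv, scons_succ, sh_apply]
      rcases lt_or_ge n i with h | h
      · rw [upN_lt _ h, v_subst, swp, if_pos h]
      · rw [upN_ge _ h, sh_apply, shift_v, v_subst, show n - i + j + i = n - i + (j + i) by omega, h1]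
        congr 1; omega
  have := Cong.swap (D := D) i j (wrap (sh (j + i)) Us (pair b (P.shift i) (T.subst (recv j i N))))
  rw [← nusP_nusP i j] at this
  simp only [wrap_subst, pair_subst, Proc.shift_subst, Proc.subst_subst, h2, h3, sh_apply,
    v_subst, h1] at this
  simpa only [plug, wrap_append, wrap_substAll, CLab.body, wrap, sh_apply, v_subst, scons_succ,
    Option.getD_some, ← Nat.add_assoc] using this

/-- When the hole is the receiver, the binders of the sender are already outermost, and an equality
suffices. -/
theorem plug_inp (c : Msg L) (j i : ℕ) (N : Msg L) (N' : Option (Msg L)) (P T : Proc L) (b : Bool)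
    (Us : List (Bool × Proc L)) :
    nusP (j + i) (wrap (sh (j + i)) Us (pair b (P.subst (recv j i N)) (T.shift i))) =
      nusP j (plug (.inp c) N i N' (P.subst (upN (i + 1) (sh j)))
        (substAll Us (sh (j + 1)) ++ [(b, T.shift 1)])) := by
  simp only [plug, wrap_append, wrap_substAll, CLab.body, wrap, Proc.shift_subst, inst_upN_sh,
    sh_apply, v_subst, scons_succ, ← nusP_nusP, ← Nat.add_assoc]
  simp only [Proc.shift, Nat.add_assoc]
  rfl

/-- The commitments of all renamings of `P` into inner scopes are matched. -/
def ShiftSim (Ax : Msg L → Msg L → Prop) (D : Proc L → Proc L → Prop) (P Q : Proc L) : Prop :=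
  ∀ k, Sim Ax D (P.shift k) (Q.shift k)

/-- The output of the hole is matched below the `i` binders of its partner, that is, for the copies
shifted by `i`, with the partner's residual as a component reading the payload at index `0`.
Exchanging binders before and after brings the two communications into that form. -/
theorem ShiftSim.comm_out (hsymm : ∀ {P Q : Proc L}, D P Q → D Q P) {P Q : Proc L}
    (h : ShiftSim Ax D P Q) {E : Set ℕ} (hE : E.Finite)
    {c N : Msg L} {j : ℕ} {P' : Proc L} (hs : CStep Ax E P (.out c) j (some N) P') (i : ℕ) :
    ∃ j' N' Q', CStep Ax E Q (.out c) j' (some N') Q' ∧ ∀ (b : Bool) (T : Proc L) (Us : List (Bool × Proc L)),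
      CongStar D (nusP (j + i) (wrap (sh (j + i)) Us (pair b (P'.shift i) (T.subst (recv j i N)))))
        (nusP (j' + i) (wrap (sh (j' + i)) Us (pair b (Q'.shift i) (T.subst (recv j' i N'))))) := by
  obtain ⟨j', N', Q', h1, h2⟩ := h i _ (hE.image _) _ _ _ _ (hs.shift hE i)
  obtain ⟨N₀, Q₀, h3, h4, h5⟩ := CStep.unren (renEnv_shift i E) (l := .out c) h1
  obtain ⟨N₀, rfl⟩ := h3.exists_some
  refine ⟨j', N₀, Q₀, h3, fun b T Us => ?_⟩
  refine .head (nusP_swap_out D c (v 0) j i N P' T b Us) ?_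
  refine .tail ?_ ((nusP_swap_out D c (v 0) j' i N₀ Q₀ T b Us).symm hsymm)
  have := (h2 (v 0) (substAll Us (sh (i + 1)) ++ [(b, T)])).nusP i
  subst h4 h5
  exact this

theorem ShiftSim.comm_inp {P Q : Proc L}
    (h : ShiftSim Ax D P Q) {E : Set ℕ} (hE : E.Finite)
    {c : Msg L} {N₀ : Option (Msg L)} {i : ℕ} {P' : Proc L} (hs : CStep Ax E P (.inp c) i N₀ P')
    (j : ℕ) :
    ∃ i' N₁ Q', CStep Ax E Q (.inp c) i' N₁ Q' ∧ ∀ (N : Msg L) (b : Bool) (T : Proc L) (Us : List (Bool × Proc L)),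
      CongStar D (nusP (j + i) (wrap (sh (j + i)) Us (pair b (P'.subst (recv j i N)) (T.shift i))))
        (nusP (j + i') (wrap (sh (j + i')) Us (pair b (Q'.subst (recv j i' N)) (T.shift i')))) := by
  obtain ⟨i', N', Q', h1, h2⟩ := h j _ (hE.image _) _ _ _ _ (hs.shift hE j)
  obtain ⟨N₁, Q₀, h3, h4, h5⟩ := CStep.unren (renEnv_shift j E) (l := .inp c) h1
  refine ⟨i', N₁, Q₀, h3, fun N b T Us => ?_⟩
  have := (h2 N (substAll Us (sh (j + 1)) ++ [(b, T.shift 1)])).nusP j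
  subst h5
  rw [plug_inp c j i N, plug_inp c j i' N]
  exact this

/-- The same commitment is renamed. Its own `j` binders are added inside the permuted block, so the
results differ by the permutation lifted over `j`, which is again an instance of `Cong.perm`. -/
theorem sim_perm {k : ℕ} {P : Proc L} {r r' : ℕ → ℕ} (h1 : ∀ n, r' (r n) = n)
    (h2 : ∀ n, r (r' n) = n) (h3 : ∀ n, k ≤ n → r n = n) :
    Sim Ax D (nusP k P) (nusP k (P.subst fun n => v (r n))) := by
  intro E hE l j N P' hs
  obtain ⟨j, rfl, hs₁⟩ := hs.nusP_inv
  have hr : RenEnv r (extendEnvN k E) (extendEnvN k E) := by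
    constructor
    · exact Function.LeftInverse.injective h1
    · intro n
      rcases lt_or_ge n k with hn | hn
      · exact iff_of_true (Or.inl (perm_lt h1 h3 n hn)) (Or.inl hn)
      · rw [h3 n hn]
  have hs' := hs₁.ren hr (extendEnvN_finite hE k)
  have hl : (l.subst (sh k)).subst (fun n => v (r n)) = l.subst (sh k) := by
    rw [CLab.subst_subst]
    congr 1
    funext n
    rw [sh_apply, v_subst, h3 _ (by omega)]
  rw [hl] at hs'
  refine ⟨_, _, _, hs'.nusP, fun M Us => ?_⟩
  have := Cong.perm (D := D) (k := j + k)
    (P := wrap (scons (N.getD (Msg.shift (j + k) M)) (sh (j + k))) Us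
      (l.body P' (Msg.shift (j + k) M)))
    (fun n => if n < j then n else r (n - j) + j) (fun n => if n < j then n else r' (n - j) + j)
    (fun n => by
      rcases lt_or_ge n j with hn | hn
      · simp only [if_pos hn]
      · simp only [if_neg (not_lt.2 hn)]
        rw [if_neg (by omega), Nat.add_sub_cancel, h1]; omega)
    (fun n => by
      rcases lt_or_ge n j with hn | hn
      · simp only [if_pos hn]
      · simp only [if_neg (not_lt.2 hn)]
        rw [if_neg (by omega), Nat.add_sub_cancel, h2]; omega)
    (fun n hn => by
      rw [if_neg (by omega), h3 _ (by omega)]; omega)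
  refine .single ?_
  rw [← upN_ren, wrap_subst, CLab.body_subst, upN_upN, Nat.add_comm l.ar j] at this
  have e1 : ∀ n, upN j (fun n => (v (r n) : Msg L)) (n + (j + k)) = v (n + (j + k)) := by
    intro n
    rw [show n + (j + k) = n + k + j by omega, upN_add, h3 _ (by omega), shift_v]
  have e2 : (Msg.shift (j + k) M).subst (upN j fun n => v (r n)) = Msg.shift (j + k) M := by
    rw [Msg.shift_subst]; simp only [e1]; rfl
  have e3 : (fun n => (scons (N.getD (Msg.shift (j + k) M)) (sh (j + k)) n).subst
      (upN j fun n => v (r n))) =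
      scons ((N.map fun M => M.subst (upN j fun n => v (r n))).getD (Msg.shift (j + k) M))
        (sh (j + k)) := by
    funext n
    cases n with
    | zero =>
      cases N with
      | none => exact e2
      | some N => rfl
    | succ n => simp only [scons_succ, sh_apply, v_subst, e1]
  rw [e2, e3] at this
  simpa only [plug, CLab.ar_subst] using this

/-- Induction on the context. All substitution instances are treated together because restrictions
lift the substitution and communications need shifted copies. Under a prefix the residuals are
related by the context itself, under the other operators by matching the commitment of the hole. -/
theorem Cong.sim_subst (hsymm : ∀ {P Q : Proc L}, D P Q → D Q P)
    (hsubst : ∀ {P Q : Proc L}, D P Q → ∀ s, D (P.subst s) (Q.subst s))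
    (hsim : ∀ {P Q : Proc L}, D P Q → Sim Ax D P Q) {P Q : Proc L} (h : Cong D P Q) (s : Subst L) :
    Sim Ax D (P.subst s) (Q.subst s) := by
  have hshift : ∀ {P Q : Proc L}, (∀ s, Sim Ax D (P.subst s) (Q.subst s)) →
      ∀ s, ShiftSim Ax D (P.subst s) (Q.subst s) := by
    intro P Q h s k
    simp only [Proc.shift, Proc.subst_subst]
    exact h _
  induction h generalizing s with
  | base h => exact hsim (hsubst h s)
  | @perm k P r r' h1 h2 h3 =>
    have := sim_perm (Ax := Ax) (D := D) (P := P.subst (upN k s)) h1 h2 h3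
    simpa only [nusP_subst, Proc.subst_subst, v_subst, ren_upN_comm (perm_lt h1 h3) h3] using this
  | out h _ =>
    intro E hE l j N P' hs
    cases hs with
    | out hM => exact ⟨_, _, _, .out hM, Matches.of_body fun _ => .single (h.subst hsubst s)⟩
  | inp h _ =>
    intro E hE l j N P' hs
    cases hs with
    | inp hM =>
      refine ⟨_, _, _, .inp hM, Matches.of_body fun M => .single ?_⟩
      simp only [CLab.body, Proc.inst_eq]
      exact (h.subst hsubst _).subst hsubst _
  | mat _ ih =>
    intro E hE l j N P' hs
    cases hs with
    | mat hs hM =>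
      obtain ⟨i, N', Q', h1, h2⟩ := ih s E hE _ _ _ _ hs
      exact ⟨i, N', Q', .mat h1 hM, h2⟩
  | mismat _ ih =>
    intro E hE l j N P' hs
    cases hs with
    | mismat hs hM =>
      obtain ⟨i, N', Q', h1, h2⟩ := ih s E hE _ _ _ _ hs
      exact ⟨i, N', Q', .mismat h1 hM, h2⟩
  | nu _ ih =>
    intro E hE l j N P' hs
    cases hs with
    | res hs =>
      obtain ⟨i, N', Q', h1, h2⟩ := ih s.up _ (extendEnv_finite hE) _ _ _ _ hs
      exact ⟨i + 1, N', Q', .res h1, h2.nu⟩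
  | sumL _ ih =>
    intro E hE l j N P' hs
    cases hs with
    | sumL hs =>
      obtain ⟨i, N', Q', h1, h2⟩ := ih s E hE _ _ _ _ hs
      exact ⟨i, N', Q', .sumL h1, h2⟩
    | sumR hs => exact ⟨_, _, _, .sumR hs, .refl _ _ _ _⟩
  | sumR _ ih =>
    intro E hE l j N P' hs
    cases hs with
    | sumL hs => exact ⟨_, _, _, .sumL hs, .refl _ _ _ _⟩
    | sumR hs =>
      obtain ⟨i, N', Q', h1, h2⟩ := ih s E hE _ _ _ _ hs
      exact ⟨i, N', Q', .sumR h1, h2⟩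
  | @pair P Q T b h ih =>
    intro E hE l j N P' hs
    rw [pair_subst] at hs ⊢
    obtain ⟨P', rfl, hs₁⟩ | ⟨T', rfl, hs₁⟩ | ⟨j, i, c, N₁, N₂, P', T', rfl, rfl, rfl, rfl, h1, h2⟩ |
      ⟨j, i, c, N₁, N₂, P', T', rfl, rfl, rfl, rfl, h1, h2⟩ := hs.pair_cases
    · obtain ⟨i, N', Q', h1, h2⟩ := ih s E hE _ _ _ _ hs₁
      exact ⟨i, N', _, h1.pair_left b _, h2.pair b _⟩
    · refine ⟨_, _, _, hs₁.pair_right b _, Matches.of_body fun M => .single ?_⟩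
      simp only [CLab.body_pair, CLab.body_shift]
      exact .pair b ((h.subst hsubst s).subst hsubst _)
    · obtain ⟨j', N', Q', h3, h4⟩ := (hshift ih s).comm_out hsymm hE h1 i
      exact ⟨_, _, _, h3.pair_out_inp b h2, .tau fun Us => h4 b T' Us⟩
    · obtain ⟨i', N', Q', h3, h4⟩ := (hshift ih s).comm_inp hE h2 j
      exact ⟨_, _, _, h1.pair_inp_out b h3, .tau fun Us => h4 N₁ b T' Us⟩
  | @rep P Q h ih =>
    intro E hE l j N P' hs
    have hrep : Cong D (Proc.rep (P.subst s)) (Proc.rep (Q.subst s)) := .rep (h.subst hsubst s)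
    cases hs with
    | repAct hs =>
      obtain ⟨i, N', Q', h1, h2⟩ := ih s E hE _ _ _ _ hs
      -- Single-hole contexts allow one replacement at a time: first the acting copy, with the
      -- residual `!P` kept, then `!P` by `!Q`.
      refine ⟨i, N', _, .repAct h1, fun M Us => (h2.pair true (.rep (P.subst s)) M Us).trans ?_⟩
      refine Matches.of_body (fun M => .single ?_) M Us
      simp only [CLab.body_pair, CLab.body_par, CLab.body_shift]
      exact Cong.pair false (hrep.subst hsubst _)
    | @repClose _ _ _ R c N j i N₀ h1 h2 =>
      obtain ⟨j', N₁, Q', h3, h4⟩ := (hshift ih s).comm_out hsymm hE h1 i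
      obtain ⟨i', N₂, R', h5, h6⟩ := (hshift ih s).comm_inp hE h2 j'
      refine ⟨_, _, _, .repClose h3 h5, .tau fun Us => ?_⟩
      have hw : ∀ (T : Proc L) (k : ℕ) (X : Proc L), wrap (sh k) (Us ++ [(true, T)]) X =
          wrap (sh k) Us (.par X (T.shift k)) := fun T k X => wrap_append _ _ _ _
      -- Three replacements in turn: the sending copy, the receiving copy next to the new sender,
      -- and finally the replication.
      have g1 := h4 true R (Us ++ [(true, .rep (P.subst s))])
      have g2 := h6 N₁ false Q' (Us ++ [(true, .rep (P.subst s))])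
      simp only [hw] at g1 g2
      refine (g1.trans g2).trans (CongStar.nusP (CongStar.wrap (.single ?_) _ _) _)
      exact Cong.pair false (hrep.subst hsubst _)

end Closure

/-! ### Framed pairs -/

section Framed

variable {L : FirstOrder.Language.{u, w}} {Ax : Msg L → Msg L → Prop}

/-- The even variables, which serve as names of outputs. -/
def Ev : Set ℕ := {n | Even n}

/-- All output variables of a history are even. -/
def History.OutsEven : History L → Prop
  | .nil => True
  | .out h x => h.OutsEven ∧ x ∈ Ev
  | .inp h _ => h.OutsEven

theorem History.fv_finite (h : History L) : h.fv.Finite := by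
  induction h with
  | nil => exact Set.finite_empty
  | out h x ih => exact ih.union (Set.finite_singleton x)
  | inp h M ih => exact ih.union (Msg.fv_finite M)

theorem History.mem_fv_subst {h : History L} {σ : Subst L} (hσ : Respects σ h) {x : ℕ} :
    x ∈ (h.subst σ).fv ↔ ∃ n ∈ h.fv, x ∈ Msg.fv (σ n) := by
  induction h with
  | nil => simp [History.subst, History.fv]
  | out h y ih =>
    simp only [History.subst, History.fv, Set.mem_union, ih hσ.1, Set.mem_singleton_iff,
      or_and_right, exists_or, exists_eq_left, hσ.2.1, Msg.fv_var]
  | inp h M ih =>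
    simp only [History.subst, History.fv, Set.mem_union, ih hσ, Msg.mem_fv_subst, or_and_right,
      exists_or]

theorem History.OutsEven.subst {h : History L} (hh : h.OutsEven) (σ : Subst L) :
    (h.subst σ).OutsEven := by
  induction h with
  | nil => trivial
  | out h x ih => exact ⟨ih hh.1, hh.2⟩
  | inp h M ih => exact ih hh

theorem Respects.id_subst {h : History L} {σ : Subst L} (hσ : Respects σ h) :
    Respects Subst.id (h.subst σ) := by
  induction h with
  | nil => trivial
  | out h x ih =>
    refine ⟨ih hσ.1, rfl, fun y hy hx => ?_⟩
    obtain ⟨n, hn, hyn⟩ := (History.mem_fv_subst hσ.1).1 hy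
    rw [Subst.id, Msg.fv_var, Set.mem_singleton_iff] at hx
    exact hσ.2.2 n hn (hx ▸ hyn)
  | inp h M ih => exact ih hσ

/-- The output variables are even, hence fixed and not produced by other variables. An even variable
of an earlier part is itself fixed, so it can yield a later output variable only if it equals it,
which `hid` excludes. -/
theorem respects_of_freshFor {h : History L} (hh : h.OutsEven) (hid : Respects Subst.id h)
    {σ : Subst L} (hσ : σ.FreshFor Ev) : Respects σ h := by
  rw [freshFor_iff] at hσ
  induction h with
  | nil => trivial
  | out h x ih =>
    refine ⟨ih hh.1 hid.1, hσ.1 x hh.2, fun y hy => ?_⟩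
    by_cases hyE : y ∈ Ev
    · rw [hσ.1 y hyE]; exact hid.2.2 y hy
    · exact hσ.2 y hyE x hh.2
  | inp h M ih => exact ih hh hid

theorem respects_of_eq {h : History L} (hid : Respects Subst.id h) {σ : Subst L}
    (hσ : ∀ n ∈ h.fv, σ n = v n) : Respects σ h := by
  induction h with
  | nil => trivial
  | out h x ih =>
    refine ⟨ih hid.1 fun n hn => hσ n (Or.inl hn), hσ x (Or.inr rfl), fun y hy => ?_⟩
    rw [hσ y (Or.inl hy)]; exact hid.2.2 y hy
  | inp h M ih => exact ih hid fun n hn => hσ n (Or.inl hn)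

/-! ### Normal forms, frames and transitions below a block of binders. -/

theorem normalAt_nus (m k : ℕ) (A : EProc L) :
    EProc.NormalAt m (EProc.nus k A) ↔ EProc.NormalAt (m + k) A := by
  induction k generalizing m with
  | zero => rfl
  | succ k ih =>
    simp only [EProc.nus, EProc.NormalAt, ih]
    rw [Nat.add_assoc, Nat.add_comm 1 k]

theorem normal_nus_base {k : ℕ} {θ : Subst L} {P : Proc L} :
    (EProc.nus k (.base θ P)).Normal ↔
      θ.dom.Finite ∧ ∀ x ∈ θ.dom, k ≤ x ∧ x ∉ P.fv ∧ ∀ y, x ∉ Msg.fv (θ y) := by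
  rw [EProc.Normal, normalAt_nus, Nat.zero_add]; rfl

theorem mem_fv_nus {k n : ℕ} {A : EProc L} : n ∈ (EProc.nus k A).fv ↔ n + k ∈ A.fv := by
  induction k generalizing n with
  | zero => rfl
  | succ k ih =>
    simp only [EProc.nus, EProc.fv, Set.mem_ofPred_eq, ih]
    rw [Nat.add_assoc, Nat.add_comm 1 k]

theorem finite_preimage_add {s : Set ℕ} (h : s.Finite) (k : ℕ) : {n | n + k ∈ s}.Finite :=
  h.preimage (f := (· + k)) (add_left_injective k).injOn

theorem fv_nus_base_finite {k : ℕ} {θ : Subst L} {P : Proc L} (h : θ.dom.Finite) :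
    (EProc.nus k (.base θ P)).fv.Finite := by
  have h2 : {n | ∃ y ∈ θ.dom, n ∈ Msg.fv (θ y)}.Finite := by
    have : {n | ∃ y ∈ θ.dom, n ∈ Msg.fv (θ y)} = ⋃ y ∈ θ.dom, Msg.fv (θ y) := by ext; simp
    rw [this]
    exact h.biUnion fun y _ => Msg.fv_finite _
  refine (finite_preimage_add ((h.union h2).union P.fv_finite) k).subset ?_
  intro n hn
  exact mem_fv_nus.1 hn

/-- The active substitution below `k` binders, as a map from recipes of the outer scope. -/
def fr (k : ℕ) (θ : Subst L) : Subst L := fun n => θ (n + k)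

theorem equates_nus_base {k : ℕ} {θ : Subst L} {P : Proc L} {M N : Msg L} :
    (EProc.nus k (.base θ P)).Equates Ax M N ↔ EqE Ax (M.subst (fr k θ)) (N.subst (fr k θ)) := by
  have : ∀ (k : ℕ) (M N : Msg L), (EProc.nus k (.base θ P)).Equates Ax M N ↔
      (EProc.base θ P).Equates Ax (Msg.shift k M) (Msg.shift k N) := by
    intro k
    induction k with
    | zero => intro M N; simp only [Msg.shift_zero]; rfl
    | succ k ih =>
      intro M N
      simp only [EProc.nus, EProc.Equates] at ih ⊢
      rw [ih, Msg.shift_shift, Msg.shift_shift, Nat.add_comm]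
  rw [this]
  simp only [EProc.Equates, Msg.shift_subst]
  rfl

theorem NormSubst.nus {k : ℕ} {A A' : EProc L} {σ : Subst L} (h : NormSubst A (upN k σ) A') :
    NormSubst (EProc.nus k A) σ (EProc.nus k A') := by
  induction k generalizing σ with
  | zero => rw [upN_zero] at h; exact h
  | succ k ih => exact .nu (ih (by rw [upN_up]; exact h))

theorem elStep_nus_iff {k x : ℕ} {l : CLab L} {A B : EProc L} :
    ELStep Ax (EProc.nus k A) (l.lact x) B ↔
      ∃ B', B = EProc.nus k B' ∧ ELStep Ax A ((l.subst (sh k)).lact (x + k)) B' := by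
  induction k generalizing l x B with
  | zero =>
    rw [show (sh 0 : Subst L) = fun n => v n from rfl, CLab.subst_v]
    simp [EProc.nus]
  | succ k ih =>
    have key : ∀ B', ELStep Ax (EProc.nus k A) ((l.subst (sh 1)).lact (x + 1)) B' ↔
        ∃ B'', B' = EProc.nus k B'' ∧ ELStep Ax A ((l.subst (sh (k + 1))).lact (x + (k + 1))) B'' := by
      intro B'
      rw [ih, CLab.subst_subst, Nat.add_assoc, Nat.add_comm 1 k]
      have : (l.subst fun n => (sh 1 n : Msg L).subst (sh k)) = l.subst (sh (k + 1)) := by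
        congr 1; funext n; simp only [sh_apply, v_subst]; congr 1; omega
      rw [this]
    constructor
    · intro h
      cases h with
      | res h =>
        rw [CLab.lact_shift] at h
        obtain ⟨B'', rfl, h'⟩ := (key _).1 h
        exact ⟨B'', rfl, h'⟩
    · rintro ⟨B'', rfl, h⟩
      refine .res ?_
      rw [CLab.lact_shift]
      exact (key _).2 ⟨B'', rfl, h⟩

theorem elStep_base_iff {x : ℕ} {l : CLab L} {θ : Subst L} {P : Proc L} {B : EProc L} :
    ELStep Ax (.base θ P) (l.lact x) B ↔ ∃ B', B = EProc.addSubst θ B' ∧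
      LStep Ax P ((l.subst θ).lact x) B' ∧ θ.FreshFor (l.lact x).bn := by
  have : (l.lact x).subst θ = (l.subst θ).lact x := by cases l <;> rfl
  constructor
  · intro h
    cases h with
    | frame h hf => exact ⟨_, rfl, this ▸ h, hf⟩
  · rintro ⟨B', rfl, h, hf⟩
    exact .frame (this ▸ h) hf

theorem CLab.bn_subst_lact (l : CLab L) (σ : Subst L) (x : ℕ) :
    ((l.subst σ).lact x).bn = (l.lact x).bn := by cases l <;> rfl

/-- Transitions of an extended process in terms of commitments of its process part: the target. -/
def target (k : ℕ) (θ : Subst L) (l : CLab L) (x j : ℕ) (N : Option (Msg L)) (P : Proc L) : EProc L :=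
  EProc.nus (k + j) (.base ((upN j θ).comp (l.frame (x + k) j N)) (l.body P (v (x + (k + j)))))

theorem addSubst_result (k : ℕ) (θ : Subst L) (l : CLab L) (x j : ℕ) (N : Option (Msg L))
    (P : Proc L) :
    EProc.nus k (EProc.addSubst θ (l.result (x + k) (v (x + k)) j N P)) = target k θ l x j N P := by
  simp only [CLab.result, addSubst_nus, nus_nus, EProc.addSubst, target, shift_v, Nat.add_assoc]

theorem CLab.frame_subst (l : CLab L) (σ : Subst L) (x j : ℕ) (N : Option (Msg L)) :
    (l.subst σ).frame x j N = l.frame x j N := by cases l <;> rfl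

theorem CLab.result_subst_label (l : CLab L) (σ : Subst L) (x j : ℕ) (I : Msg L)
    (N : Option (Msg L)) (P : Proc L) : (l.subst σ).result x I j N P = l.result x I j N P := by
  simp only [CLab.result, CLab.frame_subst, CLab.body_subst_label]

theorem CLab.subst_sh_subst (l : CLab L) (k : ℕ) (θ : Subst L) :
    (l.subst (sh k)).subst θ = l.subst (fr k θ) := by
  rw [CLab.subst_subst]; rfl

/-- The label `l` is a recipe: the process acts on the channel obtained through the frame, and the
observer sees the recipe. Freshness of `x` makes the frame fresh for the bound name. -/
theorem CStep.toELStep {E : Set ℕ} {k : ℕ} {θ : Subst L} {P P' : Proc L} {l : CLab L} {j : ℕ}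
    {N : Option (Msg L)} (h : CStep Ax E P (l.subst (fr k θ)) j N P') (hP : P.MismatchFree) {x : ℕ}
    (hx : x ∉ (EProc.nus k (.base θ P)).fv) (hl : x + k ∉ (l.subst (fr k θ)).fv) :
    ELStep Ax (EProc.nus k (.base θ P)) (l.lact x) (target k θ l x j N P') := by
  rw [mem_fv_nus] at hx
  simp only [EProc.fv, Set.mem_union, not_or] at hx
  have h' := h.change_env hP ∅
  rw [← Proc.subst_v P] at h'
  have h2 := h'.toLStep hP _ (x := x + k) (by
    rw [Proc.subst_v]; rintro (h | h); exacts [hx.2 h, hl h])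
  rw [Proc.subst_v, CLab.result_subst_label] at h2
  refine elStep_nus_iff.2 ⟨_, (addSubst_result k θ l x j N P').symm, elStep_base_iff.2
    ⟨_, rfl, ?_, ?_⟩⟩
  · rw [CLab.subst_sh_subst]; exact h2
  · rw [CLab.bn_subst_lact]
    have hf : θ.FreshFor {x + k} := by
      rw [freshFor_iff]
      constructor
      · rintro _ rfl
        by_contra hne
        exact hx.1.1 hne
      · rintro y hy _ rfl hxy
        by_cases hyd : θ y = v y
        · rw [hyd, Msg.fv_var] at hxy
          exact hy hxy.symm
        · exact hx.1.2 ⟨y, hyd, hxy⟩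
    cases l with
    | tau => rw [freshFor_iff]; simp [CLab.lact, LAct.bn]
    | out => exact hf
    | inp => exact hf

theorem exists_cStep_of_elStep {k : ℕ} {θ : Subst L} {P : Proc L} {l : CLab L} {x : ℕ} {B : EProc L}
    (h : ELStep Ax (EProc.nus k (.base θ P)) (l.lact x) B) (E : Set ℕ) :
    ∃ j N P', CStep Ax E P (l.subst (fr k θ)) j N P' ∧ B = target k θ l x j N P' := by
  obtain ⟨_, rfl, h₁⟩ := elStep_nus_iff.1 h
  obtain ⟨_, rfl, h₂, -⟩ := elStep_base_iff.1 h₁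
  obtain ⟨j, N, P', h1, rfl, -⟩ := h₂.toCStep E rfl
  rw [CLab.subst_sh_subst] at h1
  refine ⟨j, N, P', h1, ?_⟩
  rw [CLab.result_subst_label, CLab.result_subst_label, addSubst_result]

/-! ### Framed pairs, their substitution instances and static equivalence. -/

/-- Related extended processes `ν z₁ … z_k.(θ | P)` and `ν z₁ … z_l.(ρ | Q)`, without mismatch,
whose active substitutions have even variables as their domains. -/
structure FramedPair (R : History L → EProc L → EProc L → Prop) (h : History L) (k : ℕ)
    (θ : Subst L) (P : Proc L) (l : ℕ) (ρ : Subst L) (Q : Proc L) : Prop where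
  rel : R h (EProc.nus k (.base θ P)) (EProc.nus l (.base ρ Q))
  outs : h.OutsEven
  wf : Respects Subst.id h
  domL : ∀ x ∈ θ.dom, ∃ n ∈ Ev, x = n + k
  domR : ∀ x ∈ ρ.dom, ∃ n ∈ Ev, x = n + l
  mfL : P.MismatchFree
  mfR : Q.MismatchFree

variable {R : History L → EProc L → EProc L → Prop} {h : History L} {k l : ℕ} {θ ρ : Subst L}
  {P Q : Proc L}

theorem FramedPair.symm (hR : IsOpenBisimulation Ax R) (hF : FramedPair R h k θ P l ρ Q) :
    FramedPair R h l ρ Q k θ P :=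
  ⟨hR.symm hF.rel, hF.outs, hF.wf, hF.domR, hF.domL, hF.mfR, hF.mfL⟩

theorem fr_odd (hd : ∀ x ∈ θ.dom, ∃ n ∈ Ev, x = n + k) {n : ℕ} (hn : n ∉ Ev) :
    fr k θ n = v (n + k) := by
  by_contra hne
  obtain ⟨m, hm, he⟩ := hd (n + k) hne
  exact hn (Nat.add_right_cancel he ▸ hm)

open Classical in
/-- The active substitution of the normal form after the application of `σ`. -/
noncomputable def substFrame (k : ℕ) (θ σ : Subst L) : Subst L :=
  fun n => if θ n = v n then v n else (θ n).subst (upN k σ)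

theorem notMem_fv_upN (hd : ∀ x ∈ θ.dom, ∃ n ∈ Ev, x = n + k) {σ : Subst L} (hσ : σ.FreshFor Ev)
    {x y : ℕ} (hx : x ∈ θ.dom) (hy : y ≠ x) : x ∉ Msg.fv (upN k σ y) := by
  rw [freshFor_iff] at hσ
  obtain ⟨n, hn, rfl⟩ := hd x hx
  intro hxy
  rcases lt_or_ge y k with h | h
  · rw [upN_lt _ h, Msg.fv_var, Set.mem_singleton_iff] at hxy; omega
  · obtain ⟨m, rfl⟩ := Nat.exists_eq_add_of_le' h
    rw [upN_add, Msg.add_mem_fv_shift] at hxy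
    by_cases hm : m ∈ Ev
    · rw [hσ.1 m hm, Msg.fv_var, Set.mem_singleton_iff] at hxy
      exact hy (by rw [hxy])
    · exact hσ.2 m hm n hn hxy

theorem notMem_fv_subst_upN (hd : ∀ x ∈ θ.dom, ∃ n ∈ Ev, x = n + k) {σ : Subst L}
    (hσ : σ.FreshFor Ev) {x : ℕ} (hx : x ∈ θ.dom) {M : Msg L} (hM : x ∉ Msg.fv M) :
    x ∉ Msg.fv (M.subst (upN k σ)) := by
  intro h
  obtain ⟨y, hy, hxy⟩ := Msg.mem_fv_subst.1 h
  exact notMem_fv_upN hd hσ hx (fun he => hM (he ▸ hy)) hxy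

theorem dom_substFrame (hN : ∀ x ∈ θ.dom, ∀ y, x ∉ Msg.fv (θ y))
    (hd : ∀ x ∈ θ.dom, ∃ n ∈ Ev, x = n + k) {σ : Subst L} (hσ : σ.FreshFor Ev) :
    (substFrame k θ σ).dom = θ.dom := by
  ext x
  simp only [Subst.dom, substFrame, Set.mem_ofPred_eq]
  split_ifs with hx
  · simp [hx]
  · refine iff_of_true (fun he => ?_) hx
    have := notMem_fv_subst_upN hd hσ hx (hN x hx x)
    rw [he, Msg.fv_var] at this
    exact this rfl

/-- Domain variables are even and `σ` introduces no even variable, so one application of `σ` already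
solves the equations for the new frame and nothing has to be applied again. -/
theorem normSubst_fresh (hN : (EProc.nus k (.base θ P)).Normal)
    (hd : ∀ x ∈ θ.dom, ∃ n ∈ Ev, x = n + k) {σ : Subst L} (hσ : σ.FreshFor Ev) :
    NormSubst (EProc.nus k (.base θ P)) σ
      (EProc.nus k (.base (substFrame k θ σ) (P.subst (upN k σ)))) := by
  rw [normal_nus_base] at hN
  have hN1 : ∀ x ∈ θ.dom, ∀ y, x ∉ Msg.fv (θ y) := fun x hx => (hN.2 x hx).2.2
  have hdom := dom_substFrame hN1 hd hσ
  have hfix : ∀ y ∉ θ.dom, substFrame k θ σ y = v y := by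
    intro y hy
    rw [← hdom] at hy
    exact not_not.1 hy
  have hP : (P.subst (upN k σ)).subst (substFrame k θ σ) = P.subst (upN k σ) := by
    conv_rhs => rw [← Proc.subst_v (P.subst (upN k σ))]
    refine Proc.subst_congr fun y hy => hfix y fun hyd => ?_
    obtain ⟨z, hz, hyz⟩ := Proc.mem_fv_subst.1 hy
    exact notMem_fv_upN hd hσ hyd (fun he => (hN.2 y hyd).2.1 (he ▸ hz)) hyz
  refine NormSubst.nus ?_
  have := NormSubst.base (θ := θ) (θ' := substFrame k θ σ) (σ := upN k σ) (P := P) hdom ?_ ?_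
  · rwa [hP] at this
  · intro y
    rw [Set.disjoint_right]
    intro x hx hxy
    by_cases hy : θ y = v y
    · rw [substFrame, if_pos hy, Msg.fv_var, Set.mem_singleton_iff] at hxy
      exact hx (hxy ▸ hy)
    · rw [substFrame, if_neg hy] at hxy
      exact notMem_fv_subst_upN hd hσ hx (hN1 x hx y) hxy
  · intro x hx
    rw [substFrame, if_neg hx]
    conv_lhs => rw [← Msg.subst_v ((θ x).subst (upN k σ))]
    refine Msg.subst_congr fun y hy => (hfix y fun hyd => ?_).symm
    exact notMem_fv_subst_upN hd hσ hyd (hN1 y hyd x) hy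

/-- Evaluating a recipe and then instantiating agrees with instantiating the recipe and evaluating
it over the new frame: even variables are fixed by `σ`, odd ones by the frame up to the shift. -/
theorem fr_subst (hd : ∀ x ∈ θ.dom, ∃ n ∈ Ev, x = n + k) {σ : Subst L} (hσ : σ.FreshFor Ev) (n : ℕ) :
    (fr k θ n).subst (upN k σ) = (σ n).subst (fr k (substFrame k θ σ)) := by
  have hσ' := freshFor_iff.1 hσ
  by_cases hn : n ∈ Ev
  · rw [hσ'.1 n hn, v_subst]
    simp only [fr, substFrame]
    split_ifs with h
    · rw [h, v_subst, upN_add, hσ'.1 n hn, shift_v]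
    · rfl
  · rw [fr_odd hd hn, v_subst, upN_add, Msg.shift]
    refine Msg.subst_congr fun m hm => ?_
    have hm' : m ∉ Ev := fun h => hσ'.2 n hn m h hm
    have h0 : θ (m + k) = v (m + k) := fr_odd hd hm'
    rw [fr, substFrame, if_pos h0]

theorem FramedPair.subst (hR : IsOpenBisimulation Ax R) (hF : FramedPair R h k θ P l ρ Q)
    {σ : Subst L} (hσ : σ.FreshFor Ev) :
    FramedPair R (h.subst σ) k (substFrame k θ σ) (P.subst (upN k σ)) l (substFrame l ρ σ)
      (Q.subst (upN l σ)) := by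
  have hresp := respects_of_freshFor hF.outs hF.wf hσ
  obtain ⟨hA, hB⟩ := hR.normal hF.rel
  refine ⟨hR.subst hF.rel σ hresp _ _ (normSubst_fresh hA hF.domL hσ) (normSubst_fresh hB hF.domR hσ),
    hF.outs.subst σ, hresp.id_subst, ?_, ?_, (Proc.mismatchFree_subst _).2 hF.mfL,
    (Proc.mismatchFree_subst _).2 hF.mfR⟩
  · rw [dom_substFrame (fun x hx => ((normal_nus_base.1 hA).2 x hx).2.2) hF.domL hσ]
    exact hF.domL
  · rw [dom_substFrame (fun x hx => ((normal_nus_base.1 hB).2 x hx).2.2) hF.domR hσ]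
    exact hF.domR

/-- Static equivalence extends to recipes with additional names. -/
theorem FramedPair.eq_upN (hR : IsOpenBisimulation Ax R) (hF : FramedPair R h k θ P l ρ Q)
    (m : ℕ) (M N : Msg L)
    (hMN : EqE Ax (M.subst (upN m (fr k θ))) (N.subst (upN m (fr k θ)))) :
    EqE Ax (M.subst (upN m (fr l ρ))) (N.subst (upN m (fr l ρ))) := by
  -- Static equivalence concerns recipes in the outer scope only. The `m` additional names are
  -- therefore represented by the odd variables `2 * (i + B) + 1`, with `B` bounding all variables
  -- of the relevant images under `ρ`.
  have hfin : (⋃ n ∈ Msg.fv M ∪ Msg.fv N, Msg.fv (ρ (n - m + l))).Finite :=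
    ((Msg.fv_finite M).union (Msg.fv_finite N)).biUnion fun n _ => Msg.fv_finite _
  obtain ⟨B, hB⟩ := hfin.bddAbove
  have hB' : ∀ n ∈ Msg.fv M ∪ Msg.fv N, ∀ z ∈ Msg.fv (ρ (n - m + l)), z ≤ B := fun n hn z hz =>
    hB (Set.mem_biUnion hn hz)
  have hodd : ∀ i, 2 * (i + B) + 1 ∉ Ev := fun i h => by
    rw [Ev, Set.mem_ofPred_eq, Nat.even_iff] at h; omega
  have e1 : ∀ M : Msg L,
      (M.subst fun i => v (if i < m then 2 * (i + B) + 1 else i - m)).subst (fr k θ) =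
      (M.subst (upN m (fr k θ))).subst
        (fun i => v (if i < m then 2 * (i + B) + 1 + k else i - m)) := by
    intro M
    rw [Msg.subst_subst, Msg.subst_subst]
    refine Msg.subst_congr fun n _ => ?_
    rcases lt_or_ge n m with hn | hn
    · rw [upN_lt _ hn]
      simp only [v_subst, if_pos hn]
      exact fr_odd hF.domL (hodd n)
    · rw [upN_ge _ hn, Msg.shift_subst]
      simp only [v_subst, if_neg (not_lt.2 hn)]
      conv_lhs => rw [← Msg.subst_v (fr k θ (n - m))]
      refine Msg.subst_congr fun z _ => ?_
      rw [if_neg (by omega), Nat.add_sub_cancel]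
  -- Afterwards the names are recovered: variables of the images stay below `2 * B + 1 + l`, and `2
  -- * (i + B) + 1 + l` is decoded to `i`.
  have e2 : ∀ M' : Msg L, Msg.fv M' ⊆ Msg.fv M ∪ Msg.fv N →
      ((M'.subst fun i => v (if i < m then 2 * (i + B) + 1 else i - m)).subst (fr l ρ)).subst
        (fun z => v (if z < 2 * B + 1 + l then z + m else (z - l - 1) / 2 - B)) =
      M'.subst (upN m (fr l ρ)) := by
    intro M' hM'
    rw [Msg.subst_subst, Msg.subst_subst]
    refine Msg.subst_congr fun n hn' => ?_
    rcases lt_or_ge n m with hn | hn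
    · rw [upN_lt _ hn]
      simp only [v_subst, if_pos hn]
      rw [fr_odd hF.domR (hodd n), v_subst, if_neg (by omega)]
      congr 1; omega
    · rw [upN_ge _ hn, Msg.shift]
      simp only [v_subst, if_neg (not_lt.2 hn)]
      refine Msg.subst_congr fun z hz => ?_
      have := hB' n (hM' hn') z hz
      rw [if_pos (by omega)]
  have h1 := hMN.subst (fun i => v (if i < m then 2 * (i + B) + 1 + k else i - m))
  rw [← e1, ← e1] at h1
  have h2 := equates_nus_base.1 ((hR.static hF.rel _ _).1 (equates_nus_base.2 h1))
  have h3 := h2.subst (fun z => v (if z < 2 * B + 1 + l then z + m else (z - l - 1) / 2 - B))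
  rwa [e2 M (Set.subset_union_left), e2 N (Set.subset_union_right)] at h3

theorem freshFor_mono {σ : Subst L} {E F : Set ℕ} (h : σ.FreshFor F) (hEF : E ⊆ F) :
    σ.FreshFor E := by
  rw [freshFor_iff] at h ⊢
  refine ⟨fun x hx => h.1 x (hEF hx), fun y hy x hx => ?_⟩
  by_cases hyF : y ∈ F
  · rw [h.1 y hyF, Msg.fv_var]
    rintro rfl
    exact hy hx
  · exact h.2 y hyF x (hEF hx)

/-- The point at which mismatch in the context becomes harmless. A substitution refuting the
inequality over `ρ` is fresh for the binders and the even variables, so it comes from a respectful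
substitution `σ` of the outer scope. The instances under `σ` form a framed pair again, whose static
equivalence turns it into a refutation over `θ`. -/
theorem FramedPair.transfer (hR : IsOpenBisimulation Ax R) (hF : FramedPair R h k θ P l ρ Q)
    {E : Set ℕ} (hE : Ev ⊆ E) :
    Transfer Ax (extendEnvN k E) (fr k θ) (extendEnvN l E) (fr l ρ) where
  eq := hF.eq_upN hR
  ne m M N hMN := by
    rintro ⟨τ, hτ, he⟩
    rw [extendEnvN_extendEnvN] at hτ
    obtain ⟨σ, hσ, rfl⟩ := exists_upN_of_freshFor hτ
    have hσE := freshFor_mono hσ hE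
    have key : ∀ {k : ℕ} {θ : Subst L} (_ : ∀ x ∈ θ.dom, ∃ n ∈ Ev, x = n + k) (M : Msg L),
        (M.subst (upN m (fr k θ))).subst (upN (m + k) σ) =
          (M.subst (upN m σ)).subst (upN m (fr k (substFrame k θ σ))) := by
      intro k θ hd M
      rw [Msg.subst_subst, Msg.subst_subst]
      congr 1
      funext n
      rw [← upN_upN, upN_subst, upN_subst]
      congr 1
      funext n
      exact fr_subst hd hσE n
    rw [key hF.domR, key hF.domR] at he
    have he' := ((hF.subst hR hσE).symm hR).eq_upN hR m _ _ he
    rw [← key hF.domL, ← key hF.domL] at he'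
    refine hMN ⟨upN (m + k) σ, ?_, he'⟩
    rw [extendEnvN_extendEnvN]
    exact freshFor_upN hσ _

end Framed

/-! ### The relation generated by an open bisimulation -/

section Generated

variable {L : FirstOrder.Language.{u, w}} {Ax : Msg L → Msg L → Prop}

/-- Injective renamings into the odd variables which leave infinitely many odd variables unused. -/
structure Adm (f : ℕ → ℕ) : Prop where
  inj : Function.Injective f
  odd : ∀ n, f n ∉ Ev
  inf : {n | n ∉ Ev ∧ n ∉ Set.range f}.Infinite

/-- Room for `j` new names: they receive unused odd variables, and infinitely many remain unused. -/
theorem Adm.exists_extend {f : ℕ → ℕ} (hf : Adm f) (j : ℕ) :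
    ∃ f', Adm f' ∧ ∀ n, f' (n + j) = f n := by
  induction j with
  | zero => exact ⟨f, hf, fun _ => rfl⟩
  | succ j ih =>
    obtain ⟨g, hg, hgf⟩ := ih
    obtain ⟨y, hy, hyg⟩ := hg.inf.nonempty
    refine ⟨fun n => Nat.casesOn n y g, ⟨?_, ?_, ?_⟩, fun n => hgf n⟩
    · intro a b hab
      cases a with
      | zero =>
        cases b with
        | zero => rfl
        | succ b => exact absurd ⟨b, hab.symm⟩ hyg
      | succ a =>
        cases b with
        | zero => exact absurd ⟨a, hab⟩ hyg
        | succ b => exact congrArg _ (hg.inj hab)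
    · intro n
      cases n with
      | zero => exact hy
      | succ n => exact hg.odd n
    · refine (hg.inf.sdiff (Set.finite_singleton y)).mono ?_
      rintro n ⟨⟨hn1, hn2⟩, hn3⟩
      refine ⟨hn1, ?_⟩
      rintro ⟨m, rfl⟩
      cases m with
      | zero => exact hn3 rfl
      | succ m => exact hn2 ⟨m, rfl⟩

theorem adm_four_mul : Adm fun n => 4 * n + 1 := by
  refine ⟨fun a b h => ?_, fun n h => ?_, ?_⟩
  · exact by omega
  · rw [Ev, Set.mem_ofPred_eq, Nat.even_iff] at h; omega
  · refine Set.infinite_of_injective_forall_mem (f := fun n => 4 * n + 3) (fun a b h => ?_) fun n => ?_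
    · simp only [Nat.add_right_cancel_iff] at h; omega
    · refine ⟨fun h => ?_, ?_⟩
      · rw [Ev, Set.mem_ofPred_eq, Nat.even_iff] at h; omega
      · rintro ⟨m, hm⟩; simp only at hm; omega

/-- Processes which, after a renaming, consist of a framed pair next to common parallel components,
the messages of which are recipes over the frames. -/
inductive FrameRel (R : History L → EProc L → EProc L → Prop) (P₀ Q₀ : Proc L) : Prop
  | intro {f : ℕ → ℕ} {h : History L} {k l : ℕ} {θ ρ : Subst L} {P Q : Proc L}
      (Ts : List (Bool × Proc L)) (hf : Adm f) (hF : FramedPair R h k θ P l ρ Q)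
      (hP : P₀.subst (fun n => v (f n)) = nusP k (wrap (fr k θ) Ts P))
      (hQ : Q₀.subst (fun n => v (f n)) = nusP l (wrap (fr l ρ) Ts Q)) : FrameRel R P₀ Q₀

variable {R : History L → EProc L → EProc L → Prop}

theorem FrameRel.symm (hR : IsOpenBisimulation Ax R) {P Q : Proc L} (h : FrameRel R P Q) :
    FrameRel R Q P := by
  obtain ⟨Ts, hf, hF, hP, hQ⟩ := h
  exact ⟨Ts, hf, hF.symm hR, hQ, hP⟩

/-- An arbitrary substitution becomes fresh for the even variables once it is conjugated by `f`;
hence every instance of a pair in `FrameRel` stays within the respectful ones. -/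
theorem extend_freshFor {f : ℕ → ℕ} (hf : Adm f) (s : Subst L) :
    Subst.FreshFor (Function.extend f (fun n => (s n).subst fun n => v (f n)) (fun n => v n)) Ev := by
  rw [freshFor_iff]
  constructor
  · intro x hx
    exact Function.extend_apply' _ _ _ fun ⟨n, hn⟩ => hf.odd n (hn ▸ hx)
  · intro y hy x hx hxy
    by_cases h : ∃ n, f n = y
    · obtain ⟨n, rfl⟩ := h
      rw [hf.inj.extend_apply, Msg.mem_fv_subst] at hxy
      obtain ⟨m, -, hm⟩ := hxy
      rw [Msg.fv_var, Set.mem_singleton_iff] at hm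
      exact hf.odd m (hm ▸ hx)
    · rw [Function.extend_apply' _ _ _ h, Msg.fv_var, Set.mem_singleton_iff] at hxy
      exact hy (hxy ▸ hx)

theorem nusP_wrap_subst {k : ℕ} {θ : Subst L} (hd : ∀ x ∈ θ.dom, ∃ n ∈ Ev, x = n + k) {σ : Subst L}
    (hσ : σ.FreshFor Ev) (Ts : List (Bool × Proc L)) (P : Proc L) :
    (nusP k (wrap (fr k θ) Ts P)).subst σ =
      nusP k (wrap (fr k (substFrame k θ σ)) (substAll Ts σ) (P.subst (upN k σ))) := by
  rw [nusP_subst, wrap_subst, wrap_substAll]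
  simp only [fr_subst hd hσ]

theorem FrameRel.subst (hR : IsOpenBisimulation Ax R) {P Q : Proc L} (h : FrameRel R P Q)
    (s : Subst L) : FrameRel R (P.subst s) (Q.subst s) := by
  obtain @⟨f, _, k, l, θ, ρ, P', Q', Ts, hf, hF, hP, hQ⟩ := h
  have hσ := extend_freshFor hf s
  have key : ∀ P : Proc L, (P.subst s).subst (fun n => v (f n)) = (P.subst fun n => v (f n)).subst
      (Function.extend f (fun n => (s n).subst fun n => v (f n)) (fun n => v n)) := by
    intro P
    simp only [Proc.subst_subst, v_subst, hf.inj.extend_apply]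
  refine ⟨substAll Ts (Function.extend f (fun n => (s n).subst fun n => v (f n)) fun n => v n), hf, hF.subst hR hσ, ?_, ?_⟩
  · rw [key, hP, nusP_wrap_subst hF.domL hσ]
  · rw [key, hQ, nusP_wrap_subst hF.domR hσ]

/-! ### Opening of binders into fresh odd variables. -/

/-- The processes that are renamed to `Y` and `Z` by `f` are related. -/
def RelatedVia (R : History L → EProc L → EProc L → Prop) (f : ℕ → ℕ) (Y Z : Proc L) : Prop :=
  ∀ P Q : Proc L, P.subst (fun n => v (f n)) = Y → Q.subst (fun n => v (f n)) = Z →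
    CongStar (FrameRel R) P Q

/-- The binders `0, …, j - 1` become the variables `f 0, …, f (j - 1)` of a scope outside `k`
binders. -/
def openBlock (f : ℕ → ℕ) (j k : ℕ) : Subst L := fun n => if n < j then v (f n + k) else v (n - j)

theorem openBlock_lt {f : ℕ → ℕ} {j k n : ℕ} (h : n < j) : (openBlock f j k n : Msg L) = v (f n + k) :=
  if_pos h

theorem openBlock_ge {f : ℕ → ℕ} {j k n : ℕ} (h : j ≤ n) : (openBlock f j k n : Msg L) = v (n - j) :=
  if_neg (by omega)

theorem openBlock_add {f : ℕ → ℕ} {j k n : ℕ} : (openBlock f j k (n + j) : Msg L) = v n := by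
  rw [openBlock_ge (by omega), Nat.add_sub_cancel]

theorem shift_openBlock (f : ℕ → ℕ) (j k : ℕ) (M : Msg L) :
    (Msg.shift j M).subst (openBlock f j k) = M := by
  simp only [Msg.shift_subst, openBlock_add, Msg.subst_v]

theorem Proc.shift_openBlock (f : ℕ → ℕ) (j k : ℕ) (P : Proc L) :
    (P.shift j).subst (openBlock f j k) = P := by
  simp only [Proc.shift_subst, openBlock_add, Proc.subst_v]

theorem exists_nusP_of_subst {k : ℕ} {P Y : Proc L} {s : Subst L} (h : P.subst s = nusP k Y) :
    ∃ P', P = nusP k P' ∧ P'.subst (upN k s) = Y := by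
  induction k generalizing P s with
  | zero => exact ⟨P, rfl, by rw [upN_zero]; exact h⟩
  | succ k ih =>
    cases P <;> simp only [Proc.subst, nusP, reduceCtorEq, Proc.nu.injEq] at h
    obtain ⟨P', rfl, h'⟩ := ih h
    exact ⟨P', rfl, by rwa [upN_up] at h'⟩

/-- The `j` inner binders, created by a component common to both sides, are moved outside the
private binders of the frames. There they are closed by a context `ν`, so it is enough to relate the
processes with these names as free odd variables. -/
theorem RelatedVia.of_openBlock {f f' : ℕ → ℕ} (hR : IsOpenBisimulation Ax R) {j k l : ℕ}
    (hf : ∀ n, f' (n + j) = f n) {Y Z : Proc L}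
    (h : RelatedVia R f' (nusP k (Y.subst (openBlock f' j k))) (nusP l (Z.subst (openBlock f' j l)))) :
    RelatedVia R f (nusP (k + j) Y) (nusP (l + j) Z) := by
  intro P Q hP hQ
  obtain ⟨P, rfl, hP'⟩ := exists_nusP_of_subst hP
  obtain ⟨Q, rfl, hQ'⟩ := exists_nusP_of_subst hQ
  have key : ∀ {k : ℕ} {P Y : Proc L}, P.subst (upN (k + j) fun n => v (f n)) = Y →
      (nusP k (P.subst fun n => v (swp j k n))).subst (fun n => v (f' n)) =
        nusP k (Y.subst (openBlock f' j k)) := by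
    rintro k P _ rfl
    rw [nusP_subst, Proc.subst_subst, Proc.subst_subst, upN_ren, upN_ren]
    congr 2
    funext n
    rw [v_subst, swp]
    rcases lt_or_ge n j with h1 | h1
    · simp only [if_pos h1, if_pos (show n < k + j by omega), if_neg (show ¬ n + k < k by omega),
        v_subst, openBlock_lt h1, Nat.add_sub_cancel]
    · rcases lt_or_ge n (k + j) with h2 | h2
      · simp only [if_neg (show ¬ n < j by omega), if_pos (show n < j + k by omega), if_pos h2,
          if_pos (show n - j < k by omega), v_subst, openBlock_ge h1]
      · simp only [if_neg (show ¬ n < j by omega), if_neg (show ¬ n < j + k by omega),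
          if_neg (show ¬ n < k by omega), if_neg (show ¬ n < k + j by omega), v_subst, ← hf]
        rw [openBlock_ge (by omega), show n - (k + j) + j = n - k by omega]
        congr 1
        omega
  have hmid := h _ _ (key hP') (key hQ')
  have h1 : Cong (FrameRel R) (nusP (k + j) P) (nusP (j + k) _) := Cong.swap j k P
  have h2 : Cong (FrameRel R) (nusP (l + j) Q) (nusP (j + l) _) := Cong.swap j l Q
  rw [← nusP_nusP j] at h1 h2
  exact .head h1 ((hmid.nusP j).tail (h2.symm fun h => h.symm hR))

/-- The process obtained from a commitment below `k` binders by applying it to `M` and placing it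
next to `Us`. In `Us`, index `0` stands for the payload of an output, and for `M` otherwise; the
other variables and the variables of `M` refer to the frame `s`. -/
def framedPlug (c : CLab L) (s : Subst L) (k : ℕ) (M : Msg L) (j : ℕ) (N : Option (Msg L))
    (P : Proc L) (Us : List (Bool × Proc L)) : Proc L :=
  nusP (k + j) (wrap (scons (N.getD (Msg.shift j (M.subst s))) fun n => Msg.shift j (s n)) Us
    (c.body P (Msg.shift j (M.subst s))))

/-- Commitments of framed processes that are related in all contexts. -/
def FramedMatches (R : History L → EProc L → EProc L → Prop) (c : CLab L) (s : Subst L) (k j : ℕ)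
    (N : Option (Msg L)) (P : Proc L) (t : Subst L) (l i : ℕ) (N' : Option (Msg L)) (Q : Proc L) :
    Prop :=
  ∀ f, Adm f → ∀ M Us, RelatedVia R f (framedPlug c s k M j N P Us) (framedPlug c t l M i N' Q Us)

theorem RelatedVia.of_framedPair {f : ℕ → ℕ} (hf : Adm f) {h : History L} {k l : ℕ} {θ ρ : Subst L}
    {P Q : Proc L} (hF : FramedPair R h k θ P l ρ Q) (Ts : List (Bool × Proc L)) :
    RelatedVia R f (nusP k (wrap (fr k θ) Ts P)) (nusP l (wrap (fr l ρ) Ts Q)) :=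
  fun _ _ hP hQ => .single (.base ⟨Ts, hf, hF, hP, hQ⟩)

end Generated

/-! ### Commitments of framed pairs -/

section FramedSteps

variable {L : FirstOrder.Language.{u, w}} {Ax : Msg L → Msg L → Prop}

/-- The history after an action. -/
def History.extend (h : History L) (c : CLab L) (x : ℕ) : History L :=
  match c with
  | .tau => h
  | .out _ => h.out x
  | .inp _ => h.inp (v x)

theorem notMem_fv_nus_base {k x : ℕ} {θ : Subst L} {P : Proc L} :
    x ∉ (EProc.nus k (.base θ P)).fv ↔
      θ (x + k) = v (x + k) ∧ (∀ y ∈ θ.dom, x + k ∉ Msg.fv (θ y)) ∧ x + k ∉ P.fv := by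
  rw [mem_fv_nus]
  simp only [EProc.fv, Set.mem_union, not_or, Subst.dom, Set.mem_ofPred_eq, not_not, not_exists,
    not_and, and_assoc]

theorem fr_upN (k j : ℕ) (θ : Subst L) (n : ℕ) :
    fr (k + j) (upN j θ) n = Msg.shift j (fr k θ n) := by
  rw [fr, ← Nat.add_assoc, upN_add]; rfl

theorem dom_upN {k j : ℕ} {θ : Subst L} (hd : ∀ x ∈ θ.dom, ∃ n ∈ Ev, x = n + k) :
    ∀ x ∈ (upN j θ).dom, ∃ n ∈ Ev, x = n + (k + j) := by
  intro x hx
  rcases lt_or_ge x j with h | h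
  · exact absurd (upN_lt θ h) hx
  · obtain ⟨m, rfl⟩ := Nat.exists_eq_add_of_le' h
    obtain ⟨n, hn, rfl⟩ := hd m fun he => hx (by rw [upN_add, he, shift_v])
    exact ⟨n, hn, Nat.add_assoc _ _ _⟩

theorem dom_comp_single {x : ℕ} {θ : Subst L} {N : Msg L} {y : ℕ}
    (hy : y ∈ (θ.comp (Subst.single x N)).dom) : y ∈ θ.dom ∨ y = x := by
  by_contra hne
  rw [not_or] at hne
  have h1 : θ y = v y := not_not.1 hne.1
  exact hy (by simp only [Subst.comp, h1, v_subst, Subst.single, if_neg hne.2])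

theorem comp_id (θ : Subst L) : θ.comp Subst.id = θ := by
  funext n; exact Msg.subst_v _

theorem framedPlug_none {c : CLab L} {k j : ℕ} {θ : Subst L} (M : Msg L) (P : Proc L)
    (Us : List (Bool × Proc L)) :
    framedPlug c (fr k θ) k M j none P Us =
      nusP (k + j) (wrap (fr (k + j) (upN j θ)) (substAll Us (scons M fun n => v n))
        (c.body P (Msg.shift j (M.subst (fr k θ))))) := by
  rw [framedPlug, wrap_substAll]
  congr 2
  funext n
  cases n with
  | zero =>
    simp only [scons_zero, Option.getD_none, Msg.shift, Msg.subst_subst]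
    congr 1
    funext n
    rw [fr_upN]; rfl
  | succ n => simp only [scons_succ, v_subst, fr_upN]

theorem mem_fv_nusP {k n : ℕ} {P : Proc L} : n ∈ (nusP k P).fv ↔ n + k ∈ P.fv := by
  induction k generalizing n with
  | zero => rfl
  | succ k ih =>
    simp only [nusP, Proc.fv, Set.mem_ofPred_eq, ih]
    rw [Nat.add_assoc, Nat.add_comm 1 k]

theorem mem_fv_pair {b : Bool} {P T : Proc L} {n : ℕ} :
    n ∈ (pair b P T).fv ↔ n ∈ P.fv ∨ n ∈ T.fv := by
  cases b
  · exact or_comm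
  · rfl

theorem mem_fv_wrap {s : Subst L} {Us : List (Bool × Proc L)} {P : Proc L} {U : Bool × Proc L}
    (hU : U ∈ Us) {n : ℕ} (hn : n ∈ (U.2.subst s).fv) : n ∈ (wrap s Us P).fv := by
  induction Us with
  | nil => cases hU
  | cons V Us ih =>
    rw [wrap, mem_fv_pair]
    rcases List.mem_cons.1 hU with rfl | hU
    · exact Or.inr hn
    · exact Or.inl (ih hU)

theorem wrap_congr {s t : Subst L} {Us : List (Bool × Proc L)} {P : Proc L}
    (h : ∀ U ∈ Us, ∀ n ∈ U.2.fv, s n = t n) : wrap s Us P = wrap t Us P := by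
  induction Us with
  | nil => rfl
  | cons V Us ih =>
    rw [wrap, wrap, ih fun U hU => h U (List.mem_cons_of_mem _ hU),
      Proc.subst_congr (h V List.mem_cons_self)]

/-- After an output the payload is stored in the frame under `x`, and components use the recipe `x`
for it. The second freshness hypothesis ensures that no component used `x` before, since the
extended frame would capture it. -/
theorem framedPlug_some {a : Msg L} {k j x : ℕ} {θ : Subst L} {M N : Msg L} {P P₀ : Proc L}
    {Us : List (Bool × Proc L)} (hx : x ∉ (EProc.nus k (.base θ P₀)).fv)
    (hU : x ∉ (framedPlug (.out a) (fr k θ) k M j (some N) P Us).fv) :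
    framedPlug (.out a) (fr k θ) k M j (some N) P Us =
      nusP (k + j) (wrap (fr (k + j) ((upN j θ).comp (Subst.single (x + k + j) N)))
        (substAll Us (scons (v x) fun n => v n)) P) := by
  obtain ⟨h1, h2, -⟩ := notMem_fv_nus_base.1 hx
  rw [framedPlug, mem_fv_nusP] at hU
  rw [framedPlug, wrap_substAll]
  refine congrArg _ (wrap_congr fun U hUs n hn => ?_)
  cases n with
  | zero =>
    simp only [scons_zero, v_subst, fr, Subst.comp, Option.getD_some, ← Nat.add_assoc, upN_add, h1,
      shift_v, Subst.single, if_true]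
  | succ n =>
    simp only [scons_succ, v_subst, fr, Subst.comp, ← Nat.add_assoc, upN_add]
    by_cases hnx : n = x
    · subst hnx
      refine absurd (mem_fv_wrap hUs (Proc.mem_fv_subst.2 ⟨_, hn, ?_⟩)) hU
      simp only [scons_succ, fr, h1, shift_v, Msg.fv_var, Set.mem_singleton_iff, Nat.add_assoc]
    · conv_lhs => rw [← Msg.subst_v (Msg.shift j (θ (n + k)))]
      refine Msg.subst_congr fun m hm => ?_
      rw [Subst.single, if_neg]
      rintro rfl
      rw [Msg.add_mem_fv_shift] at hm
      by_cases hd : θ (n + k) = v (n + k)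
      · rw [hd, Msg.fv_var, Set.mem_singleton_iff] at hm
        omega
      · exact h2 _ hd hm

theorem notMem_fv_ren {f : ℕ → ℕ} (hf : Adm f) {P : Proc L} {x : ℕ} (hx : x ∈ Ev) :
    x ∉ (P.subst fun n => v (f n)).fv := by
  rw [Proc.mem_fv_subst]
  rintro ⟨n, -, hn⟩
  rw [Msg.fv_var, Set.mem_singleton_iff] at hn
  exact hf.odd n (hn ▸ hx)

/-- Here the substitution may introduce domain variables, so `θ` is applied once more; this is what
evaluates the recipe `M` to the message actually received. The frame does not mention `x` and is
unchanged. -/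
theorem normSubst_single {k x : ℕ} {θ : Subst L} {P : Proc L} (M : Msg L)
    (hN : (EProc.nus k (.base θ (P.inst (v (x + k))))).Normal) (hP : x + k + 1 ∉ P.fv)
    (h2 : ∀ y ∈ θ.dom, x + k ∉ Msg.fv (θ y)) :
    NormSubst (EProc.nus k (.base θ (P.inst (v (x + k))))) (Subst.single x M)
      (EProc.nus k (.base θ (P.inst (M.subst (fr k θ))))) := by
  rw [normal_nus_base] at hN
  have hsing : ∀ n, n ≠ x + k → upN k (Subst.single x M) n = v n := by
    intro n hn
    rcases lt_or_ge n k with h | h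
    · exact upN_lt _ h
    · obtain ⟨m, rfl⟩ := Nat.exists_eq_add_of_le' h
      rw [upN_add, Subst.single, if_neg fun he => hn (by rw [he]), shift_v]
  have hθ : ∀ y ∈ θ.dom, ∀ n ∈ Msg.fv (θ y), θ n = v n := fun y _ n hn => by
    by_contra hne
    exact (hN.2 n hne).2.2 y hn
  have hres : ((P.inst (v (x + k))).subst (upN k (Subst.single x M))).subst θ =
      P.inst (M.subst (fr k θ)) := by
    rw [Proc.inst_eq, Proc.inst_eq, Proc.subst_subst, Proc.subst_subst]
    refine Proc.subst_congr fun n hn => ?_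
    cases n with
    | zero =>
      simp only [scons_zero, v_subst, upN_add, Subst.single, if_true, Msg.shift_subst]
      rfl
    | succ n =>
      have hnx : n ≠ x + k := fun he => hP (he ▸ hn)
      simp only [scons_succ, v_subst, hsing n hnx]
      by_contra hne
      refine (hN.2 n hne).2.1 ?_
      rw [Proc.inst_eq, Proc.mem_fv_subst]
      exact ⟨n + 1, hn, by rw [scons_succ, Msg.fv_var]; rfl⟩
  refine NormSubst.nus ?_
  have := NormSubst.base (θ := θ) (θ' := θ) (σ := upN k (Subst.single x M))
    (P := P.inst (v (x + k))) rfl ?_ ?_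
  · rwa [hres] at this
  · intro y
    rw [Set.disjoint_right]
    exact fun n hn => (hN.2 n hn).2.2 y
  · intro y hy
    conv_lhs => rw [← Msg.subst_v (θ y)]
    rw [Msg.subst_subst]
    refine Msg.subst_congr fun n hn => ?_
    rw [hsing n fun he => h2 y hy (he ▸ hn), v_subst, hθ y hy n hn]

variable {R : History L → EProc L → EProc L → Prop} {h : History L} {k l : ℕ} {θ ρ : Subst L}
  {P Q : Proc L}

/-- The commitment is performed as a late action with a fresh even bound name, answered by the open
bisimulation, and the answer is read back as a commitment. -/
theorem FramedPair.exists_target (hR : IsOpenBisimulation Ax R) (hF : FramedPair R h k θ P l ρ Q)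
    {E : Set ℕ} (E' : Set ℕ) {c : CLab L} {j : ℕ} {N : Option (Msg L)} {P' : Proc L}
    (hs : CStep Ax E P (c.subst (fr k θ)) j N P') :
    ∃ x ∈ Ev, x ∉ (EProc.nus k (.base θ P)).fv ∧ x ∉ (EProc.nus l (.base ρ Q)).fv ∧ x ∉ h.fv ∧
      ∃ i N' Q', CStep Ax E' Q (c.subst (fr l ρ)) i N' Q' ∧
        R (h.extend c x) (target k θ c x j N P') (target l ρ c x i N' Q') := by
  obtain ⟨hA, hB⟩ := hR.normal hF.rel
  have hinf : Ev.Infinite :=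
    Set.infinite_of_injective_forall_mem (f := fun n => 2 * n)
      (fun a b hab => by simpa using hab) fun n => even_two_mul n
  have hfin : ((EProc.nus k (.base θ P)).fv ∪ (EProc.nus l (.base ρ Q)).fv ∪ h.fv ∪
      {n | n + k ∈ (c.subst (fr k θ)).fv}).Finite :=
    (((fv_nus_base_finite (normal_nus_base.1 hA).1).union
      (fv_nus_base_finite (normal_nus_base.1 hB).1)).union h.fv_finite).union
      (finite_preimage_add (CLab.fv_finite _) k)
  obtain ⟨x, hx, hxn⟩ := hinf.exists_notMem_finite hfin
  simp only [Set.mem_union, Set.mem_ofPred_eq, not_or] at hxn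
  obtain ⟨⟨⟨hxA, hxB⟩, hxh⟩, hxc⟩ := hxn
  have hstep := hs.toELStep hF.mfL hxA hxc
  refine ⟨x, hx, hxA, hxB, hxh, ?_⟩
  have hxn : x ∉ (EProc.nus k (.base θ P)).fv ∪ (EProc.nus l (.base ρ Q)).fv ∪ h.fv := by
    simp only [Set.mem_union, not_or]; exact ⟨⟨hxA, hxB⟩, hxh⟩
  have : ∃ B', ELStep Ax (EProc.nus l (.base ρ Q)) (c.lact x) B' ∧
      R (h.extend c x) (target k θ c x j N P') B' := by
    cases c with
    | tau => exact hR.tau hF.rel _ hstep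
    | out M => exact hR.out hF.rel M x _ hxn hstep
    | inp M => exact hR.inp hF.rel M x _ hxn hstep
  obtain ⟨B', hB', hRB⟩ := this
  obtain ⟨i, N', Q', hQ, rfl⟩ := exists_cStep_of_elStep hB' E'
  exact ⟨i, N', Q', hQ, hRB⟩

/-- An output adds its bound name to the frame. For an input, the late answer is the same for all
messages; the pair is then instantiated at the recipe `M`. -/
theorem FramedPair.exists_framedMatches (hR : IsOpenBisimulation Ax R)
    (hF : FramedPair R h k θ P l ρ Q) {E : Set ℕ} (E' : Set ℕ) {c : CLab L} {j : ℕ}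
    {N : Option (Msg L)} {P' : Proc L} (hs : CStep Ax E P (c.subst (fr k θ)) j N P') :
    ∃ i N' Q', CStep Ax E' Q (c.subst (fr l ρ)) i N' Q' ∧
      FramedMatches R c (fr k θ) k j N P' (fr l ρ) l i N' Q' := by
  obtain ⟨x, hx, hxA, hxB, hxh, i, N', Q', hQ, hT⟩ := hF.exists_target hR E' hs
  refine ⟨i, N', Q', hQ, ?_⟩
  have hmf := hs.mismatchFree hF.mfL
  have hmf' := hQ.mismatchFree hF.mfR
  have hinst : ∀ {P : Proc L} {M : Msg L}, P.MismatchFree → (P.inst M).MismatchFree := by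
    intro P M hP
    rw [Proc.inst_eq]
    exact (Proc.mismatchFree_subst _).2 hP
  intro f hf M Us
  cases c with
  | tau =>
    obtain rfl := hs.eq_none (by rintro _ ⟨⟩)
    obtain rfl := hQ.eq_none (by rintro _ ⟨⟩)
    simp only [target, CLab.frame, comp_id, CLab.body, History.extend] at hT
    rw [framedPlug_none, framedPlug_none]
    exact .of_framedPair hf ⟨hT, hF.outs, hF.wf, dom_upN hF.domL, dom_upN hF.domR, hmf, hmf'⟩ _
  | out a =>
    obtain ⟨N, rfl⟩ := hs.exists_some
    obtain ⟨N', rfl⟩ := hQ.exists_some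
    simp only [target, CLab.frame, CLab.body, History.extend, Option.getD_some] at hT
    have hdom : ∀ {k j : ℕ} {θ : Subst L} {N : Msg L}, (∀ x ∈ θ.dom, ∃ n ∈ Ev, x = n + k) →
        ∀ y ∈ ((upN j θ).comp (Subst.single (x + k + j) N)).dom, ∃ n ∈ Ev, y = n + (k + j) := by
      intro k j θ N hd y hy
      rcases dom_comp_single hy with hy | rfl
      · exact dom_upN hd y hy
      · exact ⟨x, hx, Nat.add_assoc _ _ _⟩
    have hF' : FramedPair R (h.out x) _ _ _ _ _ _ := ⟨hT, ⟨hF.outs, hx⟩, ⟨hF.wf, rfl, fun y hy hxy => ?_⟩,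
      hdom hF.domL, hdom hF.domR, hmf, hmf'⟩
    · intro P₀ Q₀ hP₀ hQ₀
      -- All free variables of a process renamed by `f` are odd, so the even `x` does not occur.
      rw [framedPlug_some hxA (hP₀ ▸ notMem_fv_ren hf hx)] at hP₀
      rw [framedPlug_some hxB (hQ₀ ▸ notMem_fv_ren hf hx)] at hQ₀
      exact RelatedVia.of_framedPair hf hF' _ _ _ hP₀ hQ₀
    · rw [Subst.id, Msg.fv_var, Set.mem_singleton_iff] at hxy
      exact hxh (hxy ▸ hy)
  | inp a =>
    obtain rfl := hs.eq_none (by rintro _ ⟨⟩)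
    obtain rfl := hQ.eq_none (by rintro _ ⟨⟩)
    simp only [target, CLab.frame, comp_id, CLab.body, History.extend] at hT
    obtain ⟨hA, hB⟩ := hR.normal hT
    have hns : ∀ {E : Set ℕ} {k j : ℕ} {θ : Subst L} {P P' : Proc L} {a : Msg L},
        x ∉ (EProc.nus k (.base θ P)).fv → CStep Ax E P (.inp a) j none P' →
        (EProc.nus (k + j) (.base (upN j θ) (P'.inst (v (x + (k + j)))))).Normal →
        NormSubst (EProc.nus (k + j) (.base (upN j θ) (P'.inst (v (x + (k + j))))))
          (Subst.single x M)
          (EProc.nus (k + j) (.base (upN j θ) (P'.inst (Msg.shift j (M.subst (fr k θ)))))) := by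
      intro E k j θ P P' a hxP hs hN
      obtain ⟨-, h2, h3⟩ := notMem_fv_nus_base.1 hxP
      have : Msg.shift j (M.subst (fr k θ)) = M.subst (fr (k + j) (upN j θ)) := by
        rw [Msg.shift, Msg.subst_subst]
        congr 1
        funext n
        rw [fr_upN]; rfl
      rw [this]
      refine normSubst_single M hN ?_ ?_
      · intro hmem
        refine h3 ((hs.mem_fv (x + k)).1 ?_)
        simpa only [CLab.ar, ← Nat.add_assoc] using hmem
      · intro y hy hxy
        rcases lt_or_ge y j with hyj | hyj
        · exact hy (upN_lt _ hyj)
        · obtain ⟨m, rfl⟩ := Nat.exists_eq_add_of_le' hyj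
          rw [← Nat.add_assoc, upN_add, Msg.add_mem_fv_shift] at hxy
          exact h2 m (fun he => hy (by rw [upN_add, he, shift_v])) hxy
    -- `M` may contain output variables, so this substitution need not be fresh for the even
    -- variables. It is respectful because `x` is recorded as an input, after everything in `h`, and
    -- does not occur in `h`.
    have hresp : Respects (Subst.single x M) (h.inp (v x)) := by
      refine respects_of_eq (h := h) hF.wf fun n hn => if_neg ?_
      rintro rfl
      exact hxh hn
    have hT' := hR.subst hT _ hresp _ _ (hns hxA hs hA) (hns hxB hQ hB)
    rw [framedPlug_none, framedPlug_none]
    exact .of_framedPair hf ⟨hT', History.OutsEven.subst (h := h.inp (v x)) hF.outs _, hresp.id_subst,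
      dom_upN hF.domL, dom_upN hF.domR, hinst hmf, hinst hmf'⟩ _

end FramedSteps

/-! ### Commitments of framed pairs next to parallel components -/

section Components

variable {L : FirstOrder.Language.{u, w}} {Ax : Msg L → Msg L → Prop}

theorem framedPlug_pair (c : CLab L) (s : Subst L) (k : ℕ) (M : Msg L) (j : ℕ) (N : Option (Msg L))
    (b : Bool) (P T : Proc L) (Us : List (Bool × Proc L)) :
    framedPlug c s k M j N (pair b P ((T.subst s).shift (j + c.ar))) Us =
      framedPlug c s k M j N P (Us ++ [(b, T.shift 1)]) := by
  simp only [framedPlug, wrap_append, CLab.body_pair, CLab.body_shift, wrap, Proc.shift_subst,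
    scons_succ]
  simp only [Proc.shift, Proc.subst_subst]
  rfl

/-- Opened names are odd and thus untouched by the frame, so a message containing them is again a
recipe over the frame. -/
theorem upN_openBlock {f : ℕ → ℕ} (hf : ∀ n, f n ∉ Ev) {s : Subst L} {k : ℕ}
    (hs : ∀ n ∉ Ev, s n = v (n + k)) (j n : ℕ) :
    (upN j s n).subst (openBlock f j k) = (openBlock f j 0 n).subst s := by
  rcases lt_or_ge n j with h | h
  · rw [upN_lt _ h, v_subst, openBlock_lt h, openBlock_lt h, v_subst, Nat.add_zero, hs _ (hf n)]
  · rw [upN_ge _ h, openBlock_ge h, shift_openBlock, v_subst]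

theorem wrap_openBlock_right {f : ℕ → ℕ} (hf : ∀ n, f n ∉ Ev) {s : Subst L} {k : ℕ}
    (hs : ∀ n ∉ Ev, s n = v (n + k)) (c : CLab L) (M : Msg L) (j : ℕ) (N : Option (Msg L)) (b : Bool)
    (P T : Proc L) (Us Ts : List (Bool × Proc L)) :
    (wrap (scons ((N.map fun N => N.subst (upN j s)).getD (Msg.shift j (M.subst s)))
        fun n => Msg.shift j (s n)) Us
      (c.body (pair b ((wrap s Ts P).shift (j + c.ar)) (T.subst (upN (j + c.ar) s)))
        (Msg.shift j (M.subst s)))).subst (openBlock f j k) =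
    wrap s (substAll Us (scons ((N.getD (Msg.shift j M)).subst (openBlock f j 0)) fun n => v n) ++
      (b, (c.body T (Msg.shift j M)).subst (openBlock f j 0)) :: Ts) P := by
  have hN : (N.map fun N => N.subst (upN j s)).getD (Msg.shift j (M.subst s)) =
      (N.getD (Msg.shift j M)).subst (upN j s) := by
    cases N with
    | none => exact (Msg.shift_upN _ _ _).symm
    | some N => rfl
  have hT : c.body (T.subst (upN (j + c.ar) s)) (Msg.shift j (M.subst s)) =
      (c.body T (Msg.shift j M)).subst (upN j s) := by
    rw [CLab.body_subst, upN_upN, Msg.shift_upN, Nat.add_comm]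
  rw [wrap_subst, wrap_append, wrap_substAll, CLab.body_pair, CLab.body_shift, hT, hN, pair_subst,
    Proc.shift_openBlock, Proc.subst_subst]
  simp only [wrap, Proc.subst_subst, upN_openBlock hf hs]
  congr 1
  funext n
  cases n with
  | zero => simp only [scons_zero, Msg.subst_subst, upN_openBlock hf hs]
  | succ n => simp only [scons_succ, shift_openBlock, v_subst]

theorem wrap_openBlock_out_inp {f : ℕ → ℕ} (hf : ∀ n, f n ∉ Ev) {s : Subst L} {k : ℕ}
    (hs : ∀ n ∉ Ev, s n = v (n + k)) (M : Msg L) (j i : ℕ) (N : Msg L) (b : Bool) (P T : Proc L)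
    (Us : List (Bool × Proc L)) :
    (wrap (scons (Msg.shift (j + i) (M.subst s)) fun n => Msg.shift (j + i) (s n)) Us
      (pair b (P.shift i) ((T.subst (upN (i + 1) s)).subst (recv j i N)))).subst
        (openBlock f i (k + j)) =
    wrap (scons N fun n => Msg.shift j (s n))
      (substAll Us (scons (Msg.shift 1 M) (sh 1)) ++
        [(b, T.subst (Subst.up (openBlock f i 0)))]) P := by
  have hsh : ∀ M : Msg L, (Msg.shift (j + i) M).subst (openBlock f i (k + j)) = Msg.shift j M := by
    intro M
    rw [← Msg.shift_shift, shift_openBlock]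
  rw [wrap_subst, wrap_append, wrap_substAll, pair_subst, Proc.shift_openBlock]
  simp only [wrap, Proc.subst_subst]
  congr 1
  · funext n
    cases n with
    | zero =>
      simp only [scons_zero, hsh, Msg.shift_subst, scons_succ]
      simp only [Msg.shift, Msg.subst_subst]
    | succ n => simp only [scons_succ, hsh, sh_apply, v_subst]
  · congr 2
    funext n
    cases n with
    | zero =>
      rw [upN_lt _ (by omega), v_subst, recv, scons_zero, shift_openBlock]
      rfl
    | succ n =>
      rw [← up_upN]
      simp only [Subst.up, recv, Msg.shift_subst, scons_succ]
      rcases lt_or_ge n i with h | h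
      · simp only [upN_lt _ h, openBlock_lt h, v_subst, hs _ (hf n), shift_v, Nat.add_zero,
          Nat.add_assoc]
      · simp only [upN_ge _ h, openBlock_ge h, v_subst, Msg.shift_subst, Msg.subst_subst]
        simp only [Msg.shift]
        refine Msg.subst_congr fun m _ => ?_
        rw [upN_ge _ (by omega), Nat.add_sub_cancel, sh_apply, shift_v, v_subst, openBlock_add]

theorem wrap_openBlock_inp_out {f : ℕ → ℕ} (hf : ∀ n, f n ∉ Ev) {s : Subst L} {k : ℕ}
    (hs : ∀ n ∉ Ev, s n = v (n + k)) (M : Msg L) (j i : ℕ) (N : Msg L) (b : Bool) (P T : Proc L)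
    (Us : List (Bool × Proc L)) :
    (wrap (scons (Msg.shift (j + i) (M.subst s)) fun n => Msg.shift (j + i) (s n)) Us
      (pair b (P.subst (recv j i (N.subst (upN j s)))) ((T.subst (upN j s)).shift i))).subst
        (upN i (openBlock f j k)) =
    wrap (scons (Msg.shift i ((N.subst (openBlock f j 0)).subst s)) fun n => Msg.shift i (s n))
      (substAll Us (scons (Msg.shift 1 M) (sh 1)) ++ [(b, (T.subst (openBlock f j 0)).shift 1)])
      (P.inst (Msg.shift i ((N.subst (openBlock f j 0)).subst s))) := by
  have hsh : ∀ M : Msg L, (Msg.shift (j + i) M).subst (upN i (openBlock f j k)) = Msg.shift i M := by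
    intro M
    rw [← Msg.shift_shift, Msg.shift_upN, shift_openBlock]
  rw [wrap_subst, wrap_append, wrap_substAll, pair_subst, Proc.shift_upN, Proc.inst_eq]
  simp only [wrap, Proc.shift_subst, scons_succ, Proc.subst_subst, Msg.subst_subst,
    upN_openBlock hf hs]
  congr 1
  · funext n
    cases n with
    | zero =>
      simp only [scons_zero, hsh, Msg.shift_subst, scons_succ]
      simp only [Msg.shift, Msg.subst_subst]
    | succ n => simp only [scons_succ, hsh, sh_apply, v_subst]
  · congr 1
    · congr 1
      funext n
      cases n with
      | zero =>
        simp only [recv, scons_zero, Msg.shift_upN, Msg.subst_subst, upN_openBlock hf hs]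
      | succ n =>
        simp only [recv, scons_succ]
        rcases lt_or_ge n i with h | h
        · simp only [upN_lt _ h, v_subst]
        · simp only [upN_ge _ h, sh_apply, shift_v, v_subst]
          rw [upN_ge _ (by omega), show n - i + j + i - i = (n - i) + j by omega, openBlock_add,
            shift_v, Nat.sub_add_cancel h]
    · simp only [Proc.shift, Proc.subst_subst]
      congr 1
      funext n
      simp only [Msg.shift, Msg.subst_subst]

variable {R : History L → EProc L → EProc L → Prop} {h : History L} {k l : ℕ} {θ ρ : Subst L}
  {P Q : Proc L}

/-- Induction on the components. A move of the inner part is matched by hypothesis, a move of the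
component `T` is replayed over `ρ` by `CStep.transfer`, and a communication combines both, with the
names created by `T` opened into fresh odd variables. -/
theorem FramedPair.exists_wrap (hR : IsOpenBisimulation Ax R)
    (hF : FramedPair R h k θ P l ρ Q) {E : Set ℕ} (hE : Ev ⊆ E) (Ts : List (Bool × Proc L))
    {c : CLab L} {j : ℕ} {N : Option (Msg L)} {P' : Proc L}
    (hs : CStep Ax (extendEnvN k E) (wrap (fr k θ) Ts P) (c.subst (fr k θ)) j N P') :
    ∃ i N' Q', CStep Ax (extendEnvN l E) (wrap (fr l ρ) Ts Q) (c.subst (fr l ρ)) i N' Q' ∧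
      FramedMatches R c (fr k θ) k j N P' (fr l ρ) l i N' Q' := by
  induction Ts generalizing c j N P' with
  | nil => exact hF.exists_framedMatches hR _ hs
  | cons T Ts ih =>
    obtain ⟨b, T⟩ := T
    have htr := hF.transfer hR hE
    have hoddL : ∀ n ∉ Ev, fr k θ n = v (n + k) := fun n => fr_odd hF.domL
    have hoddR : ∀ n ∉ Ev, fr l ρ n = v (n + l) := fun n => fr_odd hF.domR
    rcases CStep.pair_cases hs with ⟨P₁, rfl, h1⟩ | ⟨T₁, rfl, h1⟩ |
      ⟨j', i, a, N₁, N₂, P₁, T₁, hc, rfl, rfl, rfl, h1, h2⟩ |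
      ⟨j', i, a, N₁, N₂, P₁, T₁, hc, rfl, rfl, rfl, h1, h2⟩
    · obtain ⟨i, N', Q₁, h2, hm⟩ := ih h1
      refine ⟨i, N', _, h2.pair_left b (T.subst (fr l ρ)), fun f hf M Us => ?_⟩
      rw [CLab.ar_subst, CLab.ar_subst, framedPlug_pair, framedPlug_pair]
      exact hm f hf M _
    · obtain ⟨c₀, N₀, T₀, he, rfl, rfl, h2⟩ := h1.transfer htr rfl
      refine ⟨j, _, _, (h2.relabel (htr.equiv he)).pair_right b (wrap (fr l ρ) Ts Q),
        fun f hf M Us => ?_⟩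
      obtain ⟨f', hf', hff⟩ := hf.exists_extend j
      refine RelatedVia.of_openBlock hR hff ?_
      rw [CLab.ar_subst, CLab.ar_subst, wrap_openBlock_right hf'.odd hoddL,
        wrap_openBlock_right hf'.odd hoddR]
      exact .of_framedPair hf' hF _
    · cases c <;> simp only [CLab.subst, reduceCtorEq] at hc
      obtain rfl := h2.eq_none (by rintro _ ⟨⟩)
      obtain ⟨c₀, N₀, T₀, he, -, rfl, h3⟩ := h2.transfer htr rfl
      cases c₀ <;> cases he
      next a₀ he =>
      obtain ⟨i', N', Q₁, h4, hm⟩ := ih (c := .out a₀) (h1.relabel (.out he.symm))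
      obtain ⟨N', rfl⟩ := h4.exists_some
      refine ⟨i' + i, none, _, h4.pair_out_inp b h3, fun f hf M Us => ?_⟩
      obtain ⟨f', hf', hff⟩ := hf.exists_extend i
      unfold framedPlug
      rw [← Nat.add_assoc, ← Nat.add_assoc]
      refine RelatedVia.of_openBlock hR hff ?_
      -- For the output, index `0` stands for the payload, which the residual of `T` receives; the
      -- old components are re-indexed so that their index `0` still stands for `M`.
      have := hm f' hf' M (substAll Us (scons (Msg.shift 1 M) (sh 1)) ++
        [(b, T₀.subst (Subst.up (openBlock f' i 0)))])
      unfold framedPlug at this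
      simp only [CLab.body, CLab.ar, Option.getD_none, Option.getD_some] at this ⊢
      rw [wrap_openBlock_out_inp hf'.odd hoddL, wrap_openBlock_out_inp hf'.odd hoddR]
      exact this
    · cases c <;> simp only [CLab.subst, reduceCtorEq] at hc
      obtain rfl := h2.eq_none (by rintro _ ⟨⟩)
      obtain ⟨c₀, N₀, T₀, he, hN, rfl, h3⟩ := h1.transfer htr rfl
      cases N₀ with
      | none => cases hN
      | some N₀ =>
      obtain rfl := Option.some.inj hN
      cases c₀ <;> cases he
      next a₀ he =>
      obtain ⟨i', N', Q₁, h4, hm⟩ := ih (c := .inp a₀) (h2.relabel (.inp he.symm))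
      obtain rfl := h4.eq_none (by rintro _ ⟨⟩)
      refine ⟨j' + i', none, _, CStep.pair_inp_out b h3 h4, fun f hf M Us => ?_⟩
      obtain ⟨f', hf', hff⟩ := hf.exists_extend j'
      unfold framedPlug
      rw [← Nat.add_assoc, ← Nat.add_assoc, ← nusP_nusP, ← nusP_nusP (l + j')]
      refine RelatedVia.of_openBlock hR hff ?_
      -- The message received by the inner part is the payload of `T` with its private names opened,
      -- which is a recipe over both frames.
      have := hm f' hf' (N₀.subst (openBlock f' j' 0)) (substAll Us (scons (Msg.shift 1 M) (sh 1)) ++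
        [(b, (T₀.subst (openBlock f' j' 0)).shift 1)])
      unfold framedPlug at this
      simp only [CLab.body, Option.getD_none] at this ⊢
      rw [nusP_subst, nusP_subst, nusP_nusP, nusP_nusP]
      simp only [CLab.ar, Nat.add_zero]
      rw [wrap_openBlock_inp_out hf'.odd hoddL, wrap_openBlock_inp_out hf'.odd hoddR]
      exact this

/-! ### Simulation -/

theorem plug_ren {f : ℕ → ℕ} {s : Subst L} {k : ℕ} (hs : ∀ n, s (f n) = v (f n + k)) (c : CLab L)
    (M : Msg L) (j : ℕ) (N : Option (Msg L)) (P : Proc L) (Us : List (Bool × Proc L)) :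
    (plug c M (j + k) N P Us).subst (fun n => v (f n)) =
      framedPlug (c.subst fun n => v (f n)) s k (M.subst fun n => v (f n)) j
        (N.map fun M => M.subst (upN (j + k) fun n => v (f n)))
        (P.subst (upN (j + k + c.ar) fun n => v (f n)))
        (substAll Us (Subst.up fun n => v (f n))) := by
  have hM : Msg.shift j ((M.subst fun n => v (f n)).subst s) =
      (Msg.shift (j + k) M).subst (upN (j + k) fun n => v (f n)) := by
    rw [Msg.shift_upN]
    simp only [Msg.shift, Msg.subst_subst, v_subst, hs, Nat.add_assoc, Nat.add_comm j k]
  have hN : (N.map fun M => M.subst (upN (j + k) fun n => v (f n))).getD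
      ((Msg.shift (j + k) M).subst (upN (j + k) fun n => v (f n))) =
      (N.getD (Msg.shift (j + k) M)).subst (upN (j + k) fun n => v (f n)) := by
    cases N <;> rfl
  rw [plug, framedPlug, nusP_subst, wrap_subst, wrap_substAll, CLab.body_subst_label, hM,
    CLab.body_subst, upN_upN, hN, Nat.add_comm c.ar, Nat.add_comm k j]
  congr 2
  funext n
  cases n with
  | zero => rfl
  | succ n =>
    simp only [scons_succ, sh_apply, v_subst, upN_add, Subst.up, shift_v, hs,
      Nat.add_assoc, Nat.add_comm j k]

/-- The commitment is carried along `f` to the framed form, matched there by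
`FramedPair.exists_wrap`, and carried back. -/
theorem FrameRel.sim (hR : IsOpenBisimulation Ax R) {P Q : Proc L} (h : FrameRel R P Q) :
    Sim Ax (FrameRel R) P Q := by
  obtain @⟨f, _, k, l, θ, ρ, P₁, Q₁, Ts, hf, hF, hP, hQ⟩ := h
  intro E hE c j N P' hs
  -- Since `f` avoids the even variables, they can be added to the environment for free;
  -- `FramedPair.transfer` needs them there.
  have hren : RenEnv f E (f '' E ∪ Ev) := by
    refine ⟨hf.inj, fun n => ⟨?_, fun hn => Or.inl ⟨n, hn, rfl⟩⟩⟩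
    rintro (⟨m, hm, he⟩ | hn)
    · exact hf.inj he ▸ hm
    · exact absurd hn (hf.odd n)
  have hlab : ∀ {k : ℕ} {θ : Subst L}, (∀ n ∉ Ev, fr k θ n = v (n + k)) →
      (c.subst fun n => v (f n)).subst (sh k) = (c.subst fun n => v (f n)).subst (fr k θ) := by
    intro k θ ho
    simp only [CLab.subst_subst, v_subst, sh_apply, ho _ (hf.odd _)]
  have hoddL : ∀ n ∉ Ev, fr k θ n = v (n + k) := fun n => fr_odd hF.domL
  have hoddR : ∀ n ∉ Ev, fr l ρ n = v (n + l) := fun n => fr_odd hF.domR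
  have h1 := hs.ren hren hE
  rw [hP] at h1
  obtain ⟨j, rfl, h2⟩ := h1.nusP_inv
  rw [hlab hoddL] at h2
  obtain ⟨i, N', Q', h3, hm⟩ := hF.exists_wrap hR Set.subset_union_right Ts h2
  rw [← hlab hoddR] at h3
  have h4 := h3.nusP
  rw [← hQ] at h4
  obtain ⟨N₀, Q₀, h5, rfl, rfl⟩ := h4.unren hren
  refine ⟨i + l, N₀, Q₀, h5, fun M Us => ?_⟩
  exact hm f hf _ _ _ _ (plug_ren (fun n => hoddL _ (hf.odd n)) c M j N P' Us)
    (plug_ren (fun n => hoddR _ (hf.odd n)) c M i N₀ Q₀ Us)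

theorem History.outsEven_inps {h : History L} (hh : h.OutsEven) (xs : List ℕ) :
    (h.inps xs).OutsEven := by
  induction xs generalizing h with
  | nil => exact hh
  | cons x xs ih => exact ih (h := h.inp (v x)) hh

theorem respects_inps {h : History L} {σ : Subst L} (hσ : Respects σ h) (xs : List ℕ) :
    Respects σ (h.inps xs) := by
  induction xs generalizing h with
  | nil => exact hσ
  | cons x xs ih => exact ih (h := h.inp (v x)) hσ

/-- A history of inputs restricts no substitution, so the free variables may be renamed to `4 * n +
1`, with empty frames and no components. -/
theorem frameRel_of_inps (hR : IsOpenBisimulation Ax R) {P Q : Proc L} (hP : P.MismatchFree)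
    (hQ : Q.MismatchFree) {xs : List ℕ} (h : R (History.nil.inps xs) P.toEProc Q.toEProc) :
    FrameRel R P Q := by
  have hdom : (Subst.id : Subst L).dom = ∅ := by
    ext x; simp [Subst.dom, Subst.id]
  have hns : ∀ (P : Proc L) (σ : Subst L), NormSubst P.toEProc σ (P.subst σ).toEProc := by
    intro P σ
    have := NormSubst.base (θ := Subst.id) (θ' := Subst.id) (σ := σ) (P := P) rfl
      (by rw [hdom]; exact fun _ => Set.disjoint_empty _) (by rw [hdom]; exact fun x hx => hx.elim)
    rwa [show (P.subst σ).subst Subst.id = P.subst σ from Proc.subst_v _] at this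
  have hresp : Respects (fun n => v (4 * n + 1) : Subst L) (History.nil.inps xs) :=
    respects_inps (h := .nil) trivial xs
  have hfr : ∀ x ∈ (Subst.id : Subst L).dom, ∃ n ∈ Ev, x = n + 0 := by
    rw [hdom]; exact fun x hx => hx.elim
  refine .intro (f := fun n => 4 * n + 1) [] adm_four_mul ⟨hR.subst h _ hresp _ _ (hns P _) (hns Q _),
    (History.outsEven_inps (h := .nil) trivial xs).subst _, hresp.id_subst, hfr, hfr,
    (Proc.mismatchFree_subst _).2 hP, (Proc.mismatchFree_subst _).2 hQ⟩ rfl rfl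

end Components

/-! ### Open barbed bisimilarity -/

section Soundness

variable {L : FirstOrder.Language.{u, w}} {Ax : Msg L → Msg L → Prop}
  {D : Proc L → Proc L → Prop}

/-- A capturing binder renames the free variable of the hole to the bound index, so closure of `D`
under substitution is needed. -/
theorem CongStar.fill (hD : ∀ {P Q : Proc L}, D P Q → ∀ s, D (P.subst s) (Q.subst s)) {P Q : Proc L}
    (h : CongStar D P Q) (C : Ctx L) : CongStar D (C.fill P) (C.fill Q) := by
  induction C with
  | hole => exact h
  | out M N C ih => exact Relation.ReflTransGen.lift (Proc.out M N) (fun _ _ h => Cong.out h) _ _ ih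
  | inp M x C ih =>
    exact Relation.ReflTransGen.lift (Proc.inpVar M x) (fun _ _ h => Cong.inp (h.subst hD _)) _ _ ih
  | mat M N C ih => exact Relation.ReflTransGen.lift (Proc.mat M N) (fun _ _ h => Cong.mat h) _ _ ih
  | mismat M N C ih =>
    exact Relation.ReflTransGen.lift (Proc.mismat M N) (fun _ _ h => Cong.mismat h) _ _ ih
  | nu x C ih =>
    exact Relation.ReflTransGen.lift (Proc.nuVar x) (fun _ _ h => Cong.nu (h.subst hD _)) _ _ ih
  | parL C Q ih => exact ih.pair true Q
  | parR P C ih => exact ih.pair false P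
  | sumL C Q ih =>
    exact Relation.ReflTransGen.lift (fun P => Proc.sum P Q) (fun _ _ h => Cong.sumL h) _ _ ih
  | sumR P C ih =>
    exact Relation.ReflTransGen.lift (Proc.sum P) (fun _ _ h => Cong.sumR h) _ _ ih
  | rep C ih => exact Relation.ReflTransGen.lift Proc.rep (fun _ _ h => Cong.rep h) _ _ ih

/-- Each single link of a chain answers a commitment by one commitment, with residuals related by a
chain. So a challenge can be passed along the whole chain, by induction on its length. -/
theorem isOpenBarbedBisimulation_congStar (hsymm : ∀ {P Q : Proc L}, D P Q → D Q P)
    (hsubst : ∀ {P Q : Proc L}, D P Q → ∀ s, D (P.subst s) (Q.subst s))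
    (hsim : ∀ {P Q : Proc L}, D P Q → Sim Ax D P Q) : IsOpenBarbedBisimulation Ax (CongStar D) := by
  have hcong : ∀ {P Q : Proc L}, Cong D P Q → Sim Ax D P Q := by
    intro P Q h
    have := h.sim_subst hsymm hsubst hsim (fun n => v n)
    rwa [Proc.subst_v, Proc.subst_v] at this
  refine ⟨fun h => ?_, fun h C => h.fill hsubst C, fun {P Q} h M hP => ?_, fun {P Q} h P' hP => ?_⟩
  · induction h with
    | refl => exact .refl
    | tail _ h ih => exact .head (h.symm hsymm) ih
  · induction h with
    | refl => exact hP
    | tail _ h ih =>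
      rw [hasBarb_iff] at ih ⊢
      obtain ⟨j, N, P', hs | hs⟩ := ih
      · obtain ⟨i, N', Q', hQ, -⟩ := hcong h ∅ Set.finite_empty _ _ _ _ hs
        exact ⟨i, N', Q', Or.inl hQ⟩
      · obtain ⟨i, N', Q', hQ, -⟩ := hcong h ∅ Set.finite_empty _ _ _ _ hs
        exact ⟨i, N', Q', Or.inr hQ⟩
  · induction h with
    | refl => exact ⟨P', hP, .refl⟩
    | tail _ h ih =>
      obtain ⟨Q', hQ, hPQ⟩ := ih
      obtain ⟨j, N, Q'', hs, rfl⟩ := tauStep_iff.1 hQ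
      obtain ⟨i, N', S, hS, hm⟩ := hcong h ∅ Set.finite_empty _ _ _ _ hs
      obtain rfl := hs.eq_none (by rintro _ ⟨⟩)
      obtain rfl := hS.eq_none (by rintro _ ⟨⟩)
      refine ⟨_, tauStep_iff.2 ⟨i, none, S, hS, rfl⟩, hPQ.trans ?_⟩
      exact hm (v 0) []

end Soundness

end AppliedPi

theorem mainTheorem7 {L : FirstOrder.Language.{u, w}}
    (Ax : AppliedPi.Msg L → AppliedPi.Msg L → Prop) (P Q : AppliedPi.Proc L)
    (hP : P.MismatchFree) (hQ : Q.MismatchFree)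
    (h : AppliedPi.OpenBisimilar Ax P Q) :
    AppliedPi.OpenBarbedBisimilar Ax P Q := by
  obtain ⟨R, hR, xs, -, hPQ⟩ := h
  exact ⟨_, AppliedPi.isOpenBarbedBisimulation_congStar (fun h => h.symm hR)
    (fun h s => h.subst hR s) (fun h => h.sim hR),
    .single (.base (AppliedPi.frameRel_of_inps hR hP hQ hPQ))⟩
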